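/- **Theorem (Estimator approximation).** *Meshes.* Fix integers $m,L\ge 1$. For $k=1,\dots,L$ let $N_k:=m2^{k-1}$ and let $\mathcal I_U^k:=\{0,\dots,N_k\}^2$ index the nodes $i/N_k$ of the uniform grid on $D=[0,1]^2$. Every grid square is cut along its diagonal from lower left to upper right into two triangles, which gives the mesh $\mathcal T_k$; let $T^1_{k,i},T^2_{k,i}$ be the triangles in the top right quadrant of node $i$ (they belong to $\mathcal T_k$ iff $i_1,i_2<N_k$). Let $\varphi_i^k$ be the piecewise linear nodal hat functions on level $k$. For index sets $\mathcal I_V^k\subset\mathcal I_U^k$, a triangle of $\mathcal T_k$ is called *active* if it lies in $\operatorname{supp}\varphi^k_i$ for some $i\in\mathcal I_V^k$, and the mask $M^k\in\{0,1\}^{2\times\mathcal I_U^k}$ has $M^k[q]_i=1$ iff $T^q_{k,i}$ is active. *Estimator.* Let $u_h=\sum_{k=1}^L\sum_{i\in\mathcal I_V^k}\mathbf u^k_i\varphi^k_i$, $\kappa_h=\sum_{i\in\mathcal I_U^L}\boldsymbol\kappa^L_i\varphi_i^L$ and $f_h=\sum_{i\in\mathcal I_U^L}\mathbf f^L_i\varphi_i^L$.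 For a triangle $T$ of $\mathcal T_k$, $k\le L$, let $h_T$ be its diameter and $$\mathrm r_T^2:=h_T^2\,\|f_h+\nabla\cdot(\kappa_h\nabla u_h)\|_{L^2(T)}^2,\qquad \mathrm j_T^2:=h_T\,\|[\![\kappa_h\nabla u_h]\!]\|_{L^2(\partial T)}^2,\qquad \eta_T^2:=\mathrm r_T^2+\mathrm j_T^2 ,$$ where the derivatives are taken piecewise and, at a point of an edge with adjacent gradients $\nabla u_h^{(1)},\nabla u_h^{(2)}$ and outer unit normals $n^{(1)}=-n^{(2)}$, $[\![\kappa_h\nabla u_h]\!]=\kappa_h(\langle\nabla u_h^{(1)},n^{(1)}\rangle+\langle\nabla u_h^{(2)},n^{(2)}\rangle)$; edges on $\partial D$ do not contribute. Let $\eta_k^2\in\mathbb R^{2\times\mathcal I_U^k}$ be the image with $\eta_k^2[q]_i=\eta^2_{T^q_{k,i}}$ if $T^q_{k,i}$ is active and $0$ otherwise. Let $\mathbf u^k_{\mathrm{img}}$ be $\mathbf u^k$ extended by $0$ to $\mathcal I_U^k$, and let $\boldsymbol\kappa^k_{\mathrm{img}},\mathbf f^k_{\mathrm{img}}$ be the nodal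 values of $\kappa_h,f_h$ on $\mathcal I_U^k$. *Networks.* Let the activation $\sigma\in L^\infty_{\mathrm{loc}}(\mathbb R)$ be three times continuously differentiable near some $x_0$ with $\sigma''(x_0)\ne0$. A CNN acts on families of multi-channel images on the levels $1,\dots,L$. In each layer, the channels of each level are either kept or replaced by a zero-padded convolution of the channels of that level, possibly together with a 2-strided convolution of those of the next finer level or a 2-transpose strided convolution of those of the next coarser level, plus one bias per channel, followed by $\sigma$ or by the identity. $M(\Psi)$ is the total number of kernel entries and biases. *Claim.* There is a constant $C>0$, independent of $\sigma,m,L,\varepsilon,M$, such that for all such $\sigma$, all $m,L\ge1$ and all $\varepsilon,M>0$ there is a CNN $\Psi:\mathbb R^{\times_{\ell=1}^L3\times\mathcal I_U^\ell}\to\mathbb R^{\times_{\ell=1}^L2\times\mathcal I_U^\ell}$ with $M(\Psi)\le CL$ such that, for all $\mathcal I_V^k\subset\mathcal I_U^k$ and all $\mathbf u^k,\boldsymbol\kappa^L,\mathbf f^L$ with entries in $[-M,M]$, $$\Big\|M^\ell\odot\Psi\Big(\bigtimes_{k=1}^L\mathbf u^k_{\mathrm{img}}\times\boldsymbol\kappa^k_{\mathrm{img}}\times\mathbf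 f^k_{\mathrm{img}}\Big)[\ell]-\eta_\ell^2\Big\|_{\ell^\infty}\le\varepsilon\qquad\text{for all }\ell=1,\dots,L .$$ Moreover, $\Psi$ can be chosen as a composition $A\circ\Phi$ of CNNs, where $\Phi$ outputs images on the finest level $L$ only, among them four channels that approximate the residual images $(\mathrm r^2_{T^q_{L,i}})_i$ and the jump images $(\mathrm j^2_{T^q_{L,i}})_i$, $q=1,2$, up to $\varepsilon$ at all $i$ with $T^q_{L,i}\in\mathcal T_L$, and where $A$ uses neither $\sigma$ nor transpose strided convolutions, so that it passes data between levels only by 2-strided convolutions from fine to coarse. -/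

import Mathlib

open MeasureTheory Filter Topology

noncomputable section

namespace MultilevelFE

/-! ### Uniformly refined meshes of the unit square -/

/-- The plane. -/
abbrev Plane : Type := EuclideanSpace ℝ (Fin 2)

/-- Number of cells per side on level `ℓ` (levels are counted from `0`, the coarsest one, which has
`m` cells per side). -/
abbrev cells (m ℓ : ℕ) : ℕ := m * 2 ^ ℓ

/-- The node indices of level `ℓ`: an `n × n` grid with `n = m * 2 ^ ℓ + 1` (boundary included). -/
abbrev Node (m ℓ : ℕ) : Type := Fin (cells m ℓ + 1) × Fin (cells m ℓ + 1)

/-- One-channel images on level `ℓ`: one pixel per node. -/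
abbrev Image (m ℓ : ℕ) : Type := Node m ℓ → ℝ

/-- The lattice point with indices `(a, b)` on level `ℓ`. -/
def gridPoint (m ℓ a b : ℕ) : Plane := !₂[(a : ℝ) / cells m ℓ, (b : ℝ) / cells m ℓ]

/-- Index offsets of the vertices of the two triangles in the top right quadrant of a node,
counterclockwise; the square is cut along the diagonal from lower left to upper right. -/
def vertexOffset : Fin 2 → Fin 3 → ℕ × ℕ :=
  ![![(0, 0), (1, 0), (1, 1)], ![(0, 0), (1, 1), (0, 1)]]

/-- The vertices of the triangle `T^q` at node `i` of level `ℓ`. -/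
def triVertex (m ℓ : ℕ) (q : Fin 2) (i : Node m ℓ) (e : Fin 3) : Plane :=
  gridPoint m ℓ (i.1 + (vertexOffset q e).1) (i.2 + (vertexOffset q e).2)

/-- The triangle `T^q` at node `i` of level `ℓ`. -/
def tri (m ℓ : ℕ) (q : Fin 2) (i : Node m ℓ) : Set Plane :=
  convexHull ℝ (Set.range (triVertex m ℓ q i))

/-- The two triangles at node `i` belong to the mesh of the unit square (nodes of the last row and
of the last column have no triangle of the mesh in their top right quadrant). -/
def InMesh (m ℓ : ℕ) (i : Node m ℓ) : Prop := (i.1 : ℕ) < cells m ℓ ∧ (i.2 : ℕ) < cells m ℓ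

/-- The triangle `T^q` at node `i` is active: it is a triangle of the mesh that has a vertex in the
index set `IV`, i.e. it lies in the support of a hat function with index in `IV`. -/
def Active (m ℓ : ℕ) (IV : Set (Node m ℓ)) (q : Fin 2) (i : Node m ℓ) : Prop :=
  InMesh m ℓ i ∧ ∃ j ∈ IV, ∃ e : Fin 3,
    (j.1 : ℕ) = i.1 + (vertexOffset q e).1 ∧ (j.2 : ℕ) = i.2 + (vertexOffset q e).2

/-- The finest one of `L` levels. -/
abbrev finest (L : ℕ) (hL : 0 < L) : Fin L := ⟨L - 1, Nat.sub_lt hL Nat.one_pos⟩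

/-! ### Finite element functions -/

/-- The piecewise linear nodal hat function of node `i` on level `ℓ`; it is supported on the six
triangles of level `ℓ` around that node. -/
def hat (m ℓ : ℕ) (i : Node m ℓ) (x : Plane) : ℝ :=
  let s : ℝ := cells m ℓ * x 0 - (i.1 : ℕ)
  let t : ℝ := cells m ℓ * x 1 - (i.2 : ℕ)
  max 0 (1 - max |s| (max |t| |s - t|))

/-- The finite element function on level `ℓ` with the given coefficients. -/
def feFun (m ℓ : ℕ) (w : Image m ℓ) (x : Plane) : ℝ := ∑ i, w i * hat m ℓ i x

/-- The function with multilevel coefficients `u`, the sum of its contributions on all levels. -/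
def multilevelFun (m L : ℕ) (u : ∀ ℓ : Fin L, Image m ℓ) (x : Plane) : ℝ :=
  ∑ ℓ : Fin L, feFun m ℓ (u ℓ) x

/-- The coefficient image of the nodal interpolation of `g` on level `ℓ`. -/
def nodalImage (m ℓ : ℕ) (g : Plane → ℝ) : Image m ℓ := fun i => g (gridPoint m ℓ i.1 i.2)

/-! ### The residual error estimator -/

/-- The divergence of a vector field. -/
def divergence (F : Plane → Plane) (x : Plane) : ℝ :=
  ∑ j : Fin 2, (fderiv ℝ F x (EuclideanSpace.single j 1)) j

/-- The gradient of `u` at the point `x` of an edge, taken on the side of the direction `d`: for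
piecewise linear `u` and `x` inside an edge this is the gradient on the adjacent triangle. -/
def sideGradient (u : Plane → ℝ) (x d : Plane) : Plane :=
  limUnder (𝓝[>] (0 : ℝ)) fun t => gradient u (x + t • d)

/-- The jump of `κ ∇u` at `x` across an edge with unit normal `n`; `n` points out of the triangle
on the side of `-n`, and `-n` out of the one on the side of `n`. -/
def jump (κ u : Plane → ℝ) (n x : Plane) : ℝ :=
  κ x * (inner ℝ (sideGradient u x (-n)) n + inner ℝ (sideGradient u x n) (-n))

/-- A unit normal of the segment from `a` to `b`. -/
def unitNormal (a b : Plane) : Plane := (dist a b)⁻¹ • !₂[b 1 - a 1, a 0 - b 0]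

/-- The segment from `a` to `b` lies on one of the four sides of the unit square. -/
def OnBoundary (a b : Plane) : Prop :=
  ∃ j : Fin 2, (a j = 0 ∧ b j = 0) ∨ (a j = 1 ∧ b j = 1)

open Classical in
/-- Squared `L²` norm (arc length) of the jump over the segment from `a` to `b`. Jumps live on
edges between two triangles, edges on the boundary of the square do not contribute. -/
def edgeJumpSq (κ u : Plane → ℝ) (a b : Plane) : ℝ :=
  if OnBoundary a b then 0
  else dist a b * ∫ t in (0 : ℝ)..1, (jump κ u (unitNormal a b) (AffineMap.lineMap a b t)) ^ 2

/-- `h_T² ‖f + ∇ · (κ ∇u)‖²` in `L²(T)` for the triangle `T = T^q` at node `i` of level `ℓ`,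
the differential operators being applied piecewise (almost everywhere). -/
def residualSq (m ℓ : ℕ) (κ f u : Plane → ℝ) (q : Fin 2) (i : Node m ℓ) : ℝ :=
  Metric.diam (tri m ℓ q i) ^ 2 *
    ∫ x in tri m ℓ q i, (f x + divergence (fun z => κ z • gradient u z) x) ^ 2

/-- `h_T ‖[κ ∇u]‖²` in `L²(∂T)` for the triangle `T = T^q` at node `i` of level `ℓ`. -/
def jumpSq (m ℓ : ℕ) (κ u : Plane → ℝ) (q : Fin 2) (i : Node m ℓ) : ℝ :=
  Metric.diam (tri m ℓ q i) *
    ∑ e : Fin 3, edgeJumpSq κ u (triVertex m ℓ q i e) (triVertex m ℓ q i (e + 1))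

/-- The squared local error estimator `η_T²` for the triangle `T = T^q` at node `i` of level `ℓ`. -/
def etaSq (m ℓ : ℕ) (κ f u : Plane → ℝ) (q : Fin 2) (i : Node m ℓ) : ℝ :=
  residualSq m ℓ κ f u q i + jumpSq m ℓ κ u q i

open Classical in
/-- The `0/1` mask of the active triangles. -/
def mask (m ℓ : ℕ) (IV : Set (Node m ℓ)) : Fin 2 → Image m ℓ :=
  fun q i => if Active m ℓ IV q i then 1 else 0

open Classical in
/-- The estimator image: `η_T²` for every active triangle `T`, zero elsewhere. -/
def etaSqImage (m ℓ : ℕ) (IV : Set (Node m ℓ)) (κ f u : Plane → ℝ) : Fin 2 → Image m ℓ :=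
  fun q i => if Active m ℓ IV q i then etaSq m ℓ κ f u q i else 0

/-! ### Convolutions -/

/-- Kernels with `ci` input channels, `co` output channels, and width and height `2 * r + 1`. -/
abbrev Kernel (ci co r : ℕ) : Type :=
  Fin co → Fin ci → Fin (2 * r + 1) × Fin (2 * r + 1) → ℝ

/-- Extension of an image by zero (zero padding). -/
def zeroExt {n : ℕ} (x : Fin n × Fin n → ℝ) (a b : ℤ) : ℝ :=
  if h : (0 ≤ a ∧ a < n) ∧ (0 ≤ b ∧ b < n) then
    x (⟨a.toNat, by omega⟩, ⟨b.toNat, by omega⟩)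
  else 0

/-- The dilated image, with a zero between any two neighbouring pixels. -/
def dilate {n : ℕ} (x : Fin n × Fin n → ℝ) (a b : ℤ) : ℝ :=
  if Even a ∧ Even b then zeroExt x (a / 2) (b / 2) else 0

/-- The vanilla convolution. -/
def conv {ci co r n : ℕ} (K : Kernel ci co r) (x : Fin ci → Fin n × Fin n → ℝ) :
    Fin co → Fin n × Fin n → ℝ :=
  fun o p => ∑ c, ∑ d, K o c d *
    zeroExt (x c) ((p.1 : ℕ) + (d.1 : ℕ) - r) ((p.2 : ℕ) + (d.2 : ℕ) - r)

/-- The 2-strided convolution: the kernel is applied at every other pixel. -/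
def convStride {ci co r n n' : ℕ} (K : Kernel ci co r) (x : Fin ci → Fin n × Fin n → ℝ) :
    Fin co → Fin n' × Fin n' → ℝ :=
  fun o p => ∑ c, ∑ d, K o c d *
    zeroExt (x c) (2 * (p.1 : ℕ) + (d.1 : ℕ) - r) (2 * (p.2 : ℕ) + (d.2 : ℕ) - r)

/-- The 2-transpose strided convolution: the kernel is applied to the dilated image. -/
def convTranspose {ci co r n n' : ℕ} (K : Kernel ci co r) (x : Fin ci → Fin n × Fin n → ℝ) :
    Fin co → Fin n' × Fin n' → ℝ :=
  fun o p => ∑ c, ∑ d, K o c d *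
    dilate (x c) ((p.1 : ℕ) + (d.1 : ℕ) - r) ((p.2 : ℕ) + (d.2 : ℕ) - r)

/-! ### Multilevel convolutional neural networks -/

/-- Admissible activation functions: locally essentially bounded, three times continuously
differentiable near some point where the second derivative does not vanish. -/
structure Admissible (σ : ℝ → ℝ) : Prop where
  locallyBounded : ∀ K : Set ℝ, IsCompact K → MemLp σ ⊤ (volume.restrict K)
  smoothPoint : ∃ x₀ : ℝ, ContDiffAt ℝ 3 σ x₀ ∧ iteratedDeriv 2 σ x₀ ≠ 0

/-- What one layer does on level `ℓ` if there are `c s` channels on each level `s` before it, and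
`co` channels on level `ℓ` after it. The channels on the level are kept (a skip connection), or
they are replaced by a vanilla convolution, or by a convolution of their concatenation with the
channels of the next finer (2-strided) or next coarser (2-transpose strided) level. Every output
channel has one bias; the activation function is applied iff `act = true`. -/
inductive LevelOp {L : ℕ} (c : Fin L → ℕ) (ℓ : Fin L) : ℕ → Type
  | keep : LevelOp c ℓ (c ℓ)
  | vanilla {co : ℕ} (act : Bool) (r : ℕ) (K : Kernel (c ℓ) co r) (b : Fin co → ℝ) :
      LevelOp c ℓ co
  | fromFiner {co : ℕ} (act : Bool) (s : Fin L) (hs : (s : ℕ) = ℓ + 1) (r r' : ℕ)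
      (K : Kernel (c ℓ) co r) (K' : Kernel (c s) co r') (b : Fin co → ℝ) : LevelOp c ℓ co
  | fromCoarser {co : ℕ} (act : Bool) (s : Fin L) (hs : (ℓ : ℕ) = s + 1) (r r' : ℕ)
      (K : Kernel (c ℓ) co r) (K' : Kernel (c s) co r') (b : Fin co → ℝ) : LevelOp c ℓ co

/-- A family of multi-channel images, with `c ℓ` channels on level `ℓ`. -/
abbrev State (m : ℕ) {L : ℕ} (c : Fin L → ℕ) : Type := ∀ ℓ : Fin L, Fin (c ℓ) → Image m ℓ

/-- The activation function, or the identity. -/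
def activate (σ : ℝ → ℝ) (act : Bool) (t : ℝ) : ℝ := if act then σ t else t

/-- The images computed on level `ℓ`. -/
def LevelOp.eval (σ : ℝ → ℝ) (m : ℕ) {L : ℕ} {c : Fin L → ℕ} {ℓ : Fin L} (x : State m c) :
    {co : ℕ} → LevelOp c ℓ co → Fin co → Image m ℓ
  | _, .keep => x ℓ
  | _, .vanilla act _ K b => fun o p => activate σ act (conv K (x ℓ) o p + b o)
  | _, .fromFiner act s _ _ _ K K' b => fun o p =>
      activate σ act (conv K (x ℓ) o p + convStride K' (x s) o p + b o)
  | _, .fromCoarser act s _ _ _ K K' b => fun o p =>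
      activate σ act (conv K (x ℓ) o p + convTranspose K' (x s) o p + b o)

/-- The number of parameters: all kernel entries and all biases. -/
def LevelOp.params {L : ℕ} {c : Fin L → ℕ} {ℓ : Fin L} : {co : ℕ} → LevelOp c ℓ co → ℕ
  | _, .keep => 0
  | co, .vanilla _ r _ _ => co * c ℓ * (2 * r + 1) ^ 2 + co
  | co, .fromFiner _ s _ r r' _ _ _ =>
      co * c ℓ * (2 * r + 1) ^ 2 + co * c s * (2 * r' + 1) ^ 2 + co
  | co, .fromCoarser _ s _ r r' _ _ _ =>
      co * c ℓ * (2 * r + 1) ^ 2 + co * c s * (2 * r' + 1) ^ 2 + co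

/-- The operation is linear up to biases (no activation) and moves no data from coarse to fine. -/
def LevelOp.IsAggregation {L : ℕ} {c : Fin L → ℕ} {ℓ : Fin L} : {co : ℕ} → LevelOp c ℓ co → Prop
  | _, .keep => True
  | _, .vanilla act _ _ _ => act = false
  | _, .fromFiner act _ _ _ _ _ _ _ => act = false
  | _, .fromCoarser _ _ _ _ _ _ _ _ => False

/-- Multilevel CNNs on `L` levels, with `c ℓ` input and `c' ℓ` output channels on level `ℓ`: finite
sequences of layers, each of which acts on every level. -/
inductive CNN {L : ℕ} : (Fin L → ℕ) → (Fin L → ℕ) → Type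
  | nil (c : Fin L → ℕ) : CNN c c
  | cons {c c' c'' : Fin L → ℕ} (layer : ∀ ℓ : Fin L, LevelOp c ℓ (c' ℓ)) (rest : CNN c' c'') :
      CNN c c''

namespace CNN

/-- The function realized by a network with activation function `σ`. -/
def eval (σ : ℝ → ℝ) (m : ℕ) {L : ℕ} : {c c' : Fin L → ℕ} → CNN c c' → State m c → State m c'
  | _, _, .nil _, x => x
  | _, _, .cons layer rest, x => rest.eval σ m fun ℓ => (layer ℓ).eval σ m x

/-- The number of parameters of a network. -/
def params {L : ℕ} : {c c' : Fin L → ℕ} → CNN c c' → ℕ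
  | _, _, .nil _ => 0
  | _, _, .cons layer rest => (∑ ℓ, (layer ℓ).params) + rest.params

/-- The layers of the first network followed by those of the second. -/
def append {L : ℕ} : {c c' c'' : Fin L → ℕ} → CNN c c' → CNN c' c'' → CNN c c''
  | _, _, _, .nil _, B => B
  | _, _, _, .cons layer rest, B => .cons layer (rest.append B)

/-- The network uses neither the activation function nor transpose strided convolutions, so that
data move between levels only through 2-strided convolutions, from fine to coarse. -/
def IsAggregation {L : ℕ} : {c c' : Fin L → ℕ} → CNN c c' → Prop
  | _, _, .nil _ => True
  | _, _, .cons layer rest => (∀ ℓ, (layer ℓ).IsAggregation) ∧ rest.IsAggregation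

end CNN

/-- The input of the estimator network on each level: the coefficient image of `u` on that level
and the coefficient images of the nodal interpolations of `κ` and `f` on that level. -/
def inputImages (m L : ℕ) (u : ∀ ℓ : Fin L, Image m ℓ) (κ f : Plane → ℝ) :
    State m (fun _ : Fin L => 3) :=
  fun ℓ => ![u ℓ, nodalImage m ℓ κ, nodalImage m ℓ f]

end MultilevelFE

end

open MultilevelFE

/-!
The piecewise linear functions on a level are determined by their nodal images, so everything in
the estimator is a function of images, and the point is to compute it with a number of layers and
kernels per level that does not depend on the mesh.

*Prolongation.* A coarse nodal image becomes the nodal image of the same function on the next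
finer level by a transpose strided convolution with a fixed kernel (`IsP1.sum_prolongWeight`).
Accumulating these from coarse to fine gives the exact nodal image of the multilevel function on
the finest level (`eval_prolong`), with a bounded number of parameters per level because skip
connections are free.

*Local estimators on the finest level.* On a triangle the gradients of `κ` and `u` are constant,
so that `f + ∇ · (κ ∇u) = f + ∇κ · ∇u` is affine there and its squared norm is a quadratic form of
its vertex values (`IsP1.residualSq_eq`). On an edge the gradient jump is constant and `κ` is
affine, so the squared jump is a polynomial as well (`edgeSq`). Residuals and jumps are therefore
polynomials in shifted pixels, of a degree independent of the mesh. An edge on the boundary needs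
its jump switched off; here the zero padding helps: the function one on the grid, extended by
zero, tells interior pixels from boundary pixels, and multiplying by it removes the jumps of
boundary edges (`interiorMap`).

*Products.* A mixed second difference of the activation function around a point with nonzero
second derivative approximates the product of two bounded numbers up to any accuracy
(`Admissible.exists_mul_approx`). Iterating this with shifts approximates polynomials in shifted
pixels by a network whose size depends on the degree only
(`Admissible.exists_cnn_of_mem_featSpan`).

*Aggregation.* The function is piecewise linear on the finest mesh, so on a coarser level the
residual of a triangle is four times the sum of those of its four children (`residualSq_bisect`),
the factor coming from the halved diameter. The jump over a coarse edge is the sum of those over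
its two halves (`edgeJumpSq_bisect`), while fine edges interior to a coarse triangle do not enter.
So it is the edge contributions, not the jump terms of the triangles, that are passed to the
coarser levels by 2-strided convolutions, three images for the three directions of edges, and the
estimator of a triangle is assembled from its residual and its three edges at the end. Each step
multiplies errors by at most `16` (`ApproxEstimators.aggregate`), which the accuracy on the finest
level makes up for.
-/

open MultilevelFE

noncomputable section

namespace MultilevelFE

/-! ### Composition of networks -/

namespace CNN

theorem eval_append (σ : ℝ → ℝ) (m : ℕ) {L : ℕ} {c c' c'' : Fin L → ℕ} (A : CNN c c')
    (B : CNN c' c'') (x : State m c) : (A.append B).eval σ m x = B.eval σ m (A.eval σ m x) := by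
  induction A with
  | nil => rfl
  | cons layer rest ih => exact ih _ _

theorem params_append {L : ℕ} {c c' c'' : Fin L → ℕ} (A : CNN c c') (B : CNN c' c'') :
    (A.append B).params = A.params + B.params := by
  induction A with
  | nil => simp [append, params]
  | cons layer rest ih => simp [append, params, ih, add_assoc]

theorem IsAggregation.append {L : ℕ} {c c' c'' : Fin L → ℕ} {A : CNN c c'} {B : CNN c' c''}
    (hA : A.IsAggregation) (hB : B.IsAggregation) : (A.append B).IsAggregation := by
  induction A with
  | nil => exact hB
  | cons layer rest ih => exact ⟨hA.1, ih hA.2 hB⟩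

/-- The network with a single layer. -/
def single {L : ℕ} {c c' : Fin L → ℕ} (layer : ∀ ℓ : Fin L, LevelOp c ℓ (c' ℓ)) : CNN c c' :=
  .cons layer (.nil c')

theorem eval_single (σ : ℝ → ℝ) (m : ℕ) {L : ℕ} {c c' : Fin L → ℕ}
    (layer : ∀ ℓ : Fin L, LevelOp c ℓ (c' ℓ)) (x : State m c) (ℓ : Fin L) :
    (single layer).eval σ m x ℓ = (layer ℓ).eval σ m x := rfl

theorem params_single {L : ℕ} {c c' : Fin L → ℕ}
    (layer : ∀ ℓ : Fin L, LevelOp c ℓ (c' ℓ)) : (single layer).params = ∑ ℓ, (layer ℓ).params :=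
  rfl

end CNN

/-! ### Stencils of radius one -/

/-- Positions in a kernel of radius one; `(1, 1)` is the centre. -/
abbrev Offset : Type := Fin 3 × Fin 3

/-- The image translated by an offset, with zero padding. -/
def shift {n : ℕ} (d : Offset) (x : Fin n × Fin n → ℝ) : Fin n × Fin n → ℝ :=
  fun p => zeroExt x ((p.1 : ℕ) + (d.1 : ℕ) - 1) ((p.2 : ℕ) + (d.2 : ℕ) - 1)

/-- Inside the grid, the extension by zero is the image itself. -/
theorem zeroExt_of_eq {n : ℕ} (x : Fin n × Fin n → ℝ) {a b : ℤ} (p : Fin n × Fin n)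
    (ha : a = (p.1 : ℕ)) (hb : b = (p.2 : ℕ)) : zeroExt x a b = x p := by
  subst ha hb
  simp [zeroExt]

theorem abs_zeroExt_le {n : ℕ} {x : Fin n × Fin n → ℝ} {B : ℝ} (hB : 0 ≤ B)
    (h : ∀ p, |x p| ≤ B) (a b : ℤ) : |zeroExt x a b| ≤ B := by
  unfold zeroExt
  split_ifs
  · exact h _
  · simpa using hB

theorem zeroExt_sub {n : ℕ} (x y : Fin n × Fin n → ℝ) (a b : ℤ) :
    zeroExt (x - y) a b = zeroExt x a b - zeroExt y a b := by
  unfold zeroExt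
  split_ifs <;> simp

/-- Translation with zero padding as a linear map. -/
def shiftₗ {n : ℕ} (d : Offset) : (Fin n × Fin n → ℝ) →ₗ[ℝ] (Fin n × Fin n → ℝ) where
  toFun := shift d
  map_add' x y := by
    funext p; simp only [shift, zeroExt, Pi.add_apply]; split_ifs <;> simp
  map_smul' a x := by
    funext p; simp only [shift, zeroExt, Pi.smul_apply]; split_ifs <;> simp

theorem shift_center {n : ℕ} (x : Fin n × Fin n → ℝ) : shift (1, 1) x = x := by
  funext p
  exact zeroExt_of_eq _ p (by simp) (by simp)

theorem abs_shift_le {n : ℕ} {x : Fin n × Fin n → ℝ} {B : ℝ} (hB : 0 ≤ B)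
    (h : ∀ p, |x p| ≤ B) (d : Offset) (p : Fin n × Fin n) : |shift d x p| ≤ B :=
  abs_zeroExt_le hB h _ _

theorem abs_shift_sub_shift_le {n : ℕ} {x y : Fin n × Fin n → ℝ} {B : ℝ} (hB : 0 ≤ B)
    (h : ∀ p, |x p - y p| ≤ B) (d : Offset) (p : Fin n × Fin n) :
    |shift d x p - shift d y p| ≤ B := by
  have := abs_zeroExt_le (x := x - y) hB h ((p.1 : ℕ) + (d.1 : ℕ) - 1) ((p.2 : ℕ) + (d.2 : ℕ) - 1)
  rwa [zeroExt_sub] at this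

theorem conv_eq_sum_shift {ci co n : ℕ} (K : Kernel ci co 1) (x : Fin ci → Fin n × Fin n → ℝ)
    (o : Fin co) (p : Fin n × Fin n) :
    conv K x o p = ∑ c, ∑ d : Offset, K o c d * shift d (x c) p := by
  simp only [conv, shift, Nat.cast_one]

/-- The layer that acts in the same way on every level, by a vanilla convolution of radius one with
input channels labelled by `α` and output channels labelled by `β`. -/
def stencilLayer (L : ℕ) {α β : Type} {ci co : ℕ} (eα : α ≃ Fin ci) (eβ : β ≃ Fin co) (act : Bool)
    (w : β → α → Offset → ℝ) (b : β → ℝ) : CNN (fun _ : Fin L => ci) (fun _ => co) :=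
  .single fun _ => .vanilla act 1 (fun o c d => w (eβ.symm o) (eα.symm c) d)
    (fun o => b (eβ.symm o))

theorem eval_stencilLayer (σ : ℝ → ℝ) (m L : ℕ) {α β : Type} [Fintype α] {ci co : ℕ}
    (eα : α ≃ Fin ci) (eβ : β ≃ Fin co) (act : Bool) (w : β → α → Offset → ℝ) (b : β → ℝ)
    (x : State m (fun _ : Fin L => ci)) (ℓ : Fin L) (o : β) (p : Node m ℓ) :
    (stencilLayer L eα eβ act w b).eval σ m x ℓ (eβ o) p =
      activate σ act (∑ a, ∑ d, w o a d * shift d (x ℓ (eα a)) p + b o) := by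
  simp only [stencilLayer, CNN.eval_single, LevelOp.eval, conv_eq_sum_shift]
  rw [← eα.sum_comp]
  simp

theorem params_stencilLayer (L : ℕ) {α β : Type} {ci co : ℕ} (eα : α ≃ Fin ci) (eβ : β ≃ Fin co)
    (act : Bool) (w : β → α → Offset → ℝ) (b : β → ℝ) :
    (stencilLayer L eα eβ act w b).params = (co * ci * 9 + co) * L := by
  rw [stencilLayer, CNN.params_single]
  simp [LevelOp.params, mul_comm]

/-! ### Products from second differences of the activation function -/

/-- The second order Taylor expansion of an admissible activation function. -/
theorem Admissible.exists_taylor {σ : ℝ → ℝ} (hσ : Admissible σ) :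
    ∃ x₀ b c : ℝ, c ≠ 0 ∧ ∀ η > 0, ∃ ρ > 0, ∀ h : ℝ, |h| ≤ ρ →
      |σ (x₀ + h) - (σ x₀ + b * h + c / 2 * h ^ 2)| ≤ η * h ^ 2 := by
  obtain ⟨x₀, hs, h2⟩ := hσ.smoothPoint
  have hs' : ContDiffAt ℝ 2 σ x₀ := hs.of_le (by norm_num)
  -- Taylor's theorem needs a convex set on which the function is smooth: a small ball
  obtain ⟨v, hv, hcont⟩ := hs'.contDiffOn (m := 2) le_rfl (by simp)
  obtain ⟨r, hr, hball⟩ := Metric.mem_nhds_iff.1 (by simpa using hv)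
  have hcont' : ContDiffOn ℝ 2 σ (Metric.ball x₀ r) := hcont.mono (by simpa using hball)
  have hx : x₀ ∈ Metric.ball x₀ r := Metric.mem_ball_self hr
  have T := taylor_isLittleO (n := 2) (convex_ball x₀ r) hx (by exact_mod_cast hcont')
  rw [Metric.isOpen_ball.nhdsWithin_eq hx] at T
  have e2 : iteratedDerivWithin 2 σ (Metric.ball x₀ r) x₀ = iteratedDeriv 2 σ x₀ :=
    iteratedDerivWithin_of_isOpen Metric.isOpen_ball hx
  refine ⟨x₀, iteratedDerivWithin 1 σ (Metric.ball x₀ r) x₀, iteratedDeriv 2 σ x₀, h2, ?_⟩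
  intro η hη
  obtain ⟨ρ, hρ, H⟩ := Metric.eventually_nhds_iff.1 (T.def hη)
  refine ⟨ρ / 2, by positivity, fun h hh => ?_⟩
  have := H (y := x₀ + h) (by rw [Real.dist_eq]; simp only [add_sub_cancel_left]; linarith)
  simp only [taylorWithinEval_succ, taylor_within_zero_eval, e2, add_sub_cancel_left,
    Real.norm_eq_abs, smul_eq_mul] at this
  rw [abs_of_nonneg (sq_nonneg h)] at this
  convert this using 2
  norm_num
  ring

/-- The sign belonging to a Boolean. -/
def sgn (s : Bool) : ℝ := if s then 1 else -1

/-- Products are approximated by a linear combination of four values of the activation function,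
uniformly on bounded sets: this is a mixed second difference at a point with `σ'' ≠ 0`. -/
theorem Admissible.exists_mul_approx {σ : ℝ → ℝ} (hσ : Admissible σ) {R ε : ℝ} (hR : 0 < R)
    (hε : 0 < ε) : ∃ x₀ δ w : ℝ, ∀ x y : ℝ, |x| ≤ R → |y| ≤ R →
      |∑ s : Bool × Bool, w * (sgn s.1 * sgn s.2) *
        σ (x₀ + δ * (sgn s.1 * x + sgn s.2 * y)) - x * y| ≤ ε := by
  obtain ⟨x₀, b, c, hc, H⟩ := hσ.exists_taylor
  obtain ⟨ρ, hρ, H⟩ := H (|c| * ε / (4 * R ^ 2)) (by positivity)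
  -- with this step size all arguments `δ * (± x ± y)` are in the range of the Taylor expansion
  set δ := ρ / (2 * R) with hδ
  have hδ0 : 0 < δ := by positivity
  refine ⟨x₀, δ, (4 * c * δ ^ 2)⁻¹, fun x y hx hy => ?_⟩
  have key : ∀ s : ℝ, |s| ≤ 2 * R →
      |σ (x₀ + δ * s) - (σ x₀ + b * (δ * s) + c / 2 * (δ * s) ^ 2)| ≤ |c| * ε * δ ^ 2 := by
    intro s hs
    refine (H (δ * s) ?_).trans ?_
    · rw [abs_mul, abs_of_pos hδ0, hδ, div_mul_eq_mul_div, div_le_iff₀ (by positivity)]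
      exact mul_le_mul_of_nonneg_left hs hρ.le
    · have : s ^ 2 ≤ (2 * R) ^ 2 :=
        sq_le_sq' (by linarith [abs_le.1 hs]) (by linarith [abs_le.1 hs])
      rw [div_mul_eq_mul_div, div_le_iff₀ (by positivity)]
      have h3 : 0 ≤ |c| * ε * δ ^ 2 := by positivity
      nlinarith [mul_le_mul_of_nonneg_left this h3]
  have hx' := abs_le.1 hx
  have hy' := abs_le.1 hy
  have k1 := key (x + y) (abs_le.2 ⟨by linarith, by linarith⟩)
  have k2 := key (x - y) (abs_le.2 ⟨by linarith, by linarith⟩)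
  have k3 := key (-x + y) (abs_le.2 ⟨by linarith, by linarith⟩)
  have k4 := key (-x - y) (abs_le.2 ⟨by linarith, by linarith⟩)
  -- constant and linear terms cancel, and the quadratic ones give `4 * c * δ ^ 2 * (x * y)`
  have e : ∑ s : Bool × Bool, (4 * c * δ ^ 2)⁻¹ * (sgn s.1 * sgn s.2) *
        σ (x₀ + δ * (sgn s.1 * x + sgn s.2 * y)) - x * y =
      (4 * c * δ ^ 2)⁻¹ * (
        (σ (x₀ + δ * (x + y)) - (σ x₀ + b * (δ * (x + y)) + c / 2 * (δ * (x + y)) ^ 2)) -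
        (σ (x₀ + δ * (x - y)) - (σ x₀ + b * (δ * (x - y)) + c / 2 * (δ * (x - y)) ^ 2)) -
        (σ (x₀ + δ * (-x + y)) - (σ x₀ + b * (δ * (-x + y)) + c / 2 * (δ * (-x + y)) ^ 2)) +
        (σ (x₀ + δ * (-x - y)) - (σ x₀ + b * (δ * (-x - y)) + c / 2 * (δ * (-x - y)) ^ 2))) := by
    simp only [Fintype.sum_prod_type, Fintype.sum_bool, sgn, if_true, Bool.false_eq_true, if_false,
      one_mul, neg_mul, ← sub_eq_add_neg]
    field_simp
    ring
  rw [e, abs_mul, abs_inv, abs_mul, abs_mul, abs_of_pos (show (0 : ℝ) < 4 by norm_num),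
    abs_of_pos (show 0 < δ ^ 2 by positivity), inv_mul_le_iff₀ (by positivity)]
  rw [abs_le] at k1 k2 k3 k4 ⊢
  constructor <;> linarith

/-! ### Towers of features -/

/-- Labels of features of a given depth. A feature of depth `0` is an input channel. A feature of
depth `d + 1` is the product of two factors, each of which is the constant image `1` (`none`) or a
translated feature of depth `d`. -/
def Feat (ci : ℕ) : ℕ → Type
  | 0 => Fin ci
  | d + 1 => Option (Feat ci d × Offset) × Option (Feat ci d × Offset)

instance instFintypeFeat (ci : ℕ) : ∀ d, Fintype (Feat ci d)
  | 0 => inferInstanceAs (Fintype (Fin ci))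
  | d + 1 =>
    have := instFintypeFeat ci d
    inferInstanceAs (Fintype (Option (Feat ci d × Offset) × Option (Feat ci d × Offset)))

/-- The factors of the features of the next depth, made from a family `y` of images. -/
def factor {α : Type} {n : ℕ} (y : α → Fin n × Fin n → ℝ) :
    Option (α × Offset) → Fin n × Fin n → ℝ
  | none => 1
  | some (a, d) => shift d (y a)

/-- The feature with a given label as a function of the input channels. -/
def feat {ci n : ℕ} : ∀ d : ℕ, Feat ci d → (Fin ci → Fin n × Fin n → ℝ) → Fin n × Fin n → ℝ
  | 0, c, x => x c
  | d + 1, (a, b), x => factor (fun φ => feat d φ x) a * factor (fun φ => feat d φ x) b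

theorem abs_factor_le {α : Type} {n : ℕ} {y : α → Fin n × Fin n → ℝ} {B : ℝ} (hB : 1 ≤ B)
    (h : ∀ a p, |y a p| ≤ B) (t : Option (α × Offset)) (p : Fin n × Fin n) :
    |factor y t p| ≤ B := by
  rcases t with _ | ⟨a, d⟩
  · simpa [factor] using hB
  · exact abs_shift_le (by linarith) (h a) d p

theorem abs_factor_sub_factor_le {α : Type} {n : ℕ} {y z : α → Fin n × Fin n → ℝ} {B : ℝ}
    (hB : 0 ≤ B) (h : ∀ a p, |y a p - z a p| ≤ B) (t : Option (α × Offset)) (p : Fin n × Fin n) :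
    |factor y t p - factor z t p| ≤ B := by
  rcases t with _ | ⟨a, d⟩
  · simpa [factor] using hB
  · exact abs_shift_sub_shift_le hB (h a) d p

/-- Features of bounded inputs are bounded, uniformly in the size of the grid. -/
theorem exists_abs_feat_le (ci d : ℕ) (R : ℝ) : ∃ B : ℝ, 1 ≤ B ∧
    ∀ {n : ℕ} (x : Fin ci → Fin n × Fin n → ℝ), (∀ c p, |x c p| ≤ R) →
      ∀ φ p, |feat d φ x p| ≤ B := by
  induction d with
  | zero => exact ⟨max 1 R, le_max_left _ _, fun x hx φ p => (hx φ p).trans (le_max_right _ _)⟩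
  | succ d ih =>
    obtain ⟨B, hB, H⟩ := ih
    refine ⟨B * B, by nlinarith, fun x hx φ p => ?_⟩
    obtain ⟨a, b⟩ := φ
    rw [feat, Pi.mul_apply, abs_mul]
    exact mul_le_mul (abs_factor_le hB (H x hx) a p) (abs_factor_le hB (H x hx) b p)
      (abs_nonneg _) (by linarith)

/-- The number of channels that hold the features of a given depth. -/
def numFeat (ci : ℕ) : ℕ → ℕ
  | 0 => ci
  | d + 1 => Fintype.card (Feat ci (d + 1))

/-- The channel of a feature. At depth `0` the channels are those of the input, in their order. -/
def featChannel (ci : ℕ) : ∀ d, Feat ci d ≃ Fin (numFeat ci d)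
  | 0 => Equiv.refl _
  | _ + 1 => Fintype.equivFin _

/-- A bound for the number of parameters per level of a network that computes the features. -/
def featCost (ci : ℕ) : ℕ → ℕ
  | 0 => 0
  | d + 1 =>
    let k := Fintype.card (Feat ci (d + 1) × Bool × Bool)
    featCost ci d + (k * numFeat ci d * 9 + k) +
      (numFeat ci (d + 1) * k * 9 + numFeat ci (d + 1))

open Classical in
/-- The weights with which a family of images enters a factor. -/
def factorWeight {α : Type} (t : Option (α × Offset)) (a : α) (d : Offset) : ℝ :=
  if t = some (a, d) then 1 else 0

/-- The constant part of a factor. -/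
def factorBias {α : Type} (t : Option (α × Offset)) : ℝ := if t = none then 1 else 0

/-- Factors are stencils with a bias, so they can be computed by a convolution. -/
theorem sum_factorWeight {α : Type} [Fintype α] {n : ℕ} (y : α → Fin n × Fin n → ℝ)
    (t : Option (α × Offset)) (p : Fin n × Fin n) :
    ∑ a, ∑ d, factorWeight t a d * shift d (y a) p + factorBias t = factor y t p := by
  rw [← Fintype.sum_prod_type' (f := fun a d => factorWeight t a d * shift d (y a) p)]
  rcases t with _ | ⟨a, d⟩
  · simp [factorWeight, factorBias, factor]
  · rw [Finset.sum_eq_single (a, d)]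
    · simp [factorWeight, factorBias, factor]
    · rintro ⟨a', d'⟩ - h
      have : some (a, d) ≠ some (a', d') := fun e => h (Option.some.inj e).symm
      simp [factorWeight, this]
    · simp

open Classical in
/-- The features of a given depth are approximated, on bounded inputs and on one level, by networks
whose number of parameters per level depends on the depth and the number of inputs only. -/
theorem Admissible.exists_cnn_feat {σ : ℝ → ℝ} (hσ : Admissible σ) (m : ℕ) {L : ℕ} (ℓ : Fin L)
    (ci d : ℕ) (R : ℝ) {ε : ℝ} (hε : 0 < ε) :
    ∃ Φ : CNN (fun _ : Fin L => ci) (fun _ => numFeat ci d), Φ.params ≤ featCost ci d * L ∧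
      ∀ x : State m (fun _ : Fin L => ci), (∀ c p, |x ℓ c p| ≤ R) →
        ∀ φ p, |Φ.eval σ m x ℓ (featChannel ci d φ) p - feat d φ (x ℓ) p| ≤ ε := by
  induction d generalizing ε with
  | zero =>
    refine ⟨.nil _, by simp [CNN.params, featCost], fun x _ φ p => ?_⟩
    have : (CNN.nil (fun _ : Fin L => ci)).eval σ m x ℓ (featChannel ci 0 φ) p =
      feat 0 φ (x ℓ) p := rfl
    exact (abs_nonpos_iff.2 (sub_eq_zero.2 this)).trans hε.le
  | succ d ih =>
    obtain ⟨B, hB, HB⟩ := exists_abs_feat_le ci d R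
    -- half of the error is for the products, half for the errors of their factors; the minimum with
    -- `1` keeps the computed factors bounded by `B + 1`
    set ε' := min 1 (ε / 2 / (2 * B + 1)) with hε'
    have hε'0 : 0 < ε' := lt_min one_pos (by positivity)
    have hε'1 : ε' ≤ 1 := min_le_left _ _
    have hε'2 : ε' * (2 * B + 1) ≤ ε / 2 := by
      rw [← le_div_iff₀ (by positivity)]; exact min_le_right _ _
    obtain ⟨Φ, hΦp, hΦ⟩ := ih hε'0
    obtain ⟨x₀, δ, w, hw⟩ := hσ.exists_mul_approx (R := B + 1) (by linarith) (half_pos hε)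
    let Γ := Feat ci (d + 1) × Bool × Bool
    let eΓ : Γ ≃ Fin (Fintype.card Γ) := Fintype.equivFin Γ
    -- the first layer evaluates the four values of the activation function for every product,
    -- the second one combines them
    let A := stencilLayer L (featChannel ci d) eΓ true
      (fun γ a e => δ * (sgn γ.2.1 * factorWeight γ.1.1 a e + sgn γ.2.2 * factorWeight γ.1.2 a e))
      (fun γ => x₀ + δ * (sgn γ.2.1 * factorBias γ.1.1 + sgn γ.2.2 * factorBias γ.1.2))
    let A' := stencilLayer L eΓ (featChannel ci (d + 1)) false
      (fun φ γ e => if γ.1 = φ ∧ e = (1, 1) then w * (sgn γ.2.1 * sgn γ.2.2) else 0) (fun _ => 0)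
    refine ⟨Φ.append (A.append A'), ?_, fun x hx φ p => ?_⟩
    · rw [CNN.params_append, CNN.params_append, params_stencilLayer, params_stencilLayer]
      have : featCost ci (d + 1) * L = featCost ci d * L +
          ((Fintype.card Γ * numFeat ci d * 9 + Fintype.card Γ) * L +
          (numFeat ci (d + 1) * Fintype.card Γ * 9 + numFeat ci (d + 1)) * L) := by
        simp only [featCost, Γ]; ring
      rw [this]
      gcongr
    · rw [CNN.eval_append, CNN.eval_append]
      set y := Φ.eval σ m x with hy
      have hyx := hΦ x hx
      set z : Feat ci d → Node m ℓ → ℝ := fun φ => y ℓ (featChannel ci d φ) with hz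
      have hA : ∀ γ p, A.eval σ m y ℓ (eΓ γ) p =
          σ (x₀ + δ * (sgn γ.2.1 * factor z γ.1.1 p + sgn γ.2.2 * factor z γ.1.2 p)) := by
        intro γ p
        rw [eval_stencilLayer, activate, if_pos rfl, ← sum_factorWeight z, ← sum_factorWeight z]
        congr 1
        simp only [mul_add, add_mul, Finset.sum_add_distrib, Finset.mul_sum, mul_assoc, hz]
        ring
      have hA' : A'.eval σ m (A.eval σ m y) ℓ (featChannel ci (d + 1) φ) p =
          ∑ s : Bool × Bool, w * (sgn s.1 * sgn s.2) *
            σ (x₀ + δ * (sgn s.1 * factor z φ.1 p + sgn s.2 * factor z φ.2 p)) := by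
        rw [eval_stencilLayer, activate, if_neg (by simp), add_zero, Fintype.sum_prod_type,
          Finset.sum_eq_single φ]
        · refine Finset.sum_congr rfl fun s _ => ?_
          rw [Finset.sum_eq_single (1, 1)]
          · rw [if_pos ⟨rfl, rfl⟩, shift_center, hA]
          · intro e _ he; simp [he]
          · simp
        · intro ψ _ hψ; simp [hψ]
        · simp
      rw [hA']
      have hf := HB (x ℓ) hx
      have hzB : ∀ a p, |z a p| ≤ B + 1 := fun a p => by
        have h1 := hyx a p
        have h2 := hf a p
        rw [abs_le] at h1 h2 ⊢
        constructor <;> simp only [hz] <;> linarith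
      have h0 := hw _ _ (abs_factor_le (by linarith) hzB φ.1 p)
        (abs_factor_le (by linarith) hzB φ.2 p)
      refine (abs_sub_le _ (factor z φ.1 p * factor z φ.2 p) _).trans ?_
      have h1 := abs_factor_sub_factor_le hε'0.le hyx φ.1 p
      have h2 := abs_factor_sub_factor_le hε'0.le hyx φ.2 p
      have h3 := abs_factor_le (by linarith) hzB φ.1 p
      have h4 := abs_factor_le (by linarith) hf φ.2 p
      have e1 : feat (d + 1) φ (x ℓ) p = factor (fun ψ => feat d ψ (x ℓ)) φ.1 p *
          factor (fun ψ => feat d ψ (x ℓ)) φ.2 p := rfl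
      rw [e1]
      set a := factor z φ.1 p
      set b := factor z φ.2 p
      set a' := factor (fun ψ => feat d ψ (x ℓ)) φ.1 p
      set b' := factor (fun ψ => feat d ψ (x ℓ)) φ.2 p
      have e2 : |a * b - a' * b'| ≤ ε / 2 := by
        have : a * b - a' * b' = a * (b - b') + (a - a') * b' := by ring
        rw [this]
        refine (abs_add_le _ _).trans ?_
        rw [abs_mul, abs_mul]
        have i1 : |a| * |b - b'| ≤ (B + 1) * ε' :=
          mul_le_mul h3 h2 (abs_nonneg _) (by linarith)
        have i2 : |a - a'| * |b'| ≤ ε' * B := mul_le_mul h1 h4 (abs_nonneg _) hε'0.le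
        linarith
      linarith

/-! ### Stencil polynomials -/

/-- Linear combinations of features of depth `d`, as maps from input channels to images. -/
def featSpan (ci n d : ℕ) :
    Submodule ℝ ((Fin ci → Fin n × Fin n → ℝ) → Fin n × Fin n → ℝ) :=
  Submodule.span ℝ (Set.range (feat d))

/-- Linear combinations of the constant `1` and of translated features of depth `d`. -/
def factorSpan (ci n d : ℕ) :
    Submodule ℝ ((Fin ci → Fin n × Fin n → ℝ) → Fin n × Fin n → ℝ) :=
  Submodule.span ℝ (Set.range fun (t : Option (Feat ci d × Offset)) x =>
    factor (fun φ => feat d φ x) t)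

section Span

variable {ci n d : ℕ} {f g : (Fin ci → Fin n × Fin n → ℝ) → Fin n × Fin n → ℝ}

/-- Each multiplication costs one more level in the tower of features. -/
theorem mul_mem_featSpan (hf : f ∈ factorSpan ci n d) (hg : g ∈ factorSpan ci n d) :
    f * g ∈ featSpan ci n (d + 1) := by
  have h := Submodule.mul_mem_mul hf hg
  rw [factorSpan, Submodule.span_mul_span] at h
  refine Submodule.span_mono ?_ h
  rintro _ ⟨_, ⟨a, rfl⟩, _, ⟨b, rfl⟩, rfl⟩
  exact ⟨(a, b), rfl⟩

theorem one_mem_factorSpan : 1 ∈ factorSpan ci n d :=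
  Submodule.subset_span ⟨none, rfl⟩

theorem shift_mem_factorSpan (hf : f ∈ featSpan ci n d) (e : Offset) :
    (fun x => shift e (f x)) ∈ factorSpan ci n d := by
  have h := Submodule.mem_map_of_mem (f := LinearMap.compLeft (shiftₗ e) _) hf
  rw [featSpan, Submodule.map_span] at h
  refine Submodule.span_mono ?_ h
  rintro _ ⟨_, ⟨φ, rfl⟩, rfl⟩
  exact ⟨some (φ, e), rfl⟩

theorem featSpan_le_factorSpan : featSpan ci n d ≤ factorSpan ci n d := fun f hf => by
  simpa only [shift_center] using shift_mem_factorSpan hf (1, 1)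

theorem factorSpan_le_featSpan_succ : factorSpan ci n d ≤ featSpan ci n (d + 1) := fun f hf => by
  simpa using mul_mem_featSpan hf one_mem_factorSpan

theorem channel_mem_featSpan (c : Fin ci) :
    (fun x : Fin ci → Fin n × Fin n → ℝ => x c) ∈ featSpan ci n 0 :=
  Submodule.subset_span ⟨c, rfl⟩

end Span

/-! ### Networks with output on a single level -/

/-- `co` channels on the level `ℓ₀`, none on the other levels. -/
def outChannels {L : ℕ} (ℓ₀ : Fin L) (co : ℕ) (ℓ : Fin L) : ℕ := if ℓ = ℓ₀ then co else 0

theorem outChannels_le {L : ℕ} (ℓ₀ : Fin L) (co : ℕ) (ℓ : Fin L) : outChannels ℓ₀ co ℓ ≤ co := by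
  unfold outChannels
  split_ifs <;> simp

theorem outChannels_self {L : ℕ} (ℓ₀ : Fin L) (co : ℕ) : outChannels ℓ₀ co ℓ₀ = co := if_pos rfl

open Classical in
/-- Finitely many stencil polynomials in the images of one level are approximated, on bounded
inputs, by networks whose number of parameters per level depends on the depth and the numbers of
channels only. -/
theorem Admissible.exists_cnn_of_mem_featSpan {σ : ℝ → ℝ} (hσ : Admissible σ) (m : ℕ) {L : ℕ}
    (ℓ₀ : Fin L) {ci co d : ℕ}
    (f : Fin co → (Fin ci → Image m ℓ₀) → Image m ℓ₀)
    (hf : ∀ o, f o ∈ featSpan ci (cells m ℓ₀ + 1) d) (R : ℝ) {ε : ℝ} (hε : 0 < ε) :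
    ∃ Φ : CNN (fun _ : Fin L => ci) (outChannels ℓ₀ co),
      Φ.params ≤ (featCost ci d + (co * numFeat ci d * 9 + co)) * L ∧
      ∀ x : State m (fun _ : Fin L => ci), (∀ c p, |x ℓ₀ c p| ≤ R) →
        ∀ o p, |Φ.eval σ m x ℓ₀ o p - f (Fin.castLE (outChannels_le _ _ _) o) (x ℓ₀) p| ≤ ε := by
  have hw : ∀ o, ∃ w : Feat ci d → ℝ, ∑ φ, w φ • feat d φ = f o := fun o =>
    (Submodule.mem_span_range_iff_exists_fun ℝ).1 (hf o)
  choose w hw using hw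
  set S : ℝ := ∑ o, ∑ φ, |w o φ| with hS
  have hS0 : 0 ≤ S := Finset.sum_nonneg fun _ _ => Finset.sum_nonneg fun _ _ => abs_nonneg _
  obtain ⟨Φ, hΦp, hΦ⟩ := hσ.exists_cnn_feat m ℓ₀ ci d R (ε := ε / (S + 1)) (by positivity)
  let layer : ∀ ℓ : Fin L, LevelOp (fun _ : Fin L => numFeat ci d) ℓ (outChannels ℓ₀ co ℓ) :=
    fun ℓ => .vanilla false 1 (fun o c e => if e = (1, 1) then
      w (Fin.castLE (outChannels_le _ _ _) o) ((featChannel ci d).symm c) else 0) (fun _ => 0)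
  refine ⟨Φ.append (.single layer), ?_, fun x hx o p => ?_⟩
  · rw [CNN.params_append, CNN.params_single, add_mul]
    refine add_le_add hΦp ((Finset.sum_le_card_nsmul _ _ (co * numFeat ci d * 9 + co) ?_).trans ?_)
    · intro ℓ _
      have := outChannels_le ℓ₀ co ℓ
      simp only [layer, LevelOp.params]
      norm_num
      gcongr
    · simp [mul_comm]
  · rw [CNN.eval_append, CNN.eval_single]
    set o' := Fin.castLE (outChannels_le ℓ₀ co ℓ₀) o
    have e1 : (layer ℓ₀).eval σ m (Φ.eval σ m x) o p =
        ∑ φ, w o' φ * Φ.eval σ m x ℓ₀ (featChannel ci d φ) p := by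
      simp only [layer, LevelOp.eval, conv_eq_sum_shift, activate]
      rw [← (featChannel ci d).sum_comp, if_neg (by simp), add_zero]
      refine Finset.sum_congr rfl fun φ _ => ?_
      rw [Finset.sum_eq_single (1, 1)]
      · rw [if_pos rfl, shift_center, Equiv.symm_apply_apply]
      · intro e _ he; simp [he]
      · simp
    have e2 : f o' (x ℓ₀) p = ∑ φ, w o' φ * feat d φ (x ℓ₀) p := by
      rw [← hw]; simp
    rw [e1, e2, ← Finset.sum_sub_distrib]
    refine (Finset.abs_sum_le_sum_abs _ _).trans ?_
    calc ∑ φ, |w o' φ * Φ.eval σ m x ℓ₀ (featChannel ci d φ) p - w o' φ * feat d φ (x ℓ₀) p|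
        ≤ ∑ φ, |w o' φ| * (ε / (S + 1)) := by
          refine Finset.sum_le_sum fun φ _ => ?_
          rw [← mul_sub, abs_mul]
          exact mul_le_mul_of_nonneg_left (hΦ x hx φ p) (abs_nonneg _)
      _ = (∑ φ, |w o' φ|) * (ε / (S + 1)) := by rw [Finset.sum_mul]
      _ ≤ (S + 1) * (ε / (S + 1)) := by
          refine mul_le_mul_of_nonneg_right ?_ (by positivity)
          have := Finset.single_le_sum (f := fun o => ∑ φ, |w o φ|)
            (fun o _ => Finset.sum_nonneg fun _ _ => abs_nonneg _) (Finset.mem_univ o')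
          linarith
      _ = ε := by field_simp

/-! ### Piecewise linear functions -/

theorem cells_pos {m : ℕ} (hm : 0 < m) (ℓ : ℕ) : (0 : ℝ) < cells m ℓ := by
  have : 0 < cells m ℓ := by positivity
  exact_mod_cast this

theorem cells_succ (m ℓ : ℕ) : cells m (ℓ + 1) = 2 * cells m ℓ := by
  simp only [cells, pow_succ]; ring

theorem cells_mul_gridPoint_zero {m : ℕ} (hm : 0 < m) (ℓ a b : ℕ) :
    cells m ℓ * gridPoint m ℓ a b 0 = a := by
  have := cells_pos hm ℓ
  simp only [gridPoint, PiLp.toLp_apply, Matrix.cons_val_zero]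
  field_simp

theorem cells_mul_gridPoint_one {m : ℕ} (hm : 0 < m) (ℓ a b : ℕ) :
    cells m ℓ * gridPoint m ℓ a b 1 = b := by
  have := cells_pos hm ℓ
  simp only [gridPoint, PiLp.toLp_apply, Matrix.cons_val_one, Matrix.cons_val_fin_one]
  field_simp

/-- The hat function of the node `(0, 0)` of the infinite mesh of width `1`. -/
def hatProfile (s t : ℝ) : ℝ := max 0 (1 - max |s| (max |t| |s - t|))

theorem hatProfile_comm (s t : ℝ) : hatProfile s t = hatProfile t s := by
  simp only [hatProfile, abs_sub_comm s t, max_left_comm |s|]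

theorem hatProfile_eq_zero {s t : ℝ} (h : 1 ≤ |s| ∨ 1 ≤ |t| ∨ 1 ≤ |s - t|) :
    hatProfile s t = 0 := by
  refine max_eq_left (sub_nonpos.2 ?_)
  rcases h with h | h | h
  · exact le_max_of_le_left h
  · exact le_max_of_le_right (le_max_of_le_left h)
  · exact le_max_of_le_right (le_max_of_le_right h)

theorem hatProfile_zero : hatProfile 0 0 = 1 := by simp [hatProfile]

theorem hatProfile_int (k l : ℤ) : hatProfile k l = if k = 0 ∧ l = 0 then 1 else 0 := by
  split_ifs with h
  · simp [h.1, h.2, hatProfile_zero]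
  · refine hatProfile_eq_zero ?_
    by_cases hk : k = 0
    · exact Or.inr (Or.inl (by exact_mod_cast Int.one_le_abs fun hl => h ⟨hk, hl⟩))
    · exact Or.inl (by exact_mod_cast Int.one_le_abs hk)

/-- The hat function is affine on the lower right triangle of every cell. -/
theorem hatProfile_add_int (k l : ℤ) {s t : ℝ} (ht : 0 ≤ t) (hts : t ≤ s) (hs : s ≤ 1) :
    hatProfile (s + k) (t + l) = hatProfile k l * (1 - s) + hatProfile (1 + k) l * (s - t) +
      hatProfile (1 + k) (1 + l) * t := by
  have e1 : hatProfile (1 + k) l = if 1 + k = 0 ∧ l = 0 then 1 else 0 := by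
    exact_mod_cast hatProfile_int (1 + k) l
  have e2 : hatProfile (1 + k) (1 + l) = if 1 + k = 0 ∧ 1 + l = 0 then 1 else 0 := by
    exact_mod_cast hatProfile_int (1 + k) (1 + l)
  rw [hatProfile_int, e1, e2]
  -- unless `k` and `l` are `0` or `-1`, the triangle does not meet the interior of the support
  have far : ∀ {j : ℤ} {r : ℝ}, 0 ≤ r → r ≤ 1 → (1 ≤ j ∨ j ≤ -2) → 1 ≤ |r + j| := by
    intro j r h0 h1 hj
    rcases hj with hj | hj
    · have : (1 : ℝ) ≤ j := by exact_mod_cast hj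
      exact (show (1 : ℝ) ≤ r + j by linarith).trans (le_abs_self _)
    · have : (j : ℝ) ≤ -2 := by exact_mod_cast hj
      exact (show (1 : ℝ) ≤ -(r + j) by linarith).trans (neg_le_abs _)
  by_cases hk : 1 ≤ k ∨ k ≤ -2
  · rw [hatProfile_eq_zero (Or.inl (far (ht.trans hts) hs hk)), if_neg (by omega),
      if_neg (by omega), if_neg (by omega)]
    ring
  by_cases hl : 1 ≤ l ∨ l ≤ -2
  · rw [hatProfile_eq_zero (Or.inr (Or.inl (far ht (hts.trans hs) hl))), if_neg (by omega),
      if_neg (by omega), if_neg (by omega)]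
    ring
  have hk' : k = 0 ∨ k = -1 := by omega
  have hl' : l = 0 ∨ l = -1 := by omega
  rcases hk' with rfl | rfl <;> rcases hl' with rfl | rfl
  · norm_num [hatProfile]
    rw [abs_of_nonneg (ht.trans hts), abs_of_nonneg ht, abs_of_nonneg (by linarith),
      max_eq_left (b := max t (s - t)) (max_le hts (by linarith)), max_eq_right (by linarith)]
  · rw [hatProfile_eq_zero]
    · norm_num
    · right; right
      push_cast
      exact (show (1 : ℝ) ≤ s + 0 - (t + -1) by linarith).trans (le_abs_self _)
  · norm_num [hatProfile]
    rw [abs_of_nonpos (by linarith), abs_of_nonneg ht,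
      abs_of_nonpos (by linarith : s + -1 - t ≤ 0), max_eq_right (a := t) (by linarith),
      max_eq_right (a := -(s + -1)) (by linarith), max_eq_right (by linarith)]
    ring
  · norm_num [hatProfile]
    rw [abs_of_nonpos (by linarith), abs_of_nonpos (by linarith), abs_of_nonneg (by linarith),
      max_eq_left (a := -(t + -1)) (by linarith),
      max_eq_right (a := -(s + -1)) (by linarith), max_eq_right (by linarith)]
    ring

theorem hat_eq_hatProfile (m ℓ : ℕ) (i : Node m ℓ) (x : Plane) : hat m ℓ i x =
    hatProfile (cells m ℓ * x 0 - (i.1 : ℕ)) (cells m ℓ * x 1 - (i.2 : ℕ)) := rfl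

/-- `g` is affine on all triangles of level `ℓ` (in the first quadrant). The function is expressed
by its vertex values; `s` and `t` are the coordinates in the cell with lower left node `(a, b)`. -/
structure IsP1 (m ℓ : ℕ) (g : Plane → ℝ) : Prop where
  lower : ∀ (a b : ℕ) (x : Plane) (s t : ℝ), cells m ℓ * x 0 = a + s → cells m ℓ * x 1 = b + t →
    0 ≤ t → t ≤ s → s ≤ 1 →
    g x = g (gridPoint m ℓ a b) * (1 - s) + g (gridPoint m ℓ (a + 1) b) * (s - t) +
      g (gridPoint m ℓ (a + 1) (b + 1)) * t
  upper : ∀ (a b : ℕ) (x : Plane) (s t : ℝ), cells m ℓ * x 0 = a + s → cells m ℓ * x 1 = b + t →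
    0 ≤ s → s ≤ t → t ≤ 1 →
    g x = g (gridPoint m ℓ a b) * (1 - t) + g (gridPoint m ℓ a (b + 1)) * (t - s) +
      g (gridPoint m ℓ (a + 1) (b + 1)) * s

section P1

variable {m : ℕ} (hm : 0 < m)
include hm

theorem hat_gridPoint {ℓ : ℕ} (i : Node m ℓ) (a b : ℕ) :
    hat m ℓ i (gridPoint m ℓ a b) = if (i.1 : ℕ) = a ∧ (i.2 : ℕ) = b then 1 else 0 := by
  rw [hat_eq_hatProfile, cells_mul_gridPoint_zero hm, cells_mul_gridPoint_one hm]
  have := hatProfile_int ((a : ℤ) - (i.1 : ℕ)) ((b : ℤ) - (i.2 : ℕ))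
  push_cast at this
  rw [this]
  congr 1
  simp only [sub_eq_zero, Nat.cast_inj, eq_comm]

/-- On the upper triangles, affinity follows from the symmetry of the hat function. -/
theorem isP1_hat {ℓ : ℕ} (i : Node m ℓ) : IsP1 m ℓ (hat m ℓ i) where
  lower a b x s t hx hy ht hts hs := by
    simp only [hat_eq_hatProfile, cells_mul_gridPoint_zero hm, cells_mul_gridPoint_one hm, hx, hy]
    have := hatProfile_add_int ((a : ℤ) - (i.1 : ℕ)) ((b : ℤ) - (i.2 : ℕ)) ht hts hs
    push_cast at this ⊢
    convert this using 2 <;> ring_nf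
  upper a b x s t hx hy hs hst ht := by
    simp only [hat_eq_hatProfile, cells_mul_gridPoint_zero hm, cells_mul_gridPoint_one hm, hx, hy]
    have := hatProfile_add_int ((b : ℤ) - (i.2 : ℕ)) ((a : ℤ) - (i.1 : ℕ)) hs hst ht
    push_cast at this ⊢
    rw [hatProfile_comm (_ + s - _), hatProfile_comm ((a : ℝ) - _), hatProfile_comm ((a : ℝ) - _),
      hatProfile_comm ((a : ℝ) + 1 - _)]
    convert this using 2 <;> ring_nf

omit hm in
theorem isP1_sum {ℓ : ℕ} {ι : Type*} (S : Finset ι) (g : ι → Plane → ℝ)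
    (h : ∀ i ∈ S, IsP1 m ℓ (g i)) : IsP1 m ℓ fun x => ∑ i ∈ S, g i x where
  lower a b x s t hx hy ht hts hs := by
    simp only [Finset.sum_mul, ← Finset.sum_add_distrib]
    exact Finset.sum_congr rfl fun i hi => (h i hi).lower a b x s t hx hy ht hts hs
  upper a b x s t hx hy hs hst ht := by
    simp only [Finset.sum_mul, ← Finset.sum_add_distrib]
    exact Finset.sum_congr rfl fun i hi => (h i hi).upper a b x s t hx hy hs hst ht

omit hm in
theorem IsP1.const_mul {ℓ : ℕ} {g : Plane → ℝ} (h : IsP1 m ℓ g) (c : ℝ) :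
    IsP1 m ℓ fun x => c * g x where
  lower a b x s t hx hy ht hts hs := by rw [h.lower a b x s t hx hy ht hts hs]; ring
  upper a b x s t hx hy hs hst ht := by rw [h.upper a b x s t hx hy hs hst ht]; ring

theorem isP1_feFun {ℓ : ℕ} (w : Image m ℓ) : IsP1 m ℓ (feFun m ℓ w) :=
  isP1_sum _ _ fun i _ => (isP1_hat hm i).const_mul _

theorem feFun_gridPoint {ℓ : ℕ} (w : Image m ℓ) (i : Node m ℓ) :
    feFun m ℓ w (gridPoint m ℓ i.1 i.2) = w i := by
  rw [feFun, Finset.sum_eq_single i]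
  · rw [hat_gridPoint hm, if_pos ⟨rfl, rfl⟩, mul_one]
  · intro j _ hj
    rw [hat_gridPoint hm, if_neg, mul_zero]
    rintro ⟨h1, h2⟩
    exact hj (Prod.ext (Fin.ext h1) (Fin.ext h2))
  · simp

omit hm in
theorem cells_mul_succ (ℓ : ℕ) (r : ℝ) : (cells m (ℓ + 1) : ℝ) * r = 2 * (cells m ℓ * r) := by
  rw [cells_succ]; push_cast; ring

theorem cells_mul_gridPoint_succ_zero (ℓ a b : ℕ) :
    cells m ℓ * gridPoint m (ℓ + 1) a b 0 = a / 2 := by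
  have := cells_mul_gridPoint_zero hm (ℓ + 1) a b
  rw [cells_mul_succ] at this
  linarith

theorem cells_mul_gridPoint_succ_one (ℓ a b : ℕ) :
    cells m ℓ * gridPoint m (ℓ + 1) a b 1 = b / 2 := by
  have := cells_mul_gridPoint_one hm (ℓ + 1) a b
  rw [cells_mul_succ] at this
  linarith

/-- Values of a piecewise linear function at the nodes of the next finer level, lower triangle:
the fine node `(2 a + j, 2 b + k)` with `k ≤ j ≤ 2`. -/
theorem IsP1.fine_lower {ℓ : ℕ} {g : Plane → ℝ} (h : IsP1 m ℓ g) (a b j k p q : ℕ)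
    (hp : p = 2 * a + j) (hq : q = 2 * b + k) (hkj : k ≤ j) (hj : j ≤ 2) :
    g (gridPoint m (ℓ + 1) p q) = g (gridPoint m ℓ a b) * (1 - (j : ℝ) / 2) +
      g (gridPoint m ℓ (a + 1) b) * ((j : ℝ) / 2 - k / 2) +
      g (gridPoint m ℓ (a + 1) (b + 1)) * ((k : ℝ) / 2) := by
  have h1 : (k : ℝ) ≤ j := by exact_mod_cast hkj
  have h2 : (j : ℝ) ≤ 2 := by exact_mod_cast hj
  refine h.lower a b _ _ _ ?_ ?_ (by positivity) (by linarith) (by linarith)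
  · rw [cells_mul_gridPoint_succ_zero hm, hp]; push_cast; ring
  · rw [cells_mul_gridPoint_succ_one hm, hq]; push_cast; ring

/-- The analogue of `IsP1.fine_lower` for the upper triangle: the fine node `(2 a + j, 2 b + k)`
with `j ≤ k ≤ 2`. -/
theorem IsP1.fine_upper {ℓ : ℕ} {g : Plane → ℝ} (h : IsP1 m ℓ g) (a b j k p q : ℕ)
    (hp : p = 2 * a + j) (hq : q = 2 * b + k) (hkj : j ≤ k) (hj : k ≤ 2) :
    g (gridPoint m (ℓ + 1) p q) = g (gridPoint m ℓ a b) * (1 - (k : ℝ) / 2) +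
      g (gridPoint m ℓ a (b + 1)) * ((k : ℝ) / 2 - j / 2) +
      g (gridPoint m ℓ (a + 1) (b + 1)) * ((j : ℝ) / 2) := by
  have h1 : (j : ℝ) ≤ k := by exact_mod_cast hkj
  have h2 : (k : ℝ) ≤ 2 := by exact_mod_cast hj
  refine h.upper a b _ _ _ ?_ ?_ (by positivity) (by linarith) (by linarith)
  · rw [cells_mul_gridPoint_succ_zero hm, hp]; push_cast; ring
  · rw [cells_mul_gridPoint_succ_one hm, hq]; push_cast; ring

/-- The meshes are nested. A fine triangle lies in the coarse cell with the halved indices, and the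
parities of its indices together with its type tell in which triangle of that cell. -/
theorem IsP1.succ {ℓ : ℕ} {g : Plane → ℝ} (h : IsP1 m ℓ g) : IsP1 m (ℓ + 1) g where
  lower a b x s t hx hy ht hts hs := by
    replace hx : cells m ℓ * x 0 = (a + s) / 2 := by rw [cells_mul_succ] at hx; linarith
    replace hy : cells m ℓ * x 1 = (b + t) / 2 := by rw [cells_mul_succ] at hy; linarith
    obtain ⟨A, rfl | rfl⟩ := Nat.even_or_odd' a <;> obtain ⟨B, rfl | rfl⟩ := Nat.even_or_odd' b
    · rw [h.lower A B x (s / 2) (t / 2) (by rw [hx]; push_cast; ring)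
        (by rw [hy]; push_cast; ring) (by linarith) (by linarith) (by linarith),
        h.fine_lower hm A B 0 0 (2 * A) (2 * B) rfl rfl (by simp) (by simp),
        h.fine_lower hm A B 1 0 (2 * A + 1) (2 * B) rfl rfl (by simp) (by simp),
        h.fine_lower hm A B 1 1 (2 * A + 1) (2 * B + 1) rfl rfl (by simp) (by simp)]
      push_cast; ring
    · rw [h.upper A B x (s / 2) ((1 + t) / 2) (by rw [hx]; push_cast; ring)
        (by rw [hy]; push_cast; ring) (by linarith) (by linarith) (by linarith),
        h.fine_upper hm A B 0 1 (2 * A) (2 * B + 1) rfl rfl (by simp) (by simp),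
        h.fine_upper hm A B 1 1 (2 * A + 1) (2 * B + 1) rfl rfl (by simp) (by simp),
        h.fine_upper hm A B 1 2 (2 * A + 1) (2 * B + 1 + 1) rfl rfl (by simp) (by simp)]
      push_cast; ring
    · rw [h.lower A B x ((1 + s) / 2) (t / 2) (by rw [hx]; push_cast; ring)
        (by rw [hy]; push_cast; ring) (by linarith) (by linarith) (by linarith),
        h.fine_lower hm A B 1 0 (2 * A + 1) (2 * B) rfl rfl (by simp) (by simp),
        h.fine_lower hm A B 2 0 (2 * A + 1 + 1) (2 * B) rfl rfl (by simp) (by simp),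
        h.fine_lower hm A B 2 1 (2 * A + 1 + 1) (2 * B + 1) rfl rfl (by simp) (by simp)]
      push_cast; ring
    · rw [h.lower A B x ((1 + s) / 2) ((1 + t) / 2) (by rw [hx]; push_cast; ring)
        (by rw [hy]; push_cast; ring) (by linarith) (by linarith) (by linarith),
        h.fine_lower hm A B 1 1 (2 * A + 1) (2 * B + 1) rfl rfl (by simp) (by simp),
        h.fine_lower hm A B 2 1 (2 * A + 1 + 1) (2 * B + 1) rfl rfl (by simp) (by simp),
        h.fine_lower hm A B 2 2 (2 * A + 1 + 1) (2 * B + 1 + 1) rfl rfl (by simp) (by simp)]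
      push_cast; ring
  upper a b x s t hx hy hs hst ht := by
    replace hx : cells m ℓ * x 0 = (a + s) / 2 := by rw [cells_mul_succ] at hx; linarith
    replace hy : cells m ℓ * x 1 = (b + t) / 2 := by rw [cells_mul_succ] at hy; linarith
    obtain ⟨A, rfl | rfl⟩ := Nat.even_or_odd' a <;> obtain ⟨B, rfl | rfl⟩ := Nat.even_or_odd' b
    · rw [h.upper A B x (s / 2) (t / 2) (by rw [hx]; push_cast; ring)
        (by rw [hy]; push_cast; ring) (by linarith) (by linarith) (by linarith),
        h.fine_upper hm A B 0 0 (2 * A) (2 * B) rfl rfl (by simp) (by simp),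
        h.fine_upper hm A B 0 1 (2 * A) (2 * B + 1) rfl rfl (by simp) (by simp),
        h.fine_upper hm A B 1 1 (2 * A + 1) (2 * B + 1) rfl rfl (by simp) (by simp)]
      push_cast; ring
    · rw [h.upper A B x (s / 2) ((1 + t) / 2) (by rw [hx]; push_cast; ring)
        (by rw [hy]; push_cast; ring) (by linarith) (by linarith) (by linarith),
        h.fine_upper hm A B 0 1 (2 * A) (2 * B + 1) rfl rfl (by simp) (by simp),
        h.fine_upper hm A B 0 2 (2 * A) (2 * B + 1 + 1) rfl rfl (by simp) (by simp),
        h.fine_upper hm A B 1 2 (2 * A + 1) (2 * B + 1 + 1) rfl rfl (by simp) (by simp)]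
      push_cast; ring
    · rw [h.lower A B x ((1 + s) / 2) (t / 2) (by rw [hx]; push_cast; ring)
        (by rw [hy]; push_cast; ring) (by linarith) (by linarith) (by linarith),
        h.fine_lower hm A B 1 0 (2 * A + 1) (2 * B) rfl rfl (by simp) (by simp),
        h.fine_lower hm A B 1 1 (2 * A + 1) (2 * B + 1) rfl rfl (by simp) (by simp),
        h.fine_lower hm A B 2 1 (2 * A + 1 + 1) (2 * B + 1) rfl rfl (by simp) (by simp)]
      push_cast; ring
    · rw [h.upper A B x ((1 + s) / 2) ((1 + t) / 2) (by rw [hx]; push_cast; ring)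
        (by rw [hy]; push_cast; ring) (by linarith) (by linarith) (by linarith),
        h.fine_upper hm A B 1 1 (2 * A + 1) (2 * B + 1) rfl rfl (by simp) (by simp),
        h.fine_upper hm A B 1 2 (2 * A + 1) (2 * B + 1 + 1) rfl rfl (by simp) (by simp),
        h.fine_upper hm A B 2 2 (2 * A + 1 + 1) (2 * B + 1 + 1) rfl rfl (by simp) (by simp)]
      push_cast; ring

theorem IsP1.mono {ℓ ℓ' : ℕ} (hℓ : ℓ ≤ ℓ') {g : Plane → ℝ} (h : IsP1 m ℓ g) : IsP1 m ℓ' g := by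
  induction ℓ', hℓ using Nat.le_induction with
  | base => exact h
  | succ n _ ih => exact ih.succ hm

/-- On the finest level, all contributions are piecewise linear. -/
theorem isP1_multilevelFun {L : ℕ} (u : ∀ ℓ : Fin L, Image m ℓ) :
    IsP1 m (L - 1) (multilevelFun m L u) :=
  isP1_sum _ _ fun ℓ _ => (isP1_feFun hm (u ℓ)).mono hm (by omega)

omit hm in
theorem abs_hat_le_one {ℓ : ℕ} (i : Node m ℓ) (x : Plane) : |hat m ℓ i x| ≤ 1 := by
  rw [hat_eq_hatProfile, hatProfile, abs_of_nonneg (le_max_left _ _)]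
  exact max_le zero_le_one (sub_le_self _ (le_max_of_le_left (abs_nonneg _)))

omit hm in
theorem abs_feFun_le {ℓ : ℕ} {w : Image m ℓ} {M : ℝ} (h : ∀ i, |w i| ≤ M)
    (x : Plane) : |feFun m ℓ w x| ≤ Fintype.card (Node m ℓ) * M := by
  have hM : 0 ≤ M := (abs_nonneg _).trans (h (0, 0))
  refine (Finset.abs_sum_le_sum_abs _ _).trans
    ((Finset.sum_le_card_nsmul _ _ M fun i _ => ?_).trans_eq ?_)
  · rw [abs_mul]
    exact (mul_le_mul (h i) (abs_hat_le_one i x) (abs_nonneg _) hM).trans_eq (mul_one M)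
  · rw [nsmul_eq_mul, Finset.card_univ]

omit hm in
theorem abs_multilevelFun_le {L : ℕ} {u : ∀ ℓ : Fin L, Image m ℓ} {M : ℝ}
    (h : ∀ ℓ i, |u ℓ i| ≤ M) (x : Plane) :
    |multilevelFun m L u x| ≤ ∑ ℓ : Fin L, Fintype.card (Node m ℓ) * M :=
  (Finset.abs_sum_le_sum_abs _ _).trans (Finset.sum_le_sum fun ℓ _ => abs_feFun_le (h ℓ) x)

/-! ### Prolongation -/

omit hm in
/-- The pixels inserted by the dilation vanish. -/
theorem dilate_odd {n : ℕ} (x : Fin n × Fin n → ℝ) {a b : ℤ} (h : a % 2 = 1 ∨ b % 2 = 1) :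
    dilate x a b = 0 := by
  refine if_neg ?_
  rw [Int.even_iff, Int.even_iff]
  omega

omit hm in
theorem dilate_nodalImage {ℓ : ℕ} (g : Plane → ℝ) {a b : ℤ} (A B : ℕ) (ha : a = 2 * A)
    (hb : b = 2 * B) (hA : A ≤ cells m ℓ) (hB : B ≤ cells m ℓ) :
    dilate (nodalImage m ℓ g) a b = g (gridPoint m ℓ A B) := by
  rw [dilate, if_pos ⟨⟨A, by omega⟩, ⟨B, by omega⟩⟩,
    zeroExt_of_eq _ (⟨A, by omega⟩, ⟨B, by omega⟩) (by simp only; omega) (by simp only; omega)]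
  rfl

/-- The kernel of the prolongation from a level to the next finer one: nodal values are kept at old
nodes, and averaged over the edge of which a new node is the midpoint. -/
def prolongWeight (d : Offset) : ℝ :=
  if d = (1, 1) then 1 else if d = (0, 2) ∨ d = (2, 0) then 0 else 1 / 2

/-- On nodal values of piecewise linear functions, the transpose strided convolution with the
prolongation kernel is the inclusion of the coarse finite element space into the fine one. -/
theorem IsP1.sum_prolongWeight {ℓ : ℕ} {g : Plane → ℝ} (h : IsP1 m ℓ g) (p : Node m (ℓ + 1)) :
    ∑ d : Offset, prolongWeight d * dilate (nodalImage m ℓ g) ((p.1 : ℕ) + (d.1 : ℕ) - 1)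
      ((p.2 : ℕ) + (d.2 : ℕ) - 1) = nodalImage m (ℓ + 1) g p := by
  obtain ⟨⟨a, ha⟩, ⟨b, hb⟩⟩ := p
  rw [cells_succ] at ha hb
  simp only [Fintype.sum_prod_type, Fin.sum_univ_three, prolongWeight, nodalImage, Prod.mk.injEq,
    Fin.isValue, Fin.val_zero, Fin.val_one, Fin.val_two, Nat.cast_zero, Nat.cast_one,
    Nat.cast_ofNat]
  norm_num [Fin.ext_iff]
  obtain ⟨A, rfl | rfl⟩ := Nat.even_or_odd' a <;> obtain ⟨B, rfl | rfl⟩ := Nat.even_or_odd' b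
  · simp (disch := omega) only [dilate_odd]
    rw [dilate_nodalImage g A B ?_ ?_ ?_ ?_,
      h.fine_lower hm A B 0 0 (2 * A) (2 * B) rfl rfl (by simp) (by simp)]
    · push_cast; ring
    all_goals omega
  · simp (disch := omega) only [dilate_odd]
    rw [dilate_nodalImage g A B ?_ ?_ ?_ ?_, dilate_nodalImage g A (B + 1) ?_ ?_ ?_ ?_,
      h.fine_upper hm A B 0 1 (2 * A) (2 * B + 1) rfl rfl (by simp) (by simp)]
    · push_cast; ring
    all_goals omega
  · simp (disch := omega) only [dilate_odd]
    rw [dilate_nodalImage g A B ?_ ?_ ?_ ?_, dilate_nodalImage g (A + 1) B ?_ ?_ ?_ ?_,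
      h.fine_lower hm A B 1 0 (2 * A + 1) (2 * B) rfl rfl (by simp) (by simp)]
    · push_cast; ring
    all_goals omega
  · simp (disch := omega) only [dilate_odd]
    rw [dilate_nodalImage g A B ?_ ?_ ?_ ?_, dilate_nodalImage g (A + 1) (B + 1) ?_ ?_ ?_ ?_,
      h.fine_lower hm A B 1 1 (2 * A + 1) (2 * B + 1) rfl rfl (by simp) (by simp)]
    · push_cast; ring
    all_goals omega

end P1

/-! ### Barycentric coordinates -/

/-- The vertices of the triangles in the top right quadrant of the lattice point `(a, b)`. -/
def vtx (m ℓ a b : ℕ) (q : Fin 2) (e : Fin 3) : Plane :=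
  gridPoint m ℓ (a + (vertexOffset q e).1) (b + (vertexOffset q e).2)

/-- The barycentric coordinates of the triangles in the top right quadrant of the lattice point
`(a, b)`. -/
def bary (m ℓ a b : ℕ) (q : Fin 2) (e : Fin 3) (x : Plane) : ℝ :=
  let s : ℝ := cells m ℓ * x 0 - a
  let t : ℝ := cells m ℓ * x 1 - b
  ![![1 - s, s - t, t], ![1 - t, s, t - s]] q e

/-- The gradients of the barycentric coordinates, for cells of side length `1`. -/
def baryDir (q : Fin 2) (e : Fin 3) : Plane :=
  ![![!₂[-1, 0], !₂[1, -1], !₂[0, 1]], ![!₂[0, -1], !₂[1, 0], !₂[-1, 1]]] q e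

/-- The barycentric coordinates are affine, with gradient `cells m ℓ • baryDir q e`. -/
theorem bary_eq (m ℓ a b : ℕ) (q : Fin 2) (e : Fin 3) (x : Plane) :
    bary m ℓ a b q e x = bary m ℓ a b q e 0 + inner ℝ ((cells m ℓ : ℝ) • baryDir q e) x := by
  rw [inner_smul_left, PiLp.inner_apply]
  fin_cases q <;> fin_cases e <;> simp [bary, baryDir, Fin.sum_univ_two] <;> ring

theorem bary_add_smul (m ℓ a b : ℕ) (q : Fin 2) (e : Fin 3) (x d : Plane) (r : ℝ) :
    bary m ℓ a b q e (x + r • d) =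
      bary m ℓ a b q e x + r * (cells m ℓ * inner ℝ (baryDir q e) d) := by
  rw [bary_eq, bary_eq (x := x), inner_add_right, inner_smul_right]
  simp only [real_inner_smul_left]
  ring

theorem bary_lineMap (m ℓ a b : ℕ) (q : Fin 2) (e : Fin 3) (x y : Plane) (τ : ℝ) :
    bary m ℓ a b q e (AffineMap.lineMap x y τ) =
      (1 - τ) * bary m ℓ a b q e x + τ * bary m ℓ a b q e y := by
  rw [bary_eq, bary_eq (x := x), bary_eq (x := y), AffineMap.lineMap_apply_module,
    inner_add_right, inner_smul_right, inner_smul_right]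
  ring

theorem continuous_bary (m ℓ a b : ℕ) (q : Fin 2) (e : Fin 3) :
    Continuous (bary m ℓ a b q e) := by
  rw [show bary m ℓ a b q e = fun x => bary m ℓ a b q e 0 +
    inner ℝ ((cells m ℓ : ℝ) • baryDir q e) x from funext (bary_eq m ℓ a b q e)]
  fun_prop

theorem sum_bary (m ℓ a b : ℕ) (q : Fin 2) (x : Plane) : ∑ e, bary m ℓ a b q e x = 1 := by
  fin_cases q <;> simp [bary, Fin.sum_univ_three]

theorem baryDir_ne_zero (q : Fin 2) (e : Fin 3) : baryDir q e ≠ 0 := by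
  intro h
  have h0 := congrArg (fun v : Plane => v 0) h
  have h1 := congrArg (fun v : Plane => v 1) h
  fin_cases q <;> fin_cases e <;> simp [baryDir] at h0 h1

/-- The open triangle. -/
def openTri (m ℓ a b : ℕ) (q : Fin 2) : Set Plane := {x | ∀ e, 0 < bary m ℓ a b q e x}

/-- The closed triangle. -/
def closedTri (m ℓ a b : ℕ) (q : Fin 2) : Set Plane := {x | ∀ e, 0 ≤ bary m ℓ a b q e x}

theorem isOpen_openTri (m ℓ a b : ℕ) (q : Fin 2) : IsOpen (openTri m ℓ a b q) := by
  rw [show openTri m ℓ a b q = ⋂ e, {x | 0 < bary m ℓ a b q e x} by ext; simp [openTri]]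
  exact isOpen_iInter_of_finite fun e => isOpen_lt continuous_const (continuous_bary m ℓ a b q e)

theorem isClosed_closedTri (m ℓ a b : ℕ) (q : Fin 2) : IsClosed (closedTri m ℓ a b q) := by
  rw [show closedTri m ℓ a b q = ⋂ e, {x | 0 ≤ bary m ℓ a b q e x} by ext; simp [closedTri]]
  exact isClosed_iInter fun e => isClosed_le continuous_const (continuous_bary m ℓ a b q e)

theorem openTri_subset_closedTri (m ℓ a b : ℕ) (q : Fin 2) :
    openTri m ℓ a b q ⊆ closedTri m ℓ a b q := fun _ hx e => (hx e).le

/-- Lines have measure zero. -/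
theorem volume_line_eq_zero {G : Plane} (hG : G ≠ 0) (c : ℝ) :
    volume {x : Plane | c + inner ℝ G x = 0} = 0 := by
  let A : AffineSubspace ℝ Plane :=
    { carrier := {x : Plane | c + inner ℝ G x = 0}
      smul_vsub_vadd_mem' := by
        intro k p₁ p₂ p₃ h₁ h₂ h₃
        simp only [Set.mem_ofPred_eq, vsub_eq_sub, vadd_eq_add, inner_add_right, inner_smul_right,
          inner_sub_right] at h₁ h₂ h₃ ⊢
        linear_combination k * h₁ - k * h₂ + h₃ }
  refine Measure.addHaar_affineSubspace volume A fun h => hG ?_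
  have h0 : (0 : Plane) ∈ A := h ▸ AffineSubspace.mem_top ℝ Plane 0
  have h1 : G ∈ A := h ▸ AffineSubspace.mem_top ℝ Plane G
  have h0' : c + inner ℝ G (0 : Plane) = 0 := h0
  have h1' : c + inner ℝ G G = 0 := h1
  rw [inner_zero_right] at h0'
  exact inner_self_eq_zero.1 (by linarith : inner ℝ G G = 0)

section Mesh

variable {m : ℕ} (hm : 0 < m)
include hm

theorem volume_bary_eq_zero (ℓ a b : ℕ) (q : Fin 2) (e : Fin 3) :
    volume {x | bary m ℓ a b q e x = 0} = 0 := by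
  have := volume_line_eq_zero (G := (cells m ℓ : ℝ) • baryDir q e)
    (smul_ne_zero (cells_pos hm ℓ).ne' (baryDir_ne_zero q e)) (bary m ℓ a b q e 0)
  simpa only [← bary_eq] using this

/-- The boundary of a triangle is a null set. -/
theorem ae_mem_openTri (ℓ a b : ℕ) (q : Fin 2) :
    ∀ᵐ x ∂volume.restrict (closedTri m ℓ a b q), x ∈ openTri m ℓ a b q := by
  rw [ae_restrict_iff' (isClosed_closedTri m ℓ a b q).measurableSet]
  have : ∀ᵐ x : Plane, ∀ e, bary m ℓ a b q e x ≠ 0 :=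
    ae_all_iff.2 fun e => by
      simpa [ae_iff] using volume_bary_eq_zero hm ℓ a b q e
  filter_upwards [this] with x hx h e
  exact lt_of_le_of_ne (h e) (hx e).symm

theorem bary_vtx (ℓ a b : ℕ) (q : Fin 2) (e e' : Fin 3) :
    bary m ℓ a b q e (vtx m ℓ a b q e') = if e = e' then 1 else 0 := by
  simp only [bary, vtx, cells_mul_gridPoint_zero hm, cells_mul_gridPoint_one hm]
  fin_cases q <;> fin_cases e <;> fin_cases e' <;> simp [vertexOffset]

theorem sum_bary_smul_vtx (ℓ a b : ℕ) (q : Fin 2) (x : Plane) :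
    ∑ e, bary m ℓ a b q e x • vtx m ℓ a b q e = x := by
  have := cells_pos hm ℓ
  ext j
  fin_cases q <;> fin_cases j <;>
    simp [bary, vtx, vertexOffset, gridPoint, Fin.sum_univ_three] <;> field_simp <;> ring

theorem tri_eq_closedTri (ℓ : ℕ) (q : Fin 2) (i : Node m ℓ) :
    tri m ℓ q i = closedTri m ℓ i.1 i.2 q := by
  apply Set.Subset.antisymm
  · refine convexHull_min ?_ ?_
    · rintro _ ⟨e', rfl⟩ e
      change 0 ≤ bary m ℓ i.1 i.2 q e (vtx m ℓ i.1 i.2 q e')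
      rw [bary_vtx hm]
      split_ifs <;> simp
    · intro x hx y hy α β hα hβ hαβ e
      have := bary_lineMap m ℓ i.1 i.2 q e x y β
      rw [AffineMap.lineMap_apply_module, show 1 - β = α by linarith] at this
      rw [this]
      exact add_nonneg (mul_nonneg hα (hx e)) (mul_nonneg hβ (hy e))
  · intro x hx
    rw [← sum_bary_smul_vtx hm ℓ i.1 i.2 q x]
    exact (convex_convexHull ℝ _).sum_mem (fun e _ => hx e) (sum_bary m ℓ i.1 i.2 q x)
      fun e _ => subset_convexHull ℝ _ ⟨e, rfl⟩

omit hm in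
theorem isCompact_tri (ℓ : ℕ) (q : Fin 2) (i : Node m ℓ) : IsCompact (tri m ℓ q i) :=
  (Set.finite_range _).isCompact_convexHull ℝ

omit hm in
theorem IsP1.eq_sum_bary {ℓ : ℕ} {g : Plane → ℝ} (h : IsP1 m ℓ g) {a b : ℕ} {q : Fin 2}
    {x : Plane} (hx : x ∈ closedTri m ℓ a b q) :
    g x = ∑ e, g (vtx m ℓ a b q e) * bary m ℓ a b q e x := by
  have h0 := hx 0
  have h1 := hx 1
  have h2 := hx 2
  rw [Fin.sum_univ_three]
  fin_cases q <;> simp only [bary, vtx, vertexOffset, Fin.zero_eta, Fin.mk_one, Fin.isValue,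
    Matrix.cons_val_zero, Matrix.cons_val_one, Matrix.cons_val_fin_one, Matrix.cons_val,
    add_zero] at h0 h1 h2 ⊢
  · exact h.lower a b x _ _ (add_sub_cancel _ _).symm (add_sub_cancel _ _).symm h2
      (by linarith) (by linarith)
  · rw [h.upper a b x _ _ (add_sub_cancel _ _).symm (add_sub_cancel _ _).symm h1
      (by linarith) (by linarith)]
    ring

/-! ### Derivatives of piecewise linear functions -/

omit hm in
/-- The gradient of a piecewise linear function on a triangle. -/
def p1Grad (m ℓ a b : ℕ) (q : Fin 2) (g : Plane → ℝ) : Plane :=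
  ∑ e, g (vtx m ℓ a b q e) • ((cells m ℓ : ℝ) • baryDir q e)

omit hm in
theorem hasGradientAt_const_add_inner (c : ℝ) (G x : Plane) :
    HasGradientAt (fun z => c + inner ℝ G z) G x := by
  rw [hasGradientAt_iff_hasFDerivAt]
  exact (InnerProductSpace.toDual ℝ Plane G).hasFDerivAt.const_add c

omit hm in
theorem IsP1.hasGradientAt {ℓ : ℕ} {g : Plane → ℝ} (h : IsP1 m ℓ g) {a b : ℕ} {q : Fin 2}
    {x : Plane} (hx : x ∈ openTri m ℓ a b q) : HasGradientAt g (p1Grad m ℓ a b q g) x := by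
  refine (hasGradientAt_const_add_inner
    (∑ e, g (vtx m ℓ a b q e) * bary m ℓ a b q e 0) _ x).congr_of_eventuallyEq ?_
  filter_upwards [(isOpen_openTri m ℓ a b q).mem_nhds hx] with z hz
  rw [h.eq_sum_bary (openTri_subset_closedTri _ _ _ _ _ hz), p1Grad, sum_inner,
    ← Finset.sum_add_distrib]
  refine Finset.sum_congr rfl fun e _ => ?_
  rw [bary_eq, real_inner_smul_left (x := _ • _), mul_add]

omit hm in
/-- Inside a triangle the gradient of `u` is constant, so that the divergence is a product of
gradients. -/
theorem IsP1.divergence_eq {ℓ : ℕ} {κ u : Plane → ℝ} (hκ : IsP1 m ℓ κ) (hu : IsP1 m ℓ u)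
    {a b : ℕ} {q : Fin 2} {x : Plane} (hx : x ∈ openTri m ℓ a b q) :
    divergence (fun z => κ z • gradient u z) x =
      ∑ j, p1Grad m ℓ a b q κ j * p1Grad m ℓ a b q u j := by
  have e : (fun z => κ z • gradient u z) =ᶠ[𝓝 x] fun z => κ z • p1Grad m ℓ a b q u := by
    filter_upwards [(isOpen_openTri m ℓ a b q).mem_nhds hx] with z hz
    rw [(hu.hasGradientAt hz).gradient]
  have hd := (hasGradientAt_iff_hasFDerivAt.1 (hκ.hasGradientAt hx)).smul_const
    (p1Grad m ℓ a b q u)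
  rw [divergence, e.fderiv_eq, hd.fderiv]
  refine Finset.sum_congr rfl fun j _ => ?_
  simp [EuclideanSpace.inner_single_right]

/-- The one-sided gradient at a point of the boundary of a triangle, in a direction that points
into the triangle. -/
theorem IsP1.sideGradient_eq {ℓ : ℕ} {u : Plane → ℝ} (hu : IsP1 m ℓ u) {a b : ℕ} {q : Fin 2}
    {x d : Plane} (h : ∀ e, 0 < bary m ℓ a b q e x ∨
      bary m ℓ a b q e x = 0 ∧ 0 < inner ℝ (baryDir q e) d) :
    sideGradient u x d = p1Grad m ℓ a b q u := by
  refine Tendsto.limUnder_eq (tendsto_const_nhds.congr' ?_)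
  have : ∀ᶠ r in 𝓝[>] (0 : ℝ), ∀ e, 0 < bary m ℓ a b q e (x + r • d) := by
    refine eventually_all.2 fun e => ?_
    simp only [bary_add_smul]
    rcases h e with h | ⟨h, h'⟩
    · have hc : ContinuousAt (fun r : ℝ => bary m ℓ a b q e x +
          r * (cells m ℓ * inner ℝ (baryDir q e) d)) 0 := by fun_prop
      exact nhdsWithin_le_nhds (hc.eventually (lt_mem_nhds (by simpa using h)))
    · filter_upwards [self_mem_nhdsWithin] with r hr
      rw [h, zero_add]
      exact mul_pos hr (mul_pos (cells_pos hm ℓ) h')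
  filter_upwards [this] with r hr
  exact (hu.hasGradientAt hr).gradient.symm

/-! ### Element residuals -/

omit hm in
/-- The entries of the element mass matrix. All triangles of the same type have the same one. -/
def massEntry (m ℓ : ℕ) (q : Fin 2) (e e' : Fin 3) : ℝ :=
  ∫ x in closedTri m ℓ 0 0 q, bary m ℓ 0 0 q e x * bary m ℓ 0 0 q e' x

theorem bary_sub_gridPoint (ℓ a b : ℕ) (q : Fin 2) (e : Fin 3) (x : Plane) :
    bary m ℓ 0 0 q e (x - gridPoint m ℓ a b) = bary m ℓ a b q e x := by
  simp only [bary, PiLp.sub_apply, mul_sub, cells_mul_gridPoint_zero hm,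
    cells_mul_gridPoint_one hm, Nat.cast_zero, sub_zero]

/-- The mass matrix is translation invariant. -/
theorem integral_bary_mul_bary (ℓ a b : ℕ) (q : Fin 2) (e e' : Fin 3) :
    ∫ x in closedTri m ℓ a b q, bary m ℓ a b q e x * bary m ℓ a b q e' x =
      massEntry m ℓ q e e' := by
  have h := (measurePreserving_sub_right (volume : Measure Plane)
    (gridPoint m ℓ a b)).setIntegral_preimage_emb
    (MeasurableEquiv.subRight (gridPoint m ℓ a b)).measurableEmbedding
    (fun x => bary m ℓ 0 0 q e x * bary m ℓ 0 0 q e' x) (closedTri m ℓ 0 0 q)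
  simp only [bary_sub_gridPoint hm] at h
  rw [massEntry, ← h]
  congr 2
  ext x
  simp [closedTri, bary_sub_gridPoint hm]

/-- The integrand of the element residual on a triangle is a.e. the square of an affine function. -/
theorem IsP1.residual_ae_eq {ℓ : ℕ} {κ f u : Plane → ℝ} (hκ : IsP1 m ℓ κ) (hf : IsP1 m ℓ f)
    (hu : IsP1 m ℓ u) (a b : ℕ) (q : Fin 2) :
    (fun x => (f x + divergence (fun z => κ z • gradient u z) x) ^ 2)
      =ᵐ[volume.restrict (closedTri m ℓ a b q)] fun x => ∑ e, ∑ e',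
        ((f (vtx m ℓ a b q e) + ∑ j, p1Grad m ℓ a b q κ j * p1Grad m ℓ a b q u j) *
        (f (vtx m ℓ a b q e') + ∑ j, p1Grad m ℓ a b q κ j * p1Grad m ℓ a b q u j)) *
        (bary m ℓ a b q e x * bary m ℓ a b q e' x) := by
  filter_upwards [ae_mem_openTri hm ℓ a b q] with x hx
  rw [hκ.divergence_eq hu hx, hf.eq_sum_bary (openTri_subset_closedTri _ _ _ _ _ hx)]
  set D := ∑ j, p1Grad m ℓ a b q κ j * p1Grad m ℓ a b q u j
  have : D = ∑ e, D * bary m ℓ a b q e x := by rw [← Finset.mul_sum, sum_bary, mul_one]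
  conv_lhs => rw [this, ← Finset.sum_add_distrib, sq, Finset.sum_mul_sum]
  refine Finset.sum_congr rfl fun e _ => Finset.sum_congr rfl fun e' _ => ?_
  ring

theorem integrableOn_bary_mul_bary {ℓ : ℕ} (i : Node m ℓ) (q : Fin 2) (e e' : Fin 3) :
    IntegrableOn (fun x => bary m ℓ i.1 i.2 q e x * bary m ℓ i.1 i.2 q e' x)
      (closedTri m ℓ i.1 i.2 q) := by
  refine ContinuousOn.integrableOn_compact ?_ ?_
  · rw [← tri_eq_closedTri hm]; exact isCompact_tri ℓ q i
  · exact ((continuous_bary _ _ _ _ _ _).mul (continuous_bary _ _ _ _ _ _)).continuousOn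

theorem IsP1.integrableOn_residual {ℓ : ℕ} {κ f u : Plane → ℝ} (hκ : IsP1 m ℓ κ)
    (hf : IsP1 m ℓ f) (hu : IsP1 m ℓ u) (i : Node m ℓ) (q : Fin 2) :
    IntegrableOn (fun x => (f x + divergence (fun z => κ z • gradient u z) x) ^ 2)
      (tri m ℓ q i) := by
  rw [tri_eq_closedTri hm]
  refine Integrable.congr ?_ (hκ.residual_ae_eq hm hf hu i.1 i.2 q).symm
  exact integrable_finsetSum _ fun e _ => integrable_finsetSum _ fun e' _ =>
    (integrableOn_bary_mul_bary hm i q e e').const_mul _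

/-- The element residual is a quadratic form in vertex values. -/
theorem IsP1.residualSq_eq {ℓ : ℕ} {κ f u : Plane → ℝ} (hκ : IsP1 m ℓ κ)
    (hf : IsP1 m ℓ f) (hu : IsP1 m ℓ u) (i : Node m ℓ) (q : Fin 2) :
    residualSq m ℓ κ f u q i = Metric.diam (tri m ℓ q i) ^ 2 * ∑ e, ∑ e',
      ((f (triVertex m ℓ q i e) + ∑ j, p1Grad m ℓ i.1 i.2 q κ j * p1Grad m ℓ i.1 i.2 q u j) *
      (f (triVertex m ℓ q i e') + ∑ j, p1Grad m ℓ i.1 i.2 q κ j * p1Grad m ℓ i.1 i.2 q u j)) *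
        massEntry m ℓ q e e' := by
  rw [residualSq]
  congr 1
  conv_lhs => rw [tri_eq_closedTri hm]
  rw [integral_congr_ae (hκ.residual_ae_eq hm hf hu i.1 i.2 q), integral_finsetSum]
  · refine Finset.sum_congr rfl fun e _ => ?_
    rw [integral_finsetSum]
    · refine Finset.sum_congr rfl fun e' _ => ?_
      rw [integral_const_mul, integral_bary_mul_bary hm]
      rfl
    · exact fun e' _ => (integrableOn_bary_mul_bary hm i q e e').const_mul _
  · exact fun e _ => integrable_finsetSum _ fun e' _ =>
      (integrableOn_bary_mul_bary hm i q e e').const_mul _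

/-! ### Jumps over edges -/

omit hm in
theorem jump_neg (κ u : Plane → ℝ) (n x : Plane) : jump κ u (-n) x = jump κ u n x := by
  simp only [jump, neg_neg, add_comm]

omit hm in
theorem unitNormal_comm (p r : Plane) : unitNormal r p = -unitNormal p r := by
  rw [unitNormal, unitNormal, dist_comm, ← smul_neg]
  congr 1
  ext j
  fin_cases j <;> simp

omit hm in
/-- The contribution of an edge does not depend on its orientation, which only changes the sign of
the normal. -/
theorem edgeJumpSq_comm (κ u : Plane → ℝ) (p r : Plane) :
    edgeJumpSq κ u r p = edgeJumpSq κ u p r := by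
  have hb : OnBoundary r p ↔ OnBoundary p r := by simp only [OnBoundary, and_comm]
  by_cases h : OnBoundary p r
  · rw [edgeJumpSq, edgeJumpSq, if_pos h, if_pos (hb.2 h)]
  · rw [edgeJumpSq, edgeJumpSq, if_neg h, if_neg (mt hb.1 h), dist_comm]
    have := intervalIntegral.integral_comp_sub_left (a := 0) (b := 1)
      (fun t : ℝ => (jump κ u (unitNormal p r) (AffineMap.lineMap p r t)) ^ 2) 1
    simp only [sub_self, sub_zero, AffineMap.lineMap_apply_one_sub] at this
    rw [← this]
    simp only [unitNormal_comm p r, jump_neg]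

omit hm in
/-- The squared jump is integrable over the segment from `p` to `r`. -/
def JumpIntegrable (κ u : Plane → ℝ) (p r : Plane) : Prop :=
  IntervalIntegrable (fun t : ℝ => (jump κ u (unitNormal p r) (AffineMap.lineMap p r t)) ^ 2)
    volume 0 1

/-- The jump over an edge between two triangles: `p` and `r` are the vertices `i`, `j` of the first
one and `i'`, `j'` of the second one; the unit normal points out of the first and into the second
triangle. -/
theorem IsP1.jump_ae_eq {ℓ : ℕ} {κ u : Plane → ℝ} (hκ : IsP1 m ℓ κ) (hu : IsP1 m ℓ u)
    {a b a' b' : ℕ} {q q' : Fin 2} {i j k i' j' k' : Fin 3} {p r : Plane}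
    (hi : vtx m ℓ a b q i = p) (hj : vtx m ℓ a b q j = r)
    (hi' : vtx m ℓ a' b' q' i' = p) (hj' : vtx m ℓ a' b' q' j' = r)
    (hk : i ≠ j ∧ ∀ e, e ≠ i → e ≠ j → e = k) (hk' : i' ≠ j' ∧ ∀ e, e ≠ i' → e ≠ j' → e = k')
    (hn : inner ℝ (baryDir q k) (unitNormal p r) < 0)
    (hn' : 0 < inner ℝ (baryDir q' k') (unitNormal p r)) {t : ℝ} (ht : t ∈ Set.Ioo (0 : ℝ) 1) :
    jump κ u (unitNormal p r) (AffineMap.lineMap p r t) =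
      (κ p * (1 - t) + κ r * t) *
        inner ℝ (p1Grad m ℓ a b q u - p1Grad m ℓ a' b' q' u) (unitNormal p r) := by
  -- barycentric coordinates of a point of the edge, in either of the two triangles
  have key : ∀ {a b : ℕ} {q : Fin 2} {i j : Fin 3}, i ≠ j → vtx m ℓ a b q i = p →
      vtx m ℓ a b q j = r → ∀ e, bary m ℓ a b q e (AffineMap.lineMap p r t) =
        if e = i then 1 - t else if e = j then t else 0 := by
    intro a b q i j hij hi hj e
    rw [bary_lineMap, ← hi, ← hj, bary_vtx hm, bary_vtx hm]
    by_cases h1 : e = i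
    · simp [h1, hij]
    · simp [h1]
  have side : ∀ {a b : ℕ} {q : Fin 2} {i j k : Fin 3} {d : Plane},
      (i ≠ j ∧ ∀ e, e ≠ i → e ≠ j → e = k) → vtx m ℓ a b q i = p → vtx m ℓ a b q j = r →
      0 < inner ℝ (baryDir q k) d →
      sideGradient u (AffineMap.lineMap p r t) d = p1Grad m ℓ a b q u := by
    intro a b q i j k d hk hi hj hd
    refine hu.sideGradient_eq hm fun e => ?_
    rw [key hk.1 hi hj e]
    by_cases h1 : e = i
    · left; simp [h1, ht.2]
    · by_cases h2 : e = j
      · left; simp [h2, hk.1.symm, ht.1]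
      · right
        rw [if_neg h1, if_neg h2, hk.2 e h1 h2]
        exact ⟨rfl, hd⟩
  have hx : AffineMap.lineMap p r t ∈ closedTri m ℓ a b q := fun e => by
    rw [key hk.1 hi hj e]
    split_ifs <;> linarith [ht.1, ht.2]
  have hκx : κ (AffineMap.lineMap p r t) = κ p * (1 - t) + κ r * t := by
    rw [hκ.eq_sum_bary hx]
    simp only [key hk.1 hi hj]
    rw [← Finset.sum_subset (Finset.subset_univ {i, j}), Finset.sum_pair hk.1, hi, hj]
    · simp [hk.1.symm]
    · intro e _ he
      simp only [Finset.mem_insert, Finset.mem_singleton, not_or] at he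
      simp [he.1, he.2]
  rw [jump, hκx, side hk hi hj (by rwa [inner_neg_right, neg_pos]), side hk' hi' hj' hn',
    inner_sub_left, inner_neg_right, ← sub_eq_add_neg]

omit hm in
theorem integral_affine_sq (α β J : ℝ) :
    ∫ t in (0 : ℝ)..1, ((α * (1 - t) + β * t) * J) ^ 2 =
      J ^ 2 * ((α ^ 2 + α * β + β ^ 2) / 3) := by
  have e : ∀ t : ℝ, ((α * (1 - t) + β * t) * J) ^ 2 =
      α ^ 2 * J ^ 2 + 2 * α * (β - α) * J ^ 2 * t + (β - α) ^ 2 * J ^ 2 * t ^ 2 := fun t => by ring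
  simp only [e]
  rw [intervalIntegral.integral_add, intervalIntegral.integral_add,
    intervalIntegral.integral_const_mul, intervalIntegral.integral_const_mul,
    intervalIntegral.integral_const_mul, intervalIntegral.integral_const, integral_id,
    integral_pow]
  · norm_num
    ring
  all_goals exact Continuous.intervalIntegrable (by fun_prop) _ _

/-- The squared jump over an interior edge, see `IsP1.jump_ae_eq` for the conventions. -/
theorem IsP1.edgeJumpSq_eq {ℓ : ℕ} {κ u : Plane → ℝ} (hκ : IsP1 m ℓ κ) (hu : IsP1 m ℓ u)
    {a b a' b' : ℕ} {q q' : Fin 2} {i j k i' j' k' : Fin 3} {p r : Plane}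
    (hi : vtx m ℓ a b q i = p) (hj : vtx m ℓ a b q j = r)
    (hi' : vtx m ℓ a' b' q' i' = p) (hj' : vtx m ℓ a' b' q' j' = r)
    (hk : i ≠ j ∧ ∀ e, e ≠ i → e ≠ j → e = k) (hk' : i' ≠ j' ∧ ∀ e, e ≠ i' → e ≠ j' → e = k')
    (hn : inner ℝ (baryDir q k) (unitNormal p r) < 0)
    (hn' : 0 < inner ℝ (baryDir q' k') (unitNormal p r)) :
    JumpIntegrable κ u p r ∧ (¬OnBoundary p r → edgeJumpSq κ u p r = dist p r *
      (inner ℝ (p1Grad m ℓ a b q u - p1Grad m ℓ a' b' q' u) (unitNormal p r) ^ 2 *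
        ((κ p ^ 2 + κ p * κ r + κ r ^ 2) / 3))) := by
  set J := inner ℝ (p1Grad m ℓ a b q u - p1Grad m ℓ a' b' q' u) (unitNormal p r)
  have h : Set.EqOn (fun t : ℝ => (jump κ u (unitNormal p r) (AffineMap.lineMap p r t)) ^ 2)
      (fun t => ((κ p * (1 - t) + κ r * t) * J) ^ 2) (Set.uIoo 0 1) := by
    intro t ht
    rw [Set.uIoo_of_le zero_le_one] at ht
    simp only
    rw [hκ.jump_ae_eq hm hu hi hj hi' hj' hk hk' hn hn' ht]
  constructor
  · rw [JumpIntegrable, intervalIntegrable_congr_uIoo h]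
    exact Continuous.intervalIntegrable (by fun_prop) _ _
  · intro hb
    rw [edgeJumpSq, if_neg hb, intervalIntegral.integral_congr_uIoo h, integral_affine_sq]

/-! ### The three families of edges -/

omit hm in
/-- Directions of the edges that start at a node: horizontal, vertical, and diagonal. -/
def edgeOffset : Fin 3 → ℕ × ℕ := ![(1, 0), (0, 1), (1, 1)]

omit hm in
/-- Lengths of the edges for cells of side length `1`. -/
def edgeLength : Fin 3 → ℝ := ![1, 1, √2]

omit hm in
/-- The squared jump over the edge of the family `t` that starts at the lattice point `(a, b)`. -/
def edgeSq (m ℓ : ℕ) (κ u : Plane → ℝ) (t : Fin 3) (a b : ℕ) : ℝ :=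
  edgeJumpSq κ u (gridPoint m ℓ a b)
    (gridPoint m ℓ (a + (edgeOffset t).1) (b + (edgeOffset t).2))

omit hm in
theorem edgeLength_pos (t : Fin 3) : 0 < edgeLength t := by
  fin_cases t <;> simp [edgeLength]

omit hm in
theorem gridPoint_zero (ℓ a b : ℕ) : gridPoint m ℓ a b 0 = a / cells m ℓ := rfl

omit hm in
theorem gridPoint_one (ℓ a b : ℕ) : gridPoint m ℓ a b 1 = b / cells m ℓ := rfl

theorem dist_gridPoint (ℓ a b c d : ℕ) : dist (gridPoint m ℓ a b) (gridPoint m ℓ c d) =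
    √(((a : ℝ) - c) ^ 2 + ((b : ℝ) - d) ^ 2) / cells m ℓ := by
  have hN := cells_pos hm ℓ
  rw [EuclideanSpace.dist_eq, Fin.sum_univ_two, gridPoint_zero, gridPoint_one, gridPoint_zero,
    gridPoint_one, Real.dist_eq, Real.dist_eq, sq_abs, sq_abs, ← sub_div, ← sub_div, div_pow,
    div_pow, ← add_div, Real.sqrt_div (by positivity), Real.sqrt_sq hN.le]

theorem dist_edge (ℓ : ℕ) (t : Fin 3) (a b : ℕ) : dist (gridPoint m ℓ a b)
    (gridPoint m ℓ (a + (edgeOffset t).1) (b + (edgeOffset t).2)) =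
      edgeLength t / cells m ℓ := by
  rw [dist_gridPoint hm]
  fin_cases t <;> norm_num [edgeOffset, edgeLength]

theorem unitNormal_edge (ℓ : ℕ) (t : Fin 3) (a b : ℕ) : unitNormal (gridPoint m ℓ a b)
    (gridPoint m ℓ (a + (edgeOffset t).1) (b + (edgeOffset t).2)) =
      (edgeLength t)⁻¹ • !₂[((edgeOffset t).2 : ℝ), -((edgeOffset t).1 : ℝ)] := by
  have hN := cells_pos hm ℓ
  have hl := edgeLength_pos t
  rw [unitNormal, dist_edge hm]
  ext j
  fin_cases j
  · simp only [gridPoint_zero, gridPoint_one, Fin.zero_eta, PiLp.smul_apply,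
      Matrix.cons_val_zero, smul_eq_mul, Nat.cast_add]
    field_simp; ring
  · simp only [gridPoint_zero, gridPoint_one, Fin.mk_one, PiLp.smul_apply,
      Matrix.cons_val_one, Matrix.cons_val_fin_one, smul_eq_mul, Nat.cast_add]
    field_simp; ring

/-- Edges of the mesh on the boundary of the square are horizontal ones in the first and last row,
and vertical ones in the first and last column. -/
theorem onBoundary_edge (ℓ : ℕ) (t : Fin 3) (a b : ℕ) : OnBoundary (gridPoint m ℓ a b)
    (gridPoint m ℓ (a + (edgeOffset t).1) (b + (edgeOffset t).2)) ↔
      (t = 0 ∧ (b = 0 ∨ b = cells m ℓ)) ∨ (t = 1 ∧ (a = 0 ∨ a = cells m ℓ)) := by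
  have hN := cells_pos hm ℓ
  have h0 : ∀ n : ℕ, (n : ℝ) / cells m ℓ = 0 ↔ n = 0 := fun n => by
    rw [div_eq_zero_iff, Nat.cast_eq_zero]; simp only [hN.ne', or_false]
  have h1 : ∀ n : ℕ, (n : ℝ) / cells m ℓ = 1 ↔ n = cells m ℓ := fun n => by
    rw [div_eq_one_iff_eq hN.ne', Nat.cast_inj]
  simp only [OnBoundary, Fin.exists_fin_two, gridPoint_zero, gridPoint_one, h0, h1]
  fin_cases t <;> simp [edgeOffset] <;> omega

omit hm in
theorem p1Grad_lower (ℓ a b : ℕ) (g : Plane → ℝ) : p1Grad m ℓ a b 0 g = (cells m ℓ : ℝ) •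
    !₂[g (gridPoint m ℓ (a + 1) b) - g (gridPoint m ℓ a b),
      g (gridPoint m ℓ (a + 1) (b + 1)) - g (gridPoint m ℓ (a + 1) b)] := by
  ext j
  fin_cases j <;> simp [p1Grad, Fin.sum_univ_three, baryDir, vtx, vertexOffset] <;> ring

omit hm in
theorem p1Grad_upper (ℓ a b : ℕ) (g : Plane → ℝ) : p1Grad m ℓ a b 1 g = (cells m ℓ : ℝ) •
    !₂[g (gridPoint m ℓ (a + 1) (b + 1)) - g (gridPoint m ℓ a (b + 1)),
      g (gridPoint m ℓ a (b + 1)) - g (gridPoint m ℓ a b)] := by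
  ext j
  fin_cases j <;> simp [p1Grad, Fin.sum_univ_three, baryDir, vtx, vertexOffset] <;> ring

omit hm in
/-- The factor that depends on the family and the level in the formula for the squared jump over an
edge. -/
def edgeFactor (m ℓ : ℕ) (t : Fin 3) : ℝ := cells m ℓ / edgeLength t / 3

/-- The squared jump over an interior horizontal edge, between the lower triangle of the cell above
and the upper triangle of the cell below. -/
theorem IsP1.edgeSq_horizontal {ℓ : ℕ} {κ u : Plane → ℝ} (hκ : IsP1 m ℓ κ) (hu : IsP1 m ℓ u)
    (a b : ℕ) (hb : b + 1 ≠ cells m ℓ) :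
    JumpIntegrable κ u (gridPoint m ℓ a (b + 1)) (gridPoint m ℓ (a + 1) (b + 1)) ∧
    edgeSq m ℓ κ u 0 a (b + 1) = edgeFactor m ℓ 0 *
      ((u (gridPoint m ℓ a (b + 1)) - u (gridPoint m ℓ a b) -
        u (gridPoint m ℓ (a + 1) (b + 2)) + u (gridPoint m ℓ (a + 1) (b + 1))) ^ 2 *
      (κ (gridPoint m ℓ a (b + 1)) ^ 2 +
        κ (gridPoint m ℓ a (b + 1)) * κ (gridPoint m ℓ (a + 1) (b + 1)) +
        κ (gridPoint m ℓ (a + 1) (b + 1)) ^ 2)) := by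
  have hN := cells_pos hm ℓ
  have hn := unitNormal_edge hm ℓ 0 a (b + 1)
  have hd := dist_edge hm ℓ 0 a (b + 1)
  have hbd := onBoundary_edge hm ℓ 0 a (b + 1)
  simp only [edgeOffset, edgeLength, Matrix.cons_val_zero, add_zero, inv_one, one_smul,
    Nat.cast_zero, Nat.cast_one] at hn hd hbd
  have h := hκ.edgeJumpSq_eq hm hu (a := a) (b := b + 1) (q := 0) (i := 0) (j := 1) (k := 2)
    (a' := a) (b' := b) (q' := 1) (i' := 2) (j' := 1) (k' := 0) rfl rfl rfl rfl
    (by decide) (by decide)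
    (by rw [show vtx m ℓ a (b + 1) 0 0 = gridPoint m ℓ a (b + 1) from rfl,
          show vtx m ℓ a (b + 1) 0 1 = gridPoint m ℓ (a + 1) (b + 1) from rfl, hn]
        simp [baryDir, PiLp.inner_apply, Fin.sum_univ_two])
    (by rw [show vtx m ℓ a (b + 1) 0 0 = gridPoint m ℓ a (b + 1) from rfl,
          show vtx m ℓ a (b + 1) 0 1 = gridPoint m ℓ (a + 1) (b + 1) from rfl, hn]
        simp [baryDir])
  rw [show vtx m ℓ a (b + 1) 0 0 = gridPoint m ℓ a (b + 1) from rfl,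
    show vtx m ℓ a (b + 1) 0 1 = gridPoint m ℓ (a + 1) (b + 1) from rfl] at h
  refine ⟨h.1, (h.2 ?_).trans ?_⟩
  · rw [hbd]; simp; exact hb
  · rw [hd, hn, p1Grad_lower, p1Grad_upper, edgeFactor]
    simp [PiLp.inner_apply, Fin.sum_univ_two, edgeLength]
    field_simp
    ring

/-- The squared jump over an interior vertical edge, between the lower triangle of the cell on the
left and the upper triangle of the cell on the right. -/
theorem IsP1.edgeSq_vertical {ℓ : ℕ} {κ u : Plane → ℝ} (hκ : IsP1 m ℓ κ) (hu : IsP1 m ℓ u)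
    (a b : ℕ) (ha : a + 1 ≠ cells m ℓ) :
    JumpIntegrable κ u (gridPoint m ℓ (a + 1) b) (gridPoint m ℓ (a + 1) (b + 1)) ∧
    edgeSq m ℓ κ u 1 (a + 1) b = edgeFactor m ℓ 1 *
      ((u (gridPoint m ℓ (a + 1) b) - u (gridPoint m ℓ a b) -
        u (gridPoint m ℓ (a + 2) (b + 1)) + u (gridPoint m ℓ (a + 1) (b + 1))) ^ 2 *
      (κ (gridPoint m ℓ (a + 1) b) ^ 2 +
        κ (gridPoint m ℓ (a + 1) b) * κ (gridPoint m ℓ (a + 1) (b + 1)) +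
        κ (gridPoint m ℓ (a + 1) (b + 1)) ^ 2)) := by
  have hN := cells_pos hm ℓ
  have hn := unitNormal_edge hm ℓ 1 (a + 1) b
  have hd := dist_edge hm ℓ 1 (a + 1) b
  have hbd := onBoundary_edge hm ℓ 1 (a + 1) b
  simp only [edgeOffset, edgeLength, Matrix.cons_val_one, Matrix.cons_val_zero, add_zero, inv_one,
    one_smul, Nat.cast_zero, Nat.cast_one] at hn hd hbd
  have h := hκ.edgeJumpSq_eq hm hu (a := a) (b := b) (q := 0) (i := 1) (j := 2) (k := 0)
    (a' := a + 1) (b' := b) (q' := 1) (i' := 0) (j' := 2) (k' := 1) rfl rfl rfl rfl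
    (by decide) (by decide)
    (by rw [show vtx m ℓ a b 0 1 = gridPoint m ℓ (a + 1) b from rfl,
          show vtx m ℓ a b 0 2 = gridPoint m ℓ (a + 1) (b + 1) from rfl, hn]
        simp [baryDir, PiLp.inner_apply, Fin.sum_univ_two])
    (by rw [show vtx m ℓ a b 0 1 = gridPoint m ℓ (a + 1) b from rfl,
          show vtx m ℓ a b 0 2 = gridPoint m ℓ (a + 1) (b + 1) from rfl, hn]
        simp [baryDir])
  rw [show vtx m ℓ a b 0 1 = gridPoint m ℓ (a + 1) b from rfl,
    show vtx m ℓ a b 0 2 = gridPoint m ℓ (a + 1) (b + 1) from rfl] at h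
  refine ⟨h.1, (h.2 ?_).trans ?_⟩
  · rw [hbd]; simp; exact ha
  · rw [hd, hn, p1Grad_lower, p1Grad_upper, edgeFactor]
    simp [PiLp.inner_apply, Fin.sum_univ_two, edgeLength]
    field_simp
    ring

/-- The squared jump over a diagonal edge, between the two triangles of a cell. -/
theorem IsP1.edgeSq_diagonal {ℓ : ℕ} {κ u : Plane → ℝ} (hκ : IsP1 m ℓ κ) (hu : IsP1 m ℓ u)
    (a b : ℕ) :
    JumpIntegrable κ u (gridPoint m ℓ a b) (gridPoint m ℓ (a + 1) (b + 1)) ∧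
    edgeSq m ℓ κ u 2 a b = edgeFactor m ℓ 2 *
      ((2 * (u (gridPoint m ℓ a b) - u (gridPoint m ℓ (a + 1) b) -
        u (gridPoint m ℓ a (b + 1)) + u (gridPoint m ℓ (a + 1) (b + 1)))) ^ 2 *
      (κ (gridPoint m ℓ a b) ^ 2 +
        κ (gridPoint m ℓ a b) * κ (gridPoint m ℓ (a + 1) (b + 1)) +
        κ (gridPoint m ℓ (a + 1) (b + 1)) ^ 2)) := by
  have hN := cells_pos hm ℓ
  have hn := unitNormal_edge hm ℓ 2 a b
  have hd := dist_edge hm ℓ 2 a b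
  have hbd := onBoundary_edge hm ℓ 2 a b
  simp only [edgeOffset, edgeLength, Matrix.cons_val, Nat.cast_one] at hn hd hbd
  have h := hκ.edgeJumpSq_eq hm hu (a := a) (b := b) (q := 1) (i := 0) (j := 1) (k := 2)
    (a' := a) (b' := b) (q' := 0) (i' := 0) (j' := 2) (k' := 1) rfl rfl rfl rfl
    (by decide) (by decide)
    (by rw [show vtx m ℓ a b 1 0 = gridPoint m ℓ a b from rfl,
          show vtx m ℓ a b 1 1 = gridPoint m ℓ (a + 1) (b + 1) from rfl, hn, inner_smul_right]
        refine mul_neg_of_pos_of_neg (by positivity) ?_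
        simp [baryDir, PiLp.inner_apply, Fin.sum_univ_two])
    (by rw [show vtx m ℓ a b 1 0 = gridPoint m ℓ a b from rfl,
          show vtx m ℓ a b 1 1 = gridPoint m ℓ (a + 1) (b + 1) from rfl, hn, inner_smul_right]
        refine mul_pos (by positivity) ?_
        simp [baryDir])
  rw [show vtx m ℓ a b 1 0 = gridPoint m ℓ a b from rfl,
    show vtx m ℓ a b 1 1 = gridPoint m ℓ (a + 1) (b + 1) from rfl] at h
  refine ⟨h.1, (h.2 ?_).trans ?_⟩
  · rw [hbd]; simp
  · rw [hd, hn, p1Grad_lower, p1Grad_upper, edgeFactor, inner_smul_right]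
    simp [PiLp.inner_apply, Fin.sum_univ_two, edgeLength]
    field_simp
    ring

omit hm in
/-- The squared jump over every edge of the level is integrable, up to boundary edges, for which
nothing is required. -/
def EdgeRegular (m ℓ : ℕ) (κ u : Plane → ℝ) : Prop :=
  ∀ (t : Fin 3) (a b : ℕ),
    OnBoundary (gridPoint m ℓ a b)
      (gridPoint m ℓ (a + (edgeOffset t).1) (b + (edgeOffset t).2)) ∨
    JumpIntegrable κ u (gridPoint m ℓ a b)
      (gridPoint m ℓ (a + (edgeOffset t).1) (b + (edgeOffset t).2))

theorem IsP1.edgeRegular {ℓ : ℕ} {κ u : Plane → ℝ} (hκ : IsP1 m ℓ κ) (hu : IsP1 m ℓ u) :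
    EdgeRegular m ℓ κ u := by
  intro t a b
  rw [onBoundary_edge hm]
  fin_cases t
  · by_cases h : b = 0 ∨ b = cells m ℓ
    · exact Or.inl (Or.inl ⟨rfl, h⟩)
    · obtain ⟨c, rfl⟩ := Nat.exists_eq_succ_of_ne_zero fun h0 => h (Or.inl h0)
      exact Or.inr (hκ.edgeSq_horizontal hm hu a c fun h1 => h (Or.inr h1)).1
  · by_cases h : a = 0 ∨ a = cells m ℓ
    · exact Or.inl (Or.inr ⟨rfl, h⟩)
    · obtain ⟨c, rfl⟩ := Nat.exists_eq_succ_of_ne_zero fun h0 => h (Or.inl h0)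
      exact Or.inr (hκ.edgeSq_vertical hm hu c b fun h1 => h (Or.inr h1)).1
  · exact Or.inr (hκ.edgeSq_diagonal hm hu a b).1

theorem edgeSq_eq_zero (ℓ : ℕ) (κ u : Plane → ℝ) {t : Fin 3} {a b : ℕ}
    (h : (t = 0 ∧ (b = 0 ∨ b = cells m ℓ)) ∨ (t = 1 ∧ (a = 0 ∨ a = cells m ℓ))) :
    edgeSq m ℓ κ u t a b = 0 := if_pos ((onBoundary_edge hm ℓ t a b).2 h)

theorem diam_tri (ℓ : ℕ) (q : Fin 2) (i : Node m ℓ) :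
    Metric.diam (tri m ℓ q i) = √2 / cells m ℓ := by
  have hN := cells_pos hm ℓ
  have h12 : (1 : ℝ) ≤ √2 := Real.one_le_sqrt.2 one_le_two
  have hr : Set.range (triVertex m ℓ q i) =
      {triVertex m ℓ q i 0, triVertex m ℓ q i 1, triVertex m ℓ q i 2} := by
    ext x
    simp only [Set.mem_range, Fin.exists_fin_succ, Set.mem_insert_iff, Set.mem_singleton_iff]
    simp [eq_comm]
  rw [tri, convexHull_diam, hr, Metric.diam_triple]
  simp only [triVertex, dist_gridPoint hm]
  have h1 : (1 : ℝ) / cells m ℓ ≤ √2 / cells m ℓ := div_le_div_of_nonneg_right h12 hN.le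
  generalize (cells m ℓ : ℝ) = N at *
  fin_cases q
  · simp only [vertexOffset, Fin.zero_eta, Matrix.cons_val]
    norm_num at h1 ⊢
    exact h1
  · simp only [vertexOffset, Fin.mk_one, Matrix.cons_val]
    norm_num at h1 ⊢
    exact h1

/-- The jump term of a lower triangle: its edges are the bottom and the right side and the diagonal
of the cell. -/
theorem jumpSq_lower (ℓ : ℕ) (κ u : Plane → ℝ) (i : Node m ℓ) :
    jumpSq m ℓ κ u 0 i = √2 / cells m ℓ * edgeSq m ℓ κ u 0 i.1 i.2 +
      √2 / cells m ℓ * edgeSq m ℓ κ u 1 (i.1 + 1) i.2 +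
      √2 / cells m ℓ * edgeSq m ℓ κ u 2 i.1 i.2 := by
  have e : edgeJumpSq κ u (triVertex m ℓ 0 i 2) (triVertex m ℓ 0 i 0) =
      edgeSq m ℓ κ u 2 i.1 i.2 := by rw [edgeJumpSq_comm]; rfl
  rw [jumpSq, diam_tri hm, Fin.sum_univ_three, show (2 : Fin 3) + 1 = 0 from rfl, e, mul_add,
    mul_add]
  rfl

/-- The jump term of an upper triangle: its edges are the diagonal and the top and the left side of
the cell. -/
theorem jumpSq_upper (ℓ : ℕ) (κ u : Plane → ℝ) (i : Node m ℓ) :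
    jumpSq m ℓ κ u 1 i = √2 / cells m ℓ * edgeSq m ℓ κ u 2 i.1 i.2 +
      √2 / cells m ℓ * edgeSq m ℓ κ u 0 i.1 (i.2 + 1) +
      √2 / cells m ℓ * edgeSq m ℓ κ u 1 i.1 i.2 := by
  have e : edgeJumpSq κ u (triVertex m ℓ 1 i 2) (triVertex m ℓ 1 i 0) =
      edgeSq m ℓ κ u 1 i.1 i.2 := by rw [edgeJumpSq_comm]; rfl
  have e' : edgeJumpSq κ u (triVertex m ℓ 1 i 1) (triVertex m ℓ 1 i 2) =
      edgeSq m ℓ κ u 0 i.1 (i.2 + 1) := by rw [edgeJumpSq_comm]; rfl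
  rw [jumpSq, diam_tri hm, Fin.sum_univ_three, show (2 : Fin 3) + 1 = 0 from rfl,
    show (1 : Fin 3) + 1 = 2 from rfl, e, e', mul_add, mul_add]
  rfl

/-! ### Aggregation over refined triangles and edges -/

omit hm in
/-- The squared jump over an edge is the sum of those over its two halves. -/
theorem edgeJumpSq_bisect {κ u : Plane → ℝ} {p c r : Plane}
    (hc : c = AffineMap.lineMap p r (1 / 2 : ℝ))
    (h₁ : OnBoundary p c ∨ JumpIntegrable κ u p c)
    (h₂ : OnBoundary c r ∨ JumpIntegrable κ u c r) :
    (OnBoundary p r ∨ JumpIntegrable κ u p r) ∧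
      edgeJumpSq κ u p r = edgeJumpSq κ u p c + edgeJumpSq κ u c r := by
  have hcj : ∀ j, c j = (p j + r j) / 2 := fun j => by
    rw [hc, AffineMap.lineMap_apply_module]
    simp only [PiLp.add_apply, PiLp.smul_apply, smul_eq_mul]
    ring
  -- an edge is on the boundary iff each of its halves is
  have b1 : OnBoundary p c ↔ OnBoundary p r := by
    refine exists_congr fun j => ?_
    rw [hcj]
    constructor <;> rintro (⟨h, h'⟩ | ⟨h, h'⟩)
    · left; constructor <;> linarith
    · right; constructor <;> linarith
    · left; constructor <;> linarith
    · right; constructor <;> linarith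
  have b2 : OnBoundary c r ↔ OnBoundary p r := by
    refine exists_congr fun j => ?_
    rw [hcj]
    constructor <;> rintro (⟨h, h'⟩ | ⟨h, h'⟩)
    · left; constructor <;> linarith
    · right; constructor <;> linarith
    · left; constructor <;> linarith
    · right; constructor <;> linarith
  by_cases hb : OnBoundary p r
  · refine ⟨Or.inl hb, ?_⟩
    rw [edgeJumpSq, edgeJumpSq, edgeJumpSq, if_pos hb, if_pos (b1.2 hb), if_pos (b2.2 hb),
      add_zero]
  replace h₁ := h₁.resolve_left (mt b1.1 hb)
  replace h₂ := h₂.resolve_left (mt b2.1 hb)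
  have d1 : dist p c = dist p r / 2 := by
    rw [hc, dist_left_lineMap]; norm_num; ring
  have d2 : dist c r = dist p r / 2 := by
    rw [hc, dist_lineMap_right]; norm_num; ring
  have n1 : unitNormal p c = unitNormal p r := by
    rw [unitNormal, unitNormal, d1]
    ext j
    fin_cases j <;> simp [hcj] <;> ring
  have n2 : unitNormal c r = unitNormal p r := by
    rw [unitNormal, unitNormal, d2]
    ext j
    fin_cases j <;> simp [hcj] <;> ring
  have l1 : ∀ t : ℝ, AffineMap.lineMap p c t = AffineMap.lineMap p r (t / 2) := fun t => by
    ext j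
    simp only [AffineMap.lineMap_apply_module, PiLp.add_apply, PiLp.smul_apply, smul_eq_mul, hcj]
    ring
  have l2 : ∀ t : ℝ, AffineMap.lineMap c r t = AffineMap.lineMap p r (t / 2 + 1 / 2) := fun t => by
    ext j
    simp only [AffineMap.lineMap_apply_module, PiLp.add_apply, PiLp.smul_apply, smul_eq_mul, hcj]
    ring
  set F : ℝ → ℝ := fun t => (jump κ u (unitNormal p r) (AffineMap.lineMap p r t)) ^ 2 with hF
  have i1 : IntervalIntegrable F volume 0 (1 / 2) := by
    have h := h₁
    rw [JumpIntegrable, n1] at h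
    simp only [l1] at h
    have := h.comp_mul_left (c := 2)
    simpa using this
  have i2 : IntervalIntegrable F volume (1 / 2) 1 := by
    have h := h₂
    rw [JumpIntegrable, n2] at h
    simp only [l2] at h
    have := (h.comp_mul_left (c := 2)).comp_sub_right (1 / 2)
    norm_num at this
    refine this.congr ?_
    intro t _
    simp only [hF]
  refine ⟨Or.inr (i1.trans i2), ?_⟩
  rw [edgeJumpSq, edgeJumpSq, edgeJumpSq, if_neg hb, if_neg (mt b1.1 hb), if_neg (mt b2.1 hb),
    n1, n2, d1, d2]
  have hF' : ∀ t, (jump κ u (unitNormal p r) (AffineMap.lineMap p r t)) ^ 2 = F t := fun _ => rfl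
  simp only [l1, l2, hF']
  rw [intervalIntegral.integral_comp_div F two_ne_zero,
    intervalIntegral.integral_comp_div_add F two_ne_zero,
    ← intervalIntegral.integral_add_adjacent_intervals i1 i2]
  norm_num
  ring

theorem gridPoint_succ (ℓ a b : ℕ) : gridPoint m (ℓ + 1) (2 * a) (2 * b) = gridPoint m ℓ a b := by
  have hN := cells_pos hm ℓ
  ext j
  fin_cases j
  · change gridPoint m (ℓ + 1) (2 * a) (2 * b) 0 = gridPoint m ℓ a b 0
    rw [gridPoint_zero, gridPoint_zero, cells_succ]
    push_cast
    rw [mul_div_mul_left _ _ two_ne_zero]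
  · change gridPoint m (ℓ + 1) (2 * a) (2 * b) 1 = gridPoint m ℓ a b 1
    rw [gridPoint_one, gridPoint_one, cells_succ]
    push_cast
    rw [mul_div_mul_left _ _ two_ne_zero]

theorem gridPoint_midpoint (ℓ a b c d : ℕ) : gridPoint m (ℓ + 1) (2 * a + c) (2 * b + d) =
    AffineMap.lineMap (gridPoint m ℓ a b) (gridPoint m ℓ (a + c) (b + d)) (1 / 2 : ℝ) := by
  have hN := cells_pos hm ℓ
  have hs : (cells m (ℓ + 1) : ℝ) = 2 * cells m ℓ := by rw [cells_succ]; push_cast; rfl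
  rw [AffineMap.lineMap_apply_module]
  ext j
  fin_cases j
  · change gridPoint m (ℓ + 1) (2 * a + c) (2 * b + d) 0 =
      (1 - 1 / 2 : ℝ) * gridPoint m ℓ a b 0 + (1 / 2 : ℝ) * gridPoint m ℓ (a + c) (b + d) 0
    simp only [gridPoint_zero, hs, Nat.cast_add, Nat.cast_mul, Nat.cast_ofNat]
    field_simp; ring
  · change gridPoint m (ℓ + 1) (2 * a + c) (2 * b + d) 1 =
      (1 - 1 / 2 : ℝ) * gridPoint m ℓ a b 1 + (1 / 2 : ℝ) * gridPoint m ℓ (a + c) (b + d) 1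
    simp only [gridPoint_one, hs, Nat.cast_add, Nat.cast_mul, Nat.cast_ofNat]
    field_simp; ring

/-- The edges of a level are halved by the refinement. -/
theorem EdgeRegular.bisect {ℓ : ℕ} {κ u : Plane → ℝ} (h : EdgeRegular m (ℓ + 1) κ u) :
    EdgeRegular m ℓ κ u ∧ ∀ t a b, edgeSq m ℓ κ u t a b =
      edgeSq m (ℓ + 1) κ u t (2 * a) (2 * b) +
      edgeSq m (ℓ + 1) κ u t (2 * a + (edgeOffset t).1) (2 * b + (edgeOffset t).2) := by
  have double : ∀ t a b, gridPoint m (ℓ + 1) (2 * a + (edgeOffset t).1 + (edgeOffset t).1)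
      (2 * b + (edgeOffset t).2 + (edgeOffset t).2) =
      gridPoint m ℓ (a + (edgeOffset t).1) (b + (edgeOffset t).2) := fun t a b => by
    rw [add_assoc, add_assoc, ← two_mul, ← two_mul, ← mul_add, ← mul_add, gridPoint_succ hm]
  have key : ∀ t a b, _ := fun t a b =>
    edgeJumpSq_bisect (gridPoint_midpoint hm ℓ a b (edgeOffset t).1 (edgeOffset t).2)
      (gridPoint_succ hm ℓ a b ▸ h t (2 * a) (2 * b))
      (double t a b ▸ h t (2 * a + (edgeOffset t).1) (2 * b + (edgeOffset t).2))
  refine ⟨fun t a b => (key t a b).1, fun t a b => ?_⟩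
  rw [edgeSq, edgeSq, edgeSq, (key t a b).2, gridPoint_succ hm, double]

end Mesh

/-- Cells of the four triangles into which a triangle is refined, relative to the cell of the finer
level that contains the lower left node. -/
def childOffset : Fin 2 → Fin 4 → ℕ × ℕ :=
  ![![(0, 0), (1, 0), (1, 0), (1, 1)], ![(0, 0), (0, 1), (0, 1), (1, 1)]]

/-- Types of the four triangles into which a triangle is refined. -/
def childType : Fin 2 → Fin 4 → Fin 2 := ![![0, 0, 1, 0], ![1, 1, 0, 1]]

/-- One of the four triangles into which a triangle is refined. -/
def childTri (m ℓ a b : ℕ) (q : Fin 2) (c : Fin 4) : Set Plane :=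
  closedTri m (ℓ + 1) (2 * a + (childOffset q c).1) (2 * b + (childOffset q c).2) (childType q c)

theorem mem_closedTri_zero (m ℓ a b : ℕ) (x : Plane) : x ∈ closedTri m ℓ a b 0 ↔
    0 ≤ cells m ℓ * x 1 - b ∧ cells m ℓ * x 1 - b ≤ cells m ℓ * x 0 - a ∧
      cells m ℓ * x 0 - a ≤ 1 := by
  change (∀ e, 0 ≤ bary m ℓ a b 0 e x) ↔ _
  rw [Fin.forall_fin_succ, Fin.forall_fin_two]
  change 0 ≤ 1 - (cells m ℓ * x 0 - a) ∧
    0 ≤ (cells m ℓ * x 0 - a) - (cells m ℓ * x 1 - b) ∧ 0 ≤ cells m ℓ * x 1 - b ↔ _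
  rw [sub_nonneg, sub_nonneg (b := (cells m ℓ * x 1 - b : ℝ))]
  tauto

theorem mem_closedTri_one (m ℓ a b : ℕ) (x : Plane) : x ∈ closedTri m ℓ a b 1 ↔
    0 ≤ cells m ℓ * x 0 - a ∧ cells m ℓ * x 0 - a ≤ cells m ℓ * x 1 - b ∧
      cells m ℓ * x 1 - b ≤ 1 := by
  change (∀ e, 0 ≤ bary m ℓ a b 1 e x) ↔ _
  rw [Fin.forall_fin_succ, Fin.forall_fin_two]
  change 0 ≤ 1 - (cells m ℓ * x 1 - b) ∧
    0 ≤ cells m ℓ * x 0 - a ∧ 0 ≤ (cells m ℓ * x 1 - b) - (cells m ℓ * x 0 - a) ↔ _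
  rw [sub_nonneg, sub_nonneg (b := (cells m ℓ * x 0 - a : ℝ))]
  tauto

theorem iUnion_childTri (m ℓ a b : ℕ) (q : Fin 2) :
    ⋃ c, childTri m ℓ a b q c = closedTri m ℓ a b q := by
  ext x
  have h0 := cells_mul_succ (m := m) ℓ (x 0)
  have h1 := cells_mul_succ (m := m) ℓ (x 1)
  have exists_four : ∀ P : Fin 4 → Prop, (∃ c, P c) ↔ P 0 ∨ P 1 ∨ P 2 ∨ P 3 := fun P => by
    constructor
    · rintro ⟨c, h⟩
      fin_cases c
      exacts [.inl h, .inr (.inl h), .inr (.inr (.inl h)), .inr (.inr (.inr h))]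
    · rintro (h | h | h | h)
      exacts [⟨_, h⟩, ⟨_, h⟩, ⟨_, h⟩, ⟨_, h⟩]
  rw [Set.mem_iUnion, exists_four]
  fin_cases q
  · simp only [childTri, childOffset, childType, Fin.zero_eta, Matrix.cons_val, add_zero,
      mem_closedTri_zero, mem_closedTri_one, h0, h1]
    generalize (cells m ℓ : ℝ) * x 0 = X
    generalize (cells m ℓ : ℝ) * x 1 = Y
    push_cast
    constructor
    · rintro (⟨h, h', h''⟩ | ⟨h, h', h''⟩ | ⟨h, h', h''⟩ | ⟨h, h', h''⟩) <;>
        refine ⟨?_, ?_, ?_⟩ <;> linarith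
    · rintro ⟨h, h', h''⟩
      by_cases c1 : 2 * X - 2 * a ≤ 1
      · left; refine ⟨?_, ?_, ?_⟩ <;> linarith
      by_cases c2 : 1 ≤ 2 * Y - 2 * b
      · right; right; right; refine ⟨?_, ?_, ?_⟩ <;> linarith
      by_cases c3 : 2 * Y - 2 * b ≤ 2 * X - 2 * a - 1
      · right; left; refine ⟨?_, ?_, ?_⟩ <;> linarith
      · right; right; left; refine ⟨?_, ?_, ?_⟩ <;> linarith
  · simp only [childTri, childOffset, childType, Fin.mk_one, Matrix.cons_val, add_zero,
      mem_closedTri_zero, mem_closedTri_one, h0, h1]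
    generalize (cells m ℓ : ℝ) * x 0 = X
    generalize (cells m ℓ : ℝ) * x 1 = Y
    push_cast
    constructor
    · rintro (⟨h, h', h''⟩ | ⟨h, h', h''⟩ | ⟨h, h', h''⟩ | ⟨h, h', h''⟩) <;>
        refine ⟨?_, ?_, ?_⟩ <;> linarith
    · rintro ⟨h, h', h''⟩
      by_cases c1 : 2 * Y - 2 * b ≤ 1
      · left; refine ⟨?_, ?_, ?_⟩ <;> linarith
      by_cases c2 : 1 ≤ 2 * X - 2 * a
      · right; right; right; refine ⟨?_, ?_, ?_⟩ <;> linarith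
      by_cases c3 : 2 * X - 2 * a ≤ 2 * Y - 2 * b - 1
      · right; left; refine ⟨?_, ?_, ?_⟩ <;> linarith
      · right; right; left; refine ⟨?_, ?_, ?_⟩ <;> linarith

/-- Different triangles of the same refinement meet in a line at most. -/
theorem aedisjoint_childTri {m : ℕ} (hm : 0 < m) (ℓ a b : ℕ) (q : Fin 2) :
    Pairwise (Function.onFun (AEDisjoint volume) (childTri m ℓ a b q)) := by
  -- a closed child does not meet an open one
  have sep : ∀ c c', c < c' → ∀ x ∈ childTri m ℓ a b q c', x ∉ openTri m (ℓ + 1)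
      (2 * a + (childOffset q c).1) (2 * b + (childOffset q c).2) (childType q c) := by
    intro c c' hcc x hx hx'
    have h0 := hx' 0
    have h1 := hx' 1
    have h2 := hx' 2
    unfold childTri at hx
    fin_cases q <;> fin_cases c <;> fin_cases c' <;> try exact absurd hcc (by decide)
    all_goals
      simp only [childOffset, childType, Fin.zero_eta, Fin.mk_one, Fin.reduceFinMk, Fin.isValue,
        Matrix.cons_val, mem_closedTri_zero, mem_closedTri_one, bary, add_zero, Nat.cast_add,
        Nat.cast_one] at hx h0 h1 h2
      obtain ⟨g0, g1, g2⟩ := hx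
      linarith
  have dis : ∀ c c', c < c' → AEDisjoint volume (childTri m ℓ a b q c) (childTri m ℓ a b q c') := by
    intro c c' hcc
    have := ae_mem_openTri hm (ℓ + 1) (2 * a + (childOffset q c).1) (2 * b + (childOffset q c).2)
      (childType q c)
    rw [ae_restrict_iff' (isClosed_closedTri _ _ _ _ _).measurableSet] at this
    rw [AEDisjoint, ← compl_mem_ae_iff]
    filter_upwards [this] with x hx hxx
    exact sep c c' hcc x hxx.2 (hx hxx.1)
  intro c c' hcc
  rcases lt_or_gt_of_ne hcc with h | h
  · exact dis c c' h
  · exact (dis c' c h).symm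

/-- The element residual of a triangle is obtained from those of its four children; the factor comes
from the halved diameter. -/
theorem residualSq_bisect {m : ℕ} (hm : 0 < m) {ℓ : ℕ} {κ f u : Plane → ℝ} (q : Fin 2)
    (i : Node m ℓ) (j : Fin 4 → Node m (ℓ + 1))
    (hj : ∀ c, ((j c).1 : ℕ) = 2 * i.1 + (childOffset q c).1 ∧
      ((j c).2 : ℕ) = 2 * i.2 + (childOffset q c).2)
    (h : ∀ c, IntegrableOn (fun x => (f x + divergence (fun z => κ z • gradient u z) x) ^ 2)
      (tri m (ℓ + 1) (childType q c) (j c))) :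
    IntegrableOn (fun x => (f x + divergence (fun z => κ z • gradient u z) x) ^ 2) (tri m ℓ q i) ∧
    residualSq m ℓ κ f u q i =
      4 * ∑ c, residualSq m (ℓ + 1) κ f u (childType q c) (j c) := by
  have hN := cells_pos hm ℓ
  have e : ∀ c, tri m (ℓ + 1) (childType q c) (j c) = childTri m ℓ i.1 i.2 q c := fun c => by
    rw [tri_eq_closedTri hm, (hj c).1, (hj c).2]; rfl
  have e' : tri m ℓ q i = ⋃ c, tri m (ℓ + 1) (childType q c) (j c) := by
    simp only [e, iUnion_childTri, tri_eq_closedTri hm]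
  have hi : IntegrableOn (fun x => (f x + divergence (fun z => κ z • gradient u z) x) ^ 2)
      (tri m ℓ q i) := by
    rw [e']
    exact integrableOn_finite_iUnion.2 h
  refine ⟨hi, ?_⟩
  have hd : Metric.diam (tri m ℓ q i) = 2 * (√2 / cells m (ℓ + 1)) := by
    have hs : (cells m (ℓ + 1) : ℝ) = 2 * cells m ℓ := by simpa using cells_mul_succ (m := m) ℓ 1
    rw [diam_tri hm, hs]
    field_simp
  simp only [residualSq, hd, diam_tri hm, ← Finset.mul_sum]
  conv_lhs => rw [e']
  rw [integral_iUnion_ae, tsum_fintype]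
  · ring
  · intro c
    rw [e]
    exact (isClosed_closedTri _ _ _ _ _).measurableSet.nullMeasurableSet
  · simp only [e]
    exact aedisjoint_childTri hm ℓ i.1 i.2 q
  · rwa [← e']

/-! ### The prolongation network -/

open Classical in
/-- The kernel entries of a stencil that is given by finitely many terms: the coefficient `r i`, the
channel `(s i).1` and the position `(s i).2` for every `i`. -/
def termWeight {ι α : Type} [Fintype ι] (r : ι → ℝ) (s : ι → α × Offset) (a : α) (d : Offset) : ℝ :=
  ∑ i, if s i = (a, d) then r i else 0

theorem sum_termWeight {ι α : Type} [Fintype ι] [Fintype α] (r : ι → ℝ) (s : ι → α × Offset)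
    (S : α → Offset → ℝ) :
    ∑ a, ∑ d, termWeight r s a d * S a d = ∑ i, r i * S (s i).1 (s i).2 := by
  rw [← Fintype.sum_prod_type' (f := fun a d => termWeight r s a d * S a d)]
  simp only [termWeight, Finset.sum_mul]
  rw [Finset.sum_comm]
  refine Finset.sum_congr rfl fun i _ => ?_
  rw [Finset.sum_eq_single (s i)]
  · simp
  · intro b _ hb
    rw [if_neg hb.symm, zero_mul]
  · simp

theorem sum_ite_val_eq_le (L k C : ℕ) : ∑ ℓ : Fin L, (if (ℓ : ℕ) = k then C else 0) ≤ C := by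
  rw [Fin.sum_univ_eq_sum_range (fun i => if i = k then C else 0), Finset.sum_ite_eq']
  split_ifs <;> simp

/-- The layer that adds to the first channel of level `k + 1` the prolongation of the first channel
of level `k`. -/
def prolongLayer (L k : ℕ) (ℓ : Fin L) : LevelOp (fun _ : Fin L => 3) ℓ 3 :=
  if h : (ℓ : ℕ) = k + 1 then
    .fromCoarser false ⟨k, by omega⟩ h 1 1
      (fun o => termWeight (fun _ : Unit => 1) fun _ => (o, (1, 1)))
      (fun o c d => if o = 0 ∧ c = 0 then prolongWeight d else 0) 0
  else .keep

/-- The network that prolongates the first channel from level `0` to level `k`. -/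
def prolong (L : ℕ) : ℕ → CNN (fun _ : Fin L => 3) (fun _ => 3)
  | 0 => .nil _
  | k + 1 => (prolong L k).append (.single (prolongLayer L k))

theorem params_prolong_le (L k : ℕ) : (prolong L k).params ≤ 165 * k := by
  induction k with
  | zero => simp [prolong, CNN.params]
  | succ k ih =>
    rw [prolong, CNN.params_append, CNN.params_single, mul_add]
    refine add_le_add ih ?_
    refine le_trans (le_of_eq ?_) (sum_ite_val_eq_le L (k + 1) 165)
    refine Finset.sum_congr rfl fun ℓ _ => ?_
    unfold prolongLayer
    split_ifs
    · simp [LevelOp.params]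
    · rfl

/-- The contribution of the levels up to `k` to a function with multilevel coefficients. -/
def partialFun (m L : ℕ) (u : ∀ ℓ : Fin L, Image m ℓ) (k : ℕ) (x : Plane) : ℝ :=
  ∑ ℓ : Fin L, if (ℓ : ℕ) ≤ k then feFun m ℓ (u ℓ) x else 0

section Prolong

variable {m L : ℕ} (u : ∀ ℓ : Fin L, Image m ℓ)

theorem isP1_zero (ℓ : ℕ) : IsP1 m ℓ fun _ => 0 :=
  ⟨fun _ _ _ _ _ _ _ _ _ _ => by simp, fun _ _ _ _ _ _ _ _ _ _ => by simp⟩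

theorem isP1_partialFun (hm : 0 < m) (k : ℕ) : IsP1 m k (partialFun m L u k) := by
  refine isP1_sum Finset.univ (fun (ℓ : Fin L) x => if (ℓ : ℕ) ≤ k then feFun m ℓ (u ℓ) x else 0)
    fun ℓ _ => ?_
  by_cases h : (ℓ : ℕ) ≤ k
  · simpa only [if_pos h] using (isP1_feFun hm (u ℓ)).mono hm h
  · simpa only [if_neg h] using isP1_zero k

theorem partialFun_zero (h : 0 < L) (x : Plane) :
    partialFun m L u 0 x = feFun m 0 (u ⟨0, h⟩) x := by
  rw [partialFun, Finset.sum_eq_single ⟨0, h⟩]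
  · simp
  · intro ℓ _ hℓ
    rw [if_neg]
    exact fun h0 => hℓ (Fin.ext (by simpa using h0))
  · simp

theorem partialFun_succ (k : ℕ) (h : k + 1 < L) (x : Plane) :
    partialFun m L u (k + 1) x = partialFun m L u k x + feFun m (k + 1) (u ⟨k + 1, h⟩) x := by
  have e : feFun m (k + 1) (u ⟨k + 1, h⟩) x =
      ∑ ℓ : Fin L, if (ℓ : ℕ) = k + 1 then feFun m ℓ (u ℓ) x else 0 := by
    rw [Finset.sum_eq_single ⟨k + 1, h⟩]
    · simp
    · intro ℓ _ hℓ
      rw [if_neg]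
      exact fun h0 => hℓ (Fin.ext h0)
    · simp
  rw [e, partialFun, partialFun, ← Finset.sum_add_distrib]
  refine Finset.sum_congr rfl fun ℓ _ => ?_
  split_ifs <;> first | omega | simp

theorem partialFun_last (x : Plane) : partialFun m L u (L - 1) x = multilevelFun m L u x :=
  Finset.sum_congr rfl fun ℓ _ => if_pos (by omega)

/-- After the steps up to level `k`, the first channel of every level up to `k` holds the nodal
values of the contributions of all levels that are not finer. -/
theorem eval_prolong (hm : 0 < m) (σ : ℝ → ℝ) (x : State m (fun _ : Fin L => 3))
    (hx : ∀ ℓ, x ℓ 0 = u ℓ) (k : ℕ) (ℓ : Fin L) :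
    (prolong L k).eval σ m x ℓ = if (ℓ : ℕ) ≤ k then
      ![nodalImage m ℓ (partialFun m L u ℓ), x ℓ 1, x ℓ 2] else x ℓ := by
  induction k generalizing ℓ with
  | zero =>
    change x ℓ = _
    split_ifs with h
    · obtain ⟨ℓ, hℓ⟩ := ℓ
      obtain rfl : ℓ = 0 := by simpa using h
      have : nodalImage m 0 (partialFun m L u 0) = x ⟨0, hℓ⟩ 0 := by
        funext i
        rw [nodalImage, partialFun_zero u hℓ, feFun_gridPoint hm, hx]
      funext c
      fin_cases c
      · exact this.symm
      · rfl
      · rfl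
    · rfl
  | succ k ih =>
    rw [prolong, CNN.eval_append, CNN.eval_single]
    by_cases h : (ℓ : ℕ) = k + 1
    · obtain ⟨ℓ, hℓ⟩ := ℓ
      simp only at h
      subst h
      have e : prolongLayer L k ⟨k + 1, hℓ⟩ = .fromCoarser false ⟨k, by omega⟩ rfl 1 1
          (fun o => termWeight (fun _ : Unit => 1) fun _ => (o, (1, 1)))
          (fun o c d => if o = 0 ∧ c = 0 then prolongWeight d else 0) 0 := dif_pos rfl
      rw [e, LevelOp.eval, if_pos le_rfl]
      have h1 : (prolong L k).eval σ m x ⟨k + 1, hℓ⟩ = x ⟨k + 1, hℓ⟩ := by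
        rw [ih, if_neg (by simp)]
      have h2 : (prolong L k).eval σ m x ⟨k, by omega⟩ 0 =
          nodalImage m k (partialFun m L u k) := by
        rw [ih, if_pos le_rfl]; rfl
      rw [h1]
      have h3 : ∀ (o : Fin 3) (p : Node m (k + 1)), conv (r := 1)
          (fun o => termWeight (fun _ : Unit => (1 : ℝ)) fun _ => (o, (1, 1)))
          (x ⟨k + 1, hℓ⟩) o p = x ⟨k + 1, hℓ⟩ o p := fun o p => by
        rw [conv_eq_sum_shift, sum_termWeight (S := fun a d => shift d (x ⟨k + 1, hℓ⟩ a) p)]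
        simp [shift_center]
      have h4 : ∀ (o : Fin 3) (p : Node m (k + 1)), convTranspose (r := 1)
          (fun (o c : Fin 3) d => if o = 0 ∧ c = 0 then prolongWeight d else 0)
          ((prolong L k).eval σ m x ⟨k, by omega⟩) o p =
          if o = 0 then nodalImage m (k + 1) (partialFun m L u k) p else 0 := fun o p => by
        rw [convTranspose, Finset.sum_eq_single 0]
        · by_cases ho : o = 0
          · rw [if_pos ho, ← (isP1_partialFun u hm k).sum_prolongWeight hm p, ← h2]
            simp [ho]
          · simp [ho]
        · intro c _ hc
          simp [hc]
        · simp
      funext o p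
      rw [h3, h4, activate, if_neg (by simp)]
      fin_cases o
      · change x ⟨k + 1, hℓ⟩ 0 p + nodalImage m (k + 1) (partialFun m L u k) p + 0 =
          nodalImage m (k + 1) (partialFun m L u (k + 1)) p
        rw [hx, nodalImage, nodalImage, partialFun_succ u k hℓ, feFun_gridPoint hm]
        ring
      · change x ⟨k + 1, hℓ⟩ 1 p + 0 + 0 = x ⟨k + 1, hℓ⟩ 1 p
        ring
      · change x ⟨k + 1, hℓ⟩ 2 p + 0 + 0 = x ⟨k + 1, hℓ⟩ 2 p
        ring
    · have e : prolongLayer L k ℓ = .keep := dif_neg h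
      rw [e, LevelOp.eval, ih]
      congr 1
      exact propext ⟨fun h' => by omega, fun h' => by omega⟩

end Prolong

/-! ### The local estimators as stencil polynomials -/

theorem featSpan_mono {ci n d d' : ℕ} (h : d ≤ d') : featSpan ci n d ≤ featSpan ci n d' := by
  induction d', h using Nat.le_induction with
  | base => exact le_rfl
  | succ k _ ih => exact ih.trans (featSpan_le_factorSpan.trans factorSpan_le_featSpan_succ)

theorem factorSpan_mono {ci n d d' : ℕ} (h : d ≤ d') : factorSpan ci n d ≤ factorSpan ci n d' := by
  rcases h.eq_or_lt with rfl | h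
  · exact le_rfl
  · exact factorSpan_le_featSpan_succ.trans ((featSpan_mono h).trans featSpan_le_factorSpan)

/-- The kernel position of a neighbour of the centre to the top right. -/
def centered (v : ℕ × ℕ) : Offset := (Fin.ofNat 3 (1 + v.1), Fin.ofNat 3 (1 + v.2))

theorem val_centered {v : ℕ × ℕ} (h : v.1 ≤ 1 ∧ v.2 ≤ 1) :
    ((centered v).1 : ℕ) = 1 + v.1 ∧ ((centered v).2 : ℕ) = 1 + v.2 :=
  ⟨Nat.mod_eq_of_lt (by omega), Nat.mod_eq_of_lt (by omega)⟩

theorem vertexOffset_le (q : Fin 2) (e : Fin 3) :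
    (vertexOffset q e).1 ≤ 1 ∧ (vertexOffset q e).2 ≤ 1 := by revert q e; decide

theorem edgeOffset_le (t : Fin 3) : (edgeOffset t).1 ≤ 1 ∧ (edgeOffset t).2 ≤ 1 := by
  revert t; decide

theorem childOffset_le (q : Fin 2) (c : Fin 4) :
    (childOffset q c).1 ≤ 1 ∧ (childOffset q c).2 ≤ 1 := by revert q c; decide

section Maps

variable {n : ℕ}

/-- The translated input channel `c` (`0` for `u`, `1` for `κ`, `2` for `f`). -/
def chan (n : ℕ) (c : Fin 3) (d : Offset) (z : Fin 3 → Fin n × Fin n → ℝ) : Fin n × Fin n → ℝ :=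
  shift d (z c)

theorem chan_mem (c : Fin 3) (d : Offset) : chan n c d ∈ factorSpan 3 n 0 :=
  shift_mem_factorSpan (channel_mem_featSpan c) d

/-- The gradient of the function with nodal values in channel `c`, on triangles of type `q`. -/
def gradMap (n m ℓ : ℕ) (q : Fin 2) (c : Fin 3) (j : Fin 2)
    (z : Fin 3 → Fin n × Fin n → ℝ) : Fin n × Fin n → ℝ :=
  ∑ e, ((cells m ℓ : ℝ) * baryDir q e j) • chan n c (centered (vertexOffset q e)) z

theorem gradMap_mem (m ℓ : ℕ) (q : Fin 2) (c : Fin 3) (j : Fin 2) :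
    gradMap n m ℓ q c j ∈ factorSpan 3 n 0 := by
  have : gradMap n m ℓ q c j = ∑ e, ((cells m ℓ : ℝ) * baryDir q e j) •
      chan n c (centered (vertexOffset q e)) := by
    funext z; simp only [gradMap, Finset.sum_apply, Pi.smul_apply]
  rw [this]
  exact Submodule.sum_mem _ fun e _ => Submodule.smul_mem _ _ (chan_mem _ _)

/-- The values of the residual at the vertices of the triangles of type `q`. -/
def vertexResidualMap (n m ℓ : ℕ) (q : Fin 2) (e : Fin 3) :
    (Fin 3 → Fin n × Fin n → ℝ) → Fin n × Fin n → ℝ :=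
  chan n 2 (centered (vertexOffset q e)) + ∑ j, gradMap n m ℓ q 1 j * gradMap n m ℓ q 0 j

theorem vertexResidualMap_mem (m ℓ : ℕ) (q : Fin 2) (e : Fin 3) :
    vertexResidualMap n m ℓ q e ∈ featSpan 3 n 1 :=
  add_mem (factorSpan_le_featSpan_succ (chan_mem _ _))
    (Submodule.sum_mem _ fun _ _ =>
      mul_mem_featSpan (gradMap_mem _ _ _ _ _) (gradMap_mem _ _ _ _ _))

/-- The residual images of the triangles of type `q`. -/
def residualMap (n m ℓ : ℕ) (q : Fin 2) :
    (Fin 3 → Fin n × Fin n → ℝ) → Fin n × Fin n → ℝ :=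
  ∑ e, ∑ e', ((√2 / cells m ℓ) ^ 2 * massEntry m ℓ q e e') •
    (vertexResidualMap n m ℓ q e * vertexResidualMap n m ℓ q e')

theorem residualMap_mem (m ℓ : ℕ) (q : Fin 2) : residualMap n m ℓ q ∈ featSpan 3 n 2 :=
  Submodule.sum_mem _ fun _ _ => Submodule.sum_mem _ fun _ _ => Submodule.smul_mem _ _
    (mul_mem_featSpan (featSpan_le_factorSpan (vertexResidualMap_mem _ _ _ _))
      (featSpan_le_factorSpan (vertexResidualMap_mem _ _ _ _)))

/-- The jumps of the gradient of `u` over the edges of a family, up to constant factors. -/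
def gradJumpMap (n : ℕ) (t : Fin 3) : (Fin 3 → Fin n × Fin n → ℝ) → Fin n × Fin n → ℝ :=
  ![chan n 0 (1, 1) - chan n 0 (1, 0) - chan n 0 (2, 2) + chan n 0 (2, 1),
    chan n 0 (1, 1) - chan n 0 (0, 1) - chan n 0 (2, 2) + chan n 0 (1, 2),
    (2 : ℝ) • (chan n 0 (1, 1) - chan n 0 (2, 1) - chan n 0 (1, 2) + chan n 0 (2, 2))] t

theorem gradJumpMap_mem (t : Fin 3) : gradJumpMap n t ∈ factorSpan 3 n 0 := by
  fin_cases t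
  · exact add_mem (sub_mem (sub_mem (chan_mem _ _) (chan_mem _ _)) (chan_mem _ _)) (chan_mem _ _)
  · exact add_mem (sub_mem (sub_mem (chan_mem _ _) (chan_mem _ _)) (chan_mem _ _)) (chan_mem _ _)
  · exact Submodule.smul_mem _ _
      (add_mem (sub_mem (sub_mem (chan_mem _ _) (chan_mem _ _)) (chan_mem _ _)) (chan_mem _ _))

/-- The constant image `1`, translated with zero padding: the indicator of the nodes whose
neighbour in the given direction belongs to the grid. -/
def onesMap (n : ℕ) (d : Offset) (_z : Fin 3 → Fin n × Fin n → ℝ) : Fin n × Fin n → ℝ := shift d 1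

/-- The indicator of the interior edges of a family. -/
def interiorMap (n : ℕ) (t : Fin 3) : (Fin 3 → Fin n × Fin n → ℝ) → Fin n × Fin n → ℝ :=
  ![onesMap n (1, 0) + onesMap n (1, 2) - 1, onesMap n (0, 1) + onesMap n (2, 1) - 1, 1] t

theorem interiorMap_mem (t : Fin 3) : interiorMap n t ∈ factorSpan 3 n 1 := by
  have h : ∀ d, onesMap n d ∈ factorSpan 3 n 1 := fun d =>
    shift_mem_factorSpan (factorSpan_le_featSpan_succ one_mem_factorSpan) d
  fin_cases t
  · exact sub_mem (add_mem (h _) (h _)) one_mem_factorSpan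
  · exact sub_mem (add_mem (h _) (h _)) one_mem_factorSpan
  · exact one_mem_factorSpan

/-- Three times the mean of `κ²` over the edges of a family. -/
def kappaMap (n : ℕ) (t : Fin 3) : (Fin 3 → Fin n × Fin n → ℝ) → Fin n × Fin n → ℝ :=
  chan n 1 (1, 1) * chan n 1 (1, 1) + chan n 1 (1, 1) * chan n 1 (centered (edgeOffset t)) +
    chan n 1 (centered (edgeOffset t)) * chan n 1 (centered (edgeOffset t))

theorem kappaMap_mem (t : Fin 3) : kappaMap n t ∈ featSpan 3 n 1 :=
  add_mem (add_mem (mul_mem_featSpan (chan_mem _ _) (chan_mem _ _))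
    (mul_mem_featSpan (chan_mem _ _) (chan_mem _ _)))
    (mul_mem_featSpan (chan_mem _ _) (chan_mem _ _))

/-- The squared jumps over the edges of a family, times the diameter of the triangles. -/
def edgeMap (n m ℓ : ℕ) (t : Fin 3) : (Fin 3 → Fin n × Fin n → ℝ) → Fin n × Fin n → ℝ :=
  (√2 / cells m ℓ * edgeFactor m ℓ t) • ((interiorMap n t * gradJumpMap n t) *
    (interiorMap n t * gradJumpMap n t) * kappaMap n t)

theorem edgeMap_mem (m ℓ : ℕ) (t : Fin 3) : edgeMap n m ℓ t ∈ featSpan 3 n 4 := by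
  have h : interiorMap n t * gradJumpMap n t ∈ featSpan 3 n 2 :=
    mul_mem_featSpan (interiorMap_mem t) (factorSpan_mono (Nat.zero_le 1) (gradJumpMap_mem t))
  have h' := mul_mem_featSpan (featSpan_le_factorSpan h) (featSpan_le_factorSpan h)
  exact Submodule.smul_mem _ _ (mul_mem_featSpan (featSpan_le_factorSpan h')
    (featSpan_le_factorSpan (featSpan_mono (by norm_num) (kappaMap_mem t))))

/-- The jump images of the triangles of type `q`. -/
def jumpMap (n m ℓ : ℕ) (q : Fin 2) : (Fin 3 → Fin n × Fin n → ℝ) → Fin n × Fin n → ℝ :=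
  ![edgeMap n m ℓ 0 + (fun z => shift (2, 1) (edgeMap n m ℓ 1 z)) + edgeMap n m ℓ 2,
    edgeMap n m ℓ 2 + (fun z => shift (1, 2) (edgeMap n m ℓ 0 z)) + edgeMap n m ℓ 1] q

theorem jumpMap_mem (m ℓ : ℕ) (q : Fin 2) : jumpMap n m ℓ q ∈ featSpan 3 n 5 := by
  have h := fun t => featSpan_mono (by norm_num : 4 ≤ 5) (edgeMap_mem (n := n) m ℓ t)
  have h' := fun t d => factorSpan_le_featSpan_succ
    (shift_mem_factorSpan (edgeMap_mem (n := n) m ℓ t) d)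
  fin_cases q
  · exact add_mem (add_mem (h _) (h' _ _)) (h _)
  · exact add_mem (add_mem (h _) (h' _ _)) (h _)

end Maps

/-! ### Values of the stencil polynomials at nodal images -/

theorem shift_eq_of {n : ℕ} (y : Fin n × Fin n → ℝ) (d : Offset) (p r : Fin n × Fin n)
    (h1 : (p.1 : ℕ) + (d.1 : ℕ) = r.1 + 1) (h2 : (p.2 : ℕ) + (d.2 : ℕ) = r.2 + 1) :
    shift d y p = y r :=
  zeroExt_of_eq y r (by omega) (by omega)

theorem shift_nodalImage {m ℓ : ℕ} (g : Plane → ℝ) (d : Offset) (p : Node m ℓ) (A B : ℕ)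
    (hA : (p.1 : ℕ) + (d.1 : ℕ) = A + 1) (hB : (p.2 : ℕ) + (d.2 : ℕ) = B + 1)
    (hA' : A ≤ cells m ℓ) (hB' : B ≤ cells m ℓ) :
    shift d (nodalImage m ℓ g) p = g (gridPoint m ℓ A B) :=
  shift_eq_of _ d p (⟨A, by omega⟩, ⟨B, by omega⟩) hA hB

/-- Translation of the constant image `1` detects the border of the grid, thanks to the zero
padding. -/
theorem shift_one_eq {n : ℕ} (d : Offset) (p : Fin n × Fin n) :
    shift d (1 : Fin n × Fin n → ℝ) p =
      if (1 ≤ (p.1 : ℕ) + d.1 ∧ (p.1 : ℕ) + d.1 ≤ n) ∧ (1 ≤ (p.2 : ℕ) + d.2 ∧ (p.2 : ℕ) + d.2 ≤ n)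
      then 1 else 0 := by
  simp only [shift, zeroExt, Pi.one_apply, dite_eq_ite]
  refine if_congr ?_ rfl rfl
  omega

section Values

variable {m : ℕ} (hm : 0 < m) {ℓ : ℕ} {κ f u : Plane → ℝ}

/-- The input images of one level. -/
abbrev nodalImages (m ℓ : ℕ) (u κ f : Plane → ℝ) : Fin 3 → Image m ℓ :=
  ![nodalImage m ℓ u, nodalImage m ℓ κ, nodalImage m ℓ f]

theorem chan_vertex (c : Fin 3) (q : Fin 2) (e : Fin 3) (i : Node m ℓ) (hi : InMesh m ℓ i) :
    chan (cells m ℓ + 1) c (centered (vertexOffset q e)) (nodalImages m ℓ u κ f) i =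
      ![u, κ, f] c (triVertex m ℓ q i e) := by
  have h := vertexOffset_le q e
  have h' := val_centered h
  have hi1 := hi.1
  have hi2 := hi.2
  have key : ∀ g : Plane → ℝ, shift (centered (vertexOffset q e)) (nodalImage m ℓ g) i =
      g (triVertex m ℓ q i e) := fun g =>
    shift_nodalImage g _ i _ _ (by omega) (by omega) (by omega) (by omega)
  fin_cases c <;> exact key _

theorem gradMap_eq (c : Fin 3) (q : Fin 2) (j : Fin 2) (i : Node m ℓ) (hi : InMesh m ℓ i) :
    gradMap (cells m ℓ + 1) m ℓ q c j (nodalImages m ℓ u κ f) i =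
      p1Grad m ℓ i.1 i.2 q (![u, κ, f] c) j := by
  rw [gradMap, p1Grad, Finset.sum_apply, WithLp.ofLp_sum, Finset.sum_apply]
  refine Finset.sum_congr rfl fun e _ => ?_
  rw [Pi.smul_apply, chan_vertex c q e i hi]
  simp only [PiLp.smul_apply, smul_eq_mul]
  rw [mul_comm]
  rfl

include hm

theorem residualMap_eq (hκ : IsP1 m ℓ κ) (hf : IsP1 m ℓ f) (hu : IsP1 m ℓ u) (q : Fin 2)
    (i : Node m ℓ) (hi : InMesh m ℓ i) :
    residualMap (cells m ℓ + 1) m ℓ q (nodalImages m ℓ u κ f) i = residualSq m ℓ κ f u q i := by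
  have h : ∀ e, vertexResidualMap (cells m ℓ + 1) m ℓ q e (nodalImages m ℓ u κ f) i =
      f (triVertex m ℓ q i e) + ∑ j, p1Grad m ℓ i.1 i.2 q κ j * p1Grad m ℓ i.1 i.2 q u j := by
    intro e
    simp only [vertexResidualMap, Pi.add_apply, Finset.sum_apply, Pi.mul_apply]
    rw [chan_vertex 2 q e i hi]
    congr 1
    refine Finset.sum_congr rfl fun j _ => ?_
    rw [gradMap_eq 1 q j i hi, gradMap_eq 0 q j i hi]
    rfl
  rw [hκ.residualSq_eq hm hf hu i q, diam_tri hm, Finset.mul_sum]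
  simp only [residualMap, Finset.sum_apply, Pi.smul_apply, Pi.mul_apply, h, smul_eq_mul]
  refine Finset.sum_congr rfl fun e _ => ?_
  rw [Finset.mul_sum]
  refine Finset.sum_congr rfl fun e' _ => ?_
  ring

/-- The stencil polynomials of the edges take the correct values, including `0` at boundary
edges. -/
theorem edgeMap_eq (hκ : IsP1 m ℓ κ) (hu : IsP1 m ℓ u) (t : Fin 3) (i : Node m ℓ)
    (h1 : (i.1 : ℕ) + (edgeOffset t).1 ≤ cells m ℓ)
    (h2 : (i.2 : ℕ) + (edgeOffset t).2 ≤ cells m ℓ) :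
    edgeMap (cells m ℓ + 1) m ℓ t (nodalImages m ℓ u κ f) i =
      √2 / cells m ℓ * edgeSq m ℓ κ u t i.1 i.2 := by
  obtain ⟨⟨a, ha⟩, ⟨b, hb⟩⟩ := i
  have ho := edgeOffset_le t
  have hc := val_centered ho
  have hN : 0 < cells m ℓ := by positivity
  have hk1 : chan (cells m ℓ + 1) 1 (1, 1) (nodalImages m ℓ u κ f) (⟨a, ha⟩, ⟨b, hb⟩) =
      κ (gridPoint m ℓ a b) :=
    shift_nodalImage κ _ _ a b rfl rfl (by omega) (by omega)
  have hk2 : chan (cells m ℓ + 1) 1 (centered (edgeOffset t)) (nodalImages m ℓ u κ f)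
      (⟨a, ha⟩, ⟨b, hb⟩) = κ (gridPoint m ℓ (a + (edgeOffset t).1) (b + (edgeOffset t).2)) :=
    shift_nodalImage κ _ _ _ _ (by simp only; omega) (by simp only; omega) h1 h2
  simp only [edgeMap, kappaMap, Pi.smul_apply, Pi.mul_apply, Pi.add_apply, hk1, hk2, smul_eq_mul]
  simp only at h1 h2
  fin_cases t
  · simp only [edgeOffset, Fin.zero_eta, Matrix.cons_val_zero, add_zero] at h1 h2 ⊢
    have hint : interiorMap (cells m ℓ + 1) 0 (nodalImages m ℓ u κ f) (⟨a, ha⟩, ⟨b, hb⟩) =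
        (if 1 ≤ b then 1 else 0) + (if b + 1 ≤ cells m ℓ then 1 else 0) - 1 := by
      change shift (1, 0) 1 _ + shift (1, 2) 1 _ - 1 = _
      rw [shift_one_eq, shift_one_eq]
      congr 2
      · refine if_congr ?_ rfl rfl
        simp [-Fin.val_fin_le]; omega
      · refine if_congr ?_ rfl rfl
        simp [-Fin.val_fin_le]; omega
    by_cases hbd : b = 0 ∨ b = cells m ℓ
    · rw [edgeSq_eq_zero hm ℓ κ u (Or.inl ⟨rfl, hbd⟩), hint]
      rcases hbd with rfl | rfl
      · rw [if_neg (by omega), if_pos (by omega)]; ring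
      · rw [if_pos (by omega), if_neg (by omega)]; ring
    · rw [hint, if_pos (by omega), if_pos (by omega)]
      obtain ⟨c, rfl⟩ := Nat.exists_eq_succ_of_ne_zero fun h0 => hbd (Or.inl h0)
      rw [(hκ.edgeSq_horizontal hm hu a c fun h0 => hbd (Or.inr h0)).2]
      have hj : gradJumpMap (cells m ℓ + 1) 0 (nodalImages m ℓ u κ f) (⟨a, ha⟩, ⟨c + 1, hb⟩) =
          u (gridPoint m ℓ a (c + 1)) - u (gridPoint m ℓ a c) -
          u (gridPoint m ℓ (a + 1) (c + 2)) + u (gridPoint m ℓ (a + 1) (c + 1)) := by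
        change shift (1, 1) (nodalImage m ℓ u) _ - shift (1, 0) (nodalImage m ℓ u) _ -
          shift (2, 2) (nodalImage m ℓ u) _ + shift (2, 1) (nodalImage m ℓ u) _ = _
        rw [shift_nodalImage u _ _ a (c + 1) rfl rfl (by omega) (by omega),
          shift_nodalImage u _ _ a c rfl rfl (by omega) (by omega),
          shift_nodalImage u _ _ (a + 1) (c + 2) rfl rfl (by omega) (by omega),
          shift_nodalImage u _ _ (a + 1) (c + 1) rfl rfl (by omega) (by omega)]
      rw [hj]
      ring
  · simp only [edgeOffset, Fin.mk_one, Matrix.cons_val_one, Matrix.cons_val_zero, add_zero]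
      at h1 h2 ⊢
    have hint : interiorMap (cells m ℓ + 1) 1 (nodalImages m ℓ u κ f) (⟨a, ha⟩, ⟨b, hb⟩) =
        (if 1 ≤ a then 1 else 0) + (if a + 1 ≤ cells m ℓ then 1 else 0) - 1 := by
      change shift (0, 1) 1 _ + shift (2, 1) 1 _ - 1 = _
      rw [shift_one_eq, shift_one_eq]
      congr 2
      · refine if_congr ?_ rfl rfl
        simp [-Fin.val_fin_le]; omega
      · refine if_congr ?_ rfl rfl
        simp [-Fin.val_fin_le]; omega
    by_cases hbd : a = 0 ∨ a = cells m ℓ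
    · rw [edgeSq_eq_zero hm ℓ κ u (Or.inr ⟨rfl, hbd⟩), hint]
      rcases hbd with rfl | rfl
      · rw [if_neg (by omega), if_pos (by omega)]; ring
      · rw [if_pos (by omega), if_neg (by omega)]; ring
    · rw [hint, if_pos (by omega), if_pos (by omega)]
      obtain ⟨c, rfl⟩ := Nat.exists_eq_succ_of_ne_zero fun h0 => hbd (Or.inl h0)
      rw [(hκ.edgeSq_vertical hm hu c b fun h0 => hbd (Or.inr h0)).2]
      have hj : gradJumpMap (cells m ℓ + 1) 1 (nodalImages m ℓ u κ f) (⟨c + 1, ha⟩, ⟨b, hb⟩) =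
          u (gridPoint m ℓ (c + 1) b) - u (gridPoint m ℓ c b) -
          u (gridPoint m ℓ (c + 2) (b + 1)) + u (gridPoint m ℓ (c + 1) (b + 1)) := by
        change shift (1, 1) (nodalImage m ℓ u) _ - shift (0, 1) (nodalImage m ℓ u) _ -
          shift (2, 2) (nodalImage m ℓ u) _ + shift (1, 2) (nodalImage m ℓ u) _ = _
        rw [shift_nodalImage u _ _ (c + 1) b rfl rfl (by omega) (by omega),
          shift_nodalImage u _ _ c b rfl rfl (by omega) (by omega),
          shift_nodalImage u _ _ (c + 2) (b + 1) rfl rfl (by omega) (by omega),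
          shift_nodalImage u _ _ (c + 1) (b + 1) rfl rfl (by omega) (by omega)]
      rw [hj]
      ring
  · simp only [edgeOffset, Fin.reduceFinMk, Matrix.cons_val] at h1 h2 ⊢
    have hint : interiorMap (cells m ℓ + 1) 2 (nodalImages m ℓ u κ f) (⟨a, ha⟩, ⟨b, hb⟩) = 1 := rfl
    have hj : gradJumpMap (cells m ℓ + 1) 2 (nodalImages m ℓ u κ f) (⟨a, ha⟩, ⟨b, hb⟩) =
        2 * (u (gridPoint m ℓ a b) - u (gridPoint m ℓ (a + 1) b) -
        u (gridPoint m ℓ a (b + 1)) + u (gridPoint m ℓ (a + 1) (b + 1))) := by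
      change 2 * (shift (1, 1) (nodalImage m ℓ u) _ - shift (2, 1) (nodalImage m ℓ u) _ -
        shift (1, 2) (nodalImage m ℓ u) _ + shift (2, 2) (nodalImage m ℓ u) _) = _
      rw [shift_nodalImage u _ _ a b rfl rfl (by omega) (by omega),
        shift_nodalImage u _ _ (a + 1) b rfl rfl (by omega) (by omega),
        shift_nodalImage u _ _ a (b + 1) rfl rfl (by omega) (by omega),
        shift_nodalImage u _ _ (a + 1) (b + 1) rfl rfl (by omega) (by omega)]
    rw [hint, hj, (hκ.edgeSq_diagonal hm hu a b).2]
    ring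

theorem jumpMap_eq (hκ : IsP1 m ℓ κ) (hu : IsP1 m ℓ u) (q : Fin 2) (i : Node m ℓ)
    (hi : InMesh m ℓ i) :
    jumpMap (cells m ℓ + 1) m ℓ q (nodalImages m ℓ u κ f) i = jumpSq m ℓ κ u q i := by
  obtain ⟨h1, h2⟩ := hi
  have E := fun t i => edgeMap_eq hm (f := f) hκ hu t i
  fin_cases q
  · change edgeMap _ m ℓ 0 (nodalImages m ℓ u κ f) i +
      shift (2, 1) (edgeMap _ m ℓ 1 (nodalImages m ℓ u κ f)) i +
      edgeMap _ m ℓ 2 (nodalImages m ℓ u κ f) i = jumpSq m ℓ κ u 0 i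
    rw [jumpSq_lower hm, shift_eq_of _ _ i (⟨i.1 + 1, by omega⟩, i.2) rfl rfl, E 0 i h1 h2.le,
      E 1 (⟨i.1 + 1, by omega⟩, i.2) h1 h2, E 2 i h1 h2]
  · change edgeMap _ m ℓ 2 (nodalImages m ℓ u κ f) i +
      shift (1, 2) (edgeMap _ m ℓ 0 (nodalImages m ℓ u κ f)) i +
      edgeMap _ m ℓ 1 (nodalImages m ℓ u κ f) i = jumpSq m ℓ κ u 1 i
    rw [jumpSq_upper hm, shift_eq_of _ _ i (i.1, ⟨i.2 + 1, by omega⟩) rfl rfl,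
      E 0 (i.1, ⟨i.2 + 1, by omega⟩) h1 h2, E 1 i h1.le h2, E 2 i h1 h2]

end Values

/-! ### The aggregation network -/

/-- Labels of the channels that are aggregated: element residuals for the two types of triangles,
and scaled squared jumps for the three families of edges. -/
abbrev Label : Type := Fin 2 ⊕ Fin 3

/-- The channel of a label. -/
def labelChannel : Label ≃ Fin 5 := finSumFinEquiv

/-- The kernel with which estimator images are passed to the next coarser level: residuals are
summed over the four children of a triangle, squared jumps over the two halves of an edge. The
factors `4` and `2` come from the halved diameter. -/
def aggWeight : Label → Label → Offset → ℝ
  | .inl q =>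
    termWeight (fun _ : Fin 4 => 4) fun c => (.inl (childType q c), centered (childOffset q c))
  | .inr t => termWeight (fun _ : Fin 2 => 2) ![(.inr t, (1, 1)), (.inr t, centered (edgeOffset t))]

/-- The kernel that adds up the contributions to the estimator of a triangle: its residual, and the
squared jumps over its three edges. -/
def outWeight (q : Fin 2) : Label → Offset → ℝ :=
  termWeight (fun _ : Fin 4 => 1)
    (![![(.inl 0, (1, 1)), (.inr 0, (1, 1)), (.inr 1, (2, 1)), (.inr 2, (1, 1))],
      ![(.inl 1, (1, 1)), (.inr 2, (1, 1)), (.inr 0, (1, 2)), (.inr 1, (1, 1))]] q)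

/-- The layer that computes the estimator images of a level from those of the next finer one. -/
def aggLayer (L k : ℕ) (ℓ : Fin L) : LevelOp (fun _ : Fin L => 5) ℓ 5 :=
  if h : (ℓ : ℕ) + 1 = k ∧ k < L then
    .fromFiner false ⟨k, h.2⟩ h.1.symm 0 1 0
      (fun o c d => aggWeight (labelChannel.symm o) (labelChannel.symm c) d) 0
  else .keep

/-- The layers that pass the estimator images down to the level `L - 1 - k`. -/
def aggregate (L : ℕ) : ℕ → CNN (fun _ : Fin L => 5) (fun _ => 5)
  | 0 => .nil _
  | k + 1 => (aggregate L k).append (.single (aggLayer L (L - 1 - k)))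

theorem params_aggregate_le (L k : ℕ) : (aggregate L k).params ≤ 255 * k := by
  induction k with
  | zero => simp [aggregate, CNN.params]
  | succ k ih =>
    rw [aggregate, CNN.params_append, CNN.params_single, mul_add]
    refine add_le_add ih ?_
    refine le_trans (Finset.sum_le_sum fun ℓ _ => ?_) (sum_ite_val_eq_le L (L - 1 - k - 1) 255)
    unfold aggLayer
    split_ifs with h h'
    · simp [LevelOp.params]
    · omega
    · exact Nat.zero_le _
    · exact le_rfl

theorem isAggregation_aggregate (L k : ℕ) : (aggregate L k).IsAggregation := by
  induction k with
  | zero => trivial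
  | succ k ih =>
    refine ih.append ⟨fun ℓ => ?_, trivial⟩
    unfold aggLayer
    split_ifs <;> simp [LevelOp.IsAggregation]

section Aggregate

variable {m : ℕ}

/-- The image on the next coarser level that picks the pixels at the given position. -/
def stride {n n' : ℕ} (d : Offset) (x : Fin n × Fin n → ℝ) : Fin n' × Fin n' → ℝ :=
  fun p => zeroExt x (2 * (p.1 : ℕ) + (d.1 : ℕ) - 1) (2 * (p.2 : ℕ) + (d.2 : ℕ) - 1)

theorem stride_eq_of {n n' : ℕ} (y : Fin n × Fin n → ℝ) (d : Offset) (p : Fin n' × Fin n')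
    (r : Fin n × Fin n) (h1 : 2 * (p.1 : ℕ) + (d.1 : ℕ) = r.1 + 1)
    (h2 : 2 * (p.2 : ℕ) + (d.2 : ℕ) = r.2 + 1) : stride d y p = y r :=
  zeroExt_of_eq y r (by omega) (by omega)

/-- The images with channels labelled by `Label` approximate the residual images and the scaled jump
images of level `ℓ` up to `δ`, wherever there is a triangle or an edge. -/
def ApproxEstimators (m ℓ : ℕ) (κ f u : Plane → ℝ) (δ : ℝ) (y : Label → Image m ℓ) : Prop :=
  (∀ q i, InMesh m ℓ i → |y (.inl q) i - residualSq m ℓ κ f u q i| ≤ δ) ∧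
  ∀ t i, (i.1 : ℕ) + (edgeOffset t).1 ≤ cells m ℓ → (i.2 : ℕ) + (edgeOffset t).2 ≤ cells m ℓ →
    |y (.inr t) i - √2 / cells m ℓ * edgeSq m ℓ κ u t i.1 i.2| ≤ δ

/-- All integrals in the definition of the estimators of level `ℓ` exist. -/
def RegularOn (m ℓ : ℕ) (κ f u : Plane → ℝ) : Prop :=
  EdgeRegular m ℓ κ u ∧ ∀ q i, InMesh m ℓ i →
    IntegrableOn (fun x => (f x + divergence (fun z => κ z • gradient u z) x) ^ 2) (tri m ℓ q i)

/-- The nodes of the next finer level whose triangles are the children of a triangle. -/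
theorem exists_childNode {ℓ : ℕ} (q : Fin 2) (i : Node m ℓ) (hi : InMesh m ℓ i) :
    ∃ j : Fin 4 → Node m (ℓ + 1), ∀ c, InMesh m (ℓ + 1) (j c) ∧
      ((j c).1 : ℕ) = 2 * i.1 + (childOffset q c).1 ∧
      ((j c).2 : ℕ) = 2 * i.2 + (childOffset q c).2 := by
  have h := childOffset_le q
  have hs := cells_succ m ℓ
  obtain ⟨h1, h2⟩ := hi
  refine ⟨fun c => (⟨2 * i.1 + (childOffset q c).1, ?_⟩, ⟨2 * i.2 + (childOffset q c).2, ?_⟩),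
    fun c => ⟨⟨?_, ?_⟩, rfl, rfl⟩⟩ <;> have := h c <;> try dsimp only
  all_goals rw [hs]; omega

/-- Integrability on a level is inherited from the next finer one, since its triangles and edges are
composed of those of the finer level. -/
theorem RegularOn.pred (hm : 0 < m) {ℓ : ℕ} {κ f u : Plane → ℝ} (h : RegularOn m (ℓ + 1) κ f u) :
    RegularOn m ℓ κ f u := by
  refine ⟨(h.1.bisect hm).1, fun q i hi => ?_⟩
  obtain ⟨j, hj⟩ := exists_childNode q i hi
  exact (residualSq_bisect hm q i j (fun c => (hj c).2) fun c => h.2 _ _ (hj c).1).1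

/-- One step of the aggregation. -/
theorem ApproxEstimators.aggregate (hm : 0 < m) {ℓ : ℕ} {κ f u : Plane → ℝ} {δ : ℝ}
    (hr : RegularOn m (ℓ + 1) κ f u) {y : Label → Image m (ℓ + 1)}
    (h : ApproxEstimators m (ℓ + 1) κ f u δ y) :
    ApproxEstimators m ℓ κ f u (16 * δ)
      fun l p => ∑ a, ∑ d, aggWeight l a d * stride d (y a) p := by
  have hs := cells_succ m ℓ
  have hsr : (cells m (ℓ + 1) : ℝ) = 2 * cells m ℓ := by simpa using cells_mul_succ (m := m) ℓ 1
  have hN := cells_pos hm ℓ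
  constructor
  · intro q i hi
    obtain ⟨j, hj⟩ := exists_childNode q i hi
    rw [(residualSq_bisect hm q i j (fun c => (hj c).2) fun c => hr.2 _ _ (hj c).1).2]
    simp only [aggWeight]
    rw [sum_termWeight (S := fun a d => stride d (y a) i), Finset.mul_sum,
      ← Finset.sum_sub_distrib]
    refine (Finset.abs_sum_le_sum_abs _ _).trans
      ((Finset.sum_le_card_nsmul _ _ (4 * δ) fun c _ => ?_).trans_eq ?_)
    · have hc := val_centered (childOffset_le q c)
      rw [stride_eq_of _ _ i (j c) (by rw [(hj c).2.1, hc.1]; ring)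
        (by rw [(hj c).2.2, hc.2]; ring),
        ← mul_sub, abs_mul, abs_of_pos (by norm_num : (0 : ℝ) < 4)]
      exact mul_le_mul_of_nonneg_left (h.1 _ _ (hj c).1) (by norm_num)
    · simp; ring
  · intro t i h1 h2
    have ho := edgeOffset_le t
    have hc := val_centered ho
    have hh1 := i.1.isLt
    have hh2 := i.2.isLt
    let j₁ : Node m (ℓ + 1) := (⟨2 * i.1, by omega⟩, ⟨2 * i.2, by omega⟩)
    let j₂ : Node m (ℓ + 1) :=
      (⟨2 * i.1 + (edgeOffset t).1, by omega⟩, ⟨2 * i.2 + (edgeOffset t).2, by omega⟩)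
    have a1 := h.2 t j₁ (by simp only [j₁]; omega) (by simp only [j₁]; omega)
    have a2 := h.2 t j₂ (by simp only [j₂]; omega) (by simp only [j₂]; omega)
    have hδ : 0 ≤ δ := (abs_nonneg _).trans a1
    rw [(hr.1.bisect hm).2]
    simp only [aggWeight]
    rw [sum_termWeight (S := fun a d => stride d (y a) i), Fin.sum_univ_two]
    change |2 * stride (1, 1) (y (.inr t)) i +
      2 * stride (centered (edgeOffset t)) (y (.inr t)) i - _| ≤ _
    rw [stride_eq_of _ _ i j₁ rfl rfl,
      stride_eq_of _ _ i j₂ (by simp only [j₂, hc.1]; ring) (by simp only [j₂, hc.2]; ring)]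
    have e : √2 / (cells m ℓ : ℝ) = 2 * (√2 / cells m (ℓ + 1)) := by rw [hsr]; field_simp
    rw [e]
    simp only [j₁, j₂] at a1 a2 ⊢
    rw [abs_le] at a1 a2 ⊢
    constructor <;> linarith

/-- The final layer: from residuals and edge contributions to the squared local estimators. -/
theorem ApproxEstimators.abs_sub_etaSq_le (hm : 0 < m) {ℓ : ℕ} {κ f u : Plane → ℝ} {δ : ℝ}
    {y : Label → Image m ℓ} (h : ApproxEstimators m ℓ κ f u δ y) (q : Fin 2) (i : Node m ℓ)
    (hi : InMesh m ℓ i) :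
    |∑ a, ∑ d, outWeight q a d * shift d (y a) i - etaSq m ℓ κ f u q i| ≤ 4 * δ := by
  have hr := h.1 q i hi
  obtain ⟨h1, h2⟩ := hi
  rw [outWeight, sum_termWeight (S := fun a d => shift d (y a) i), Fin.sum_univ_four, etaSq]
  fin_cases q
  · change |1 * shift (1, 1) (y (.inl 0)) i + 1 * shift (1, 1) (y (.inr 0)) i +
      1 * shift (2, 1) (y (.inr 1)) i + 1 * shift (1, 1) (y (.inr 2)) i -
      (residualSq m ℓ κ f u 0 i + jumpSq m ℓ κ u 0 i)| ≤ 4 * δ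
    rw [shift_center, shift_center, shift_center,
      shift_eq_of _ _ i (⟨i.1 + 1, by omega⟩, i.2) rfl rfl, jumpSq_lower hm]
    have g0 := h.2 0 i h1 h2.le
    have g1 := h.2 1 (⟨i.1 + 1, by omega⟩, i.2) h1 h2
    have g2 := h.2 2 i h1 h2
    change |y (.inl 0) i - residualSq m ℓ κ f u 0 i| ≤ δ at hr
    rw [abs_le] at *
    simp only at g1
    constructor <;> linarith
  · change |1 * shift (1, 1) (y (.inl 1)) i + 1 * shift (1, 1) (y (.inr 2)) i +
      1 * shift (1, 2) (y (.inr 0)) i + 1 * shift (1, 1) (y (.inr 1)) i -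
      (residualSq m ℓ κ f u 1 i + jumpSq m ℓ κ u 1 i)| ≤ 4 * δ
    rw [shift_center, shift_center, shift_center,
      shift_eq_of _ _ i (i.1, ⟨i.2 + 1, by omega⟩) rfl rfl, jumpSq_upper hm]
    have g0 := h.2 0 (i.1, ⟨i.2 + 1, by omega⟩) h1 h2
    have g1 := h.2 1 i h1.le h2
    have g2 := h.2 2 i h1 h2
    change |y (.inl 1) i - residualSq m ℓ κ f u 1 i| ≤ δ at hr
    rw [abs_le] at *
    simp only at g0
    constructor <;> linarith

/-- The errors of the aggregated images. -/
theorem eval_aggregate (hm : 0 < m) (σ : ℝ → ℝ) {L : ℕ} (hL : 0 < L) {κ f u : Plane → ℝ} {δ : ℝ}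
    (hr : RegularOn m (L - 1) κ f u) (x : State m (fun _ : Fin L => 5))
    (hx : ApproxEstimators m (L - 1) κ f u δ fun a => x (finest L hL) (labelChannel a))
    (k : ℕ) (ℓ : Fin L) (hℓ : L - 1 ≤ ℓ + k) :
    RegularOn m ℓ κ f u ∧ ApproxEstimators m ℓ κ f u (16 ^ (L - 1 - ℓ) * δ)
      fun a => (aggregate L k).eval σ m x ℓ (labelChannel a) := by
  induction k generalizing ℓ with
  | zero =>
    obtain rfl : ℓ = finest L hL := Fin.ext (by simp only; omega)
    refine ⟨hr, ?_⟩
    simpa [CNN.eval, MultilevelFE.aggregate] using hx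
  | succ k ih =>
    by_cases h : (ℓ : ℕ) + 1 = L - 1 - k ∧ L - 1 - k < L
    · have e : aggLayer L (L - 1 - k) ℓ = .fromFiner false ⟨L - 1 - k, h.2⟩ h.1.symm 0 1 0
        (fun o c d => aggWeight (labelChannel.symm o) (labelChannel.symm c) d) 0 := dif_pos h
      obtain ⟨ih1, ih2⟩ := ih ⟨L - 1 - k, h.2⟩ (by simp only; omega)
      obtain ⟨ℓ, hlt⟩ := ℓ
      simp only at h
      have hk : ∀ s (hs : s < L), ℓ + 1 = s → RegularOn m s κ f u →
          ApproxEstimators m s κ f u (16 ^ (L - 1 - s) * δ)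
            (fun a => (MultilevelFE.aggregate L k).eval σ m x ⟨s, hs⟩ (labelChannel a)) →
          RegularOn m ℓ κ f u ∧ ApproxEstimators m ℓ κ f u (16 ^ (L - 1 - ℓ) * δ)
            fun l p => ∑ a, ∑ d, aggWeight l a d * stride d
              ((MultilevelFE.aggregate L k).eval σ m x ⟨s, hs⟩ (labelChannel a)) p := by
        rintro s hs rfl g1 g2
        refine ⟨g1.pred hm, ?_⟩
        have := g2.aggregate hm g1
        rwa [← mul_assoc, ← pow_succ', show L - 1 - (ℓ + 1) + 1 = L - 1 - ℓ by omega] at this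
      obtain ⟨g1, g2⟩ := hk _ h.2 h.1 ih1 ih2
      refine ⟨g1, ?_⟩
      convert g2 using 2 with l
      funext p
      simp only [MultilevelFE.aggregate, CNN.eval_append, CNN.eval_single, e, LevelOp.eval,
        activate, convStride]
      rw [← labelChannel.sum_comp]
      simp [conv, stride]
    · have e : aggLayer L (L - 1 - k) ℓ = .keep := dif_neg h
      obtain ⟨ih1, ih2⟩ := ih ℓ (by omega)
      refine ⟨ih1, ?_⟩
      simp only [MultilevelFE.aggregate, CNN.eval_append, CNN.eval_single, e, LevelOp.eval]
      exact ih2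

end Aggregate

/-! ### The estimator network -/

/-- The images to be approximated on the finest level: residuals, jumps, and scaled squared jumps
over single edges. The jump images are not needed for the aggregation, which works with edges. -/
def estimatorMaps (n m ℓ : ℕ) : Fin 7 → (Fin 3 → Fin n × Fin n → ℝ) → Fin n × Fin n → ℝ :=
  ![residualMap n m ℓ 0, residualMap n m ℓ 1, jumpMap n m ℓ 0, jumpMap n m ℓ 1,
    edgeMap n m ℓ 0, edgeMap n m ℓ 1, edgeMap n m ℓ 2]

theorem estimatorMaps_mem (n m ℓ : ℕ) (o : Fin 7) : estimatorMaps n m ℓ o ∈ featSpan 3 n 5 := by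
  have h1 := fun q => featSpan_mono (by norm_num : 2 ≤ 5) (residualMap_mem (n := n) m ℓ q)
  have h2 := fun q => jumpMap_mem (n := n) m ℓ q
  have h3 := fun t => featSpan_mono (by norm_num : 4 ≤ 5) (edgeMap_mem (n := n) m ℓ t)
  fin_cases o
  exacts [h1 0, h1 1, h2 0, h2 1, h3 0, h3 1, h3 2]

/-- The position of a label among the images of `estimatorMaps`. -/
def selectChannel : Label → Fin 7
  | .inl q => Fin.castLE (by norm_num) q
  | .inr t => Fin.natAdd 4 t

/-- The layer that drops the jump images of the triangles and creates channels on all levels. -/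
def selectLayer {L : ℕ} (ℓ₀ : Fin L) : CNN (outChannels ℓ₀ 7) (fun _ => 5) :=
  .single fun _ => .vanilla false 1 (fun o c d => if d = (1, 1) ∧
    Fin.castLE (outChannels_le _ _ _) c = selectChannel (labelChannel.symm o) then 1 else 0) 0

theorem params_selectLayer_le {L : ℕ} (ℓ₀ : Fin L) :
    (selectLayer ℓ₀).params ≤ (5 * 7 * 9 + 5) * L := by
  rw [selectLayer, CNN.params_single]
  refine (Finset.sum_le_card_nsmul _ _ (5 * 7 * 9 + 5) fun ℓ _ => ?_).trans_eq ?_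
  · have := outChannels_le ℓ₀ 7 ℓ
    simp only [LevelOp.params]
    omega
  · simp [mul_comm]

/-- On the level `ℓ₀`, the layer picks the channels of the labels. -/
theorem eval_selectLayer {L : ℕ} (ℓ₀ : Fin L) (σ : ℝ → ℝ) (m : ℕ)
    (x : State m (outChannels ℓ₀ 7)) (a : Label) :
    (selectLayer ℓ₀).eval σ m x ℓ₀ (labelChannel a) =
      x ℓ₀ (Fin.cast (outChannels_self ℓ₀ 7).symm (selectChannel a)) := by
  funext p
  simp only [selectLayer, CNN.eval_single, LevelOp.eval, conv_eq_sum_shift, activate]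
  rw [Finset.sum_eq_single (Fin.cast (outChannels_self ℓ₀ 7).symm (selectChannel a)),
    Finset.sum_eq_single (1, 1)]
  · have : Fin.castLE (outChannels_le ℓ₀ 7 ℓ₀)
        (Fin.cast (outChannels_self ℓ₀ 7).symm (selectChannel a)) = selectChannel a := Fin.ext rfl
    simp [this, shift_center]
  · intro d _ hd
    simp [hd]
  · simp
  · intro c _ hc
    refine Finset.sum_eq_zero fun d _ => ?_
    rw [if_neg, zero_mul]
    rintro ⟨-, h⟩
    rw [Equiv.symm_apply_apply] at h
    have h' := Fin.ext_iff.1 h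
    exact hc (Fin.ext h')
  · simp

/-- From the images on the finest level to the squared local estimators on all levels. -/
def aggregation (L : ℕ) (hL : 0 < L) : CNN (outChannels (finest L hL) 7) (fun _ => 2) :=
  (selectLayer (finest L hL)).append ((aggregate L (L - 1)).append
    (stencilLayer L labelChannel (Equiv.refl (Fin 2)) false outWeight 0))

theorem isAggregation_aggregation (L : ℕ) (hL : 0 < L) : (aggregation L hL).IsAggregation :=
  CNN.IsAggregation.append ⟨fun _ => rfl, trivial⟩
    ((isAggregation_aggregate L (L - 1)).append ⟨fun _ => rfl, trivial⟩)

theorem params_aggregation_le (L : ℕ) (hL : 0 < L) : (aggregation L hL).params ≤ 667 * L := by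
  rw [aggregation, CNN.params_append, CNN.params_append, params_stencilLayer]
  have h1 := params_selectLayer_le (finest L hL)
  have h2 := params_aggregate_le L (L - 1)
  omega

/-- The number of parameters per level does not depend on the activation function, the mesh, the
stencil polynomials, the bound on the inputs, and the accuracy. -/
theorem exists_params_cnn_featSpan (ci co d : ℕ) :
    ∃ P : ℕ, ∀ σ : ℝ → ℝ, Admissible σ → ∀ (m L : ℕ) (ℓ₀ : Fin L)
      (f : Fin co → (Fin ci → Image m ℓ₀) → Image m ℓ₀),
      (∀ o, f o ∈ featSpan ci (cells m ℓ₀ + 1) d) → ∀ R ε : ℝ, 0 < ε →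
      ∃ Φ : CNN (fun _ : Fin L => ci) (outChannels ℓ₀ co), Φ.params ≤ P * L ∧
        ∀ x : State m (fun _ : Fin L => ci), (∀ c p, |x ℓ₀ c p| ≤ R) →
          ∀ o p, |Φ.eval σ m x ℓ₀ o p - f (Fin.castLE (outChannels_le _ _ _) o) (x ℓ₀) p| ≤ ε :=
  ⟨_, fun _ hσ m _ ℓ₀ f hf R _ hε => hσ.exists_cnn_of_mem_featSpan m ℓ₀ f hf R hε⟩

section Main

variable {m L : ℕ} {κ f u : Plane → ℝ} {δ : ℝ}

/-- If the first network approximates residuals and edge contributions on the finest level, then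
the aggregation approximates the squared local estimators on all levels. -/
theorem abs_eval_aggregation_sub_le (hm : 0 < m) (σ : ℝ → ℝ) (hL : 0 < L)
    (hr : RegularOn m (L - 1) κ f u) (x : State m (outChannels (finest L hL) 7))
    (hx : ApproxEstimators m (L - 1) κ f u δ fun a =>
      x (finest L hL) (Fin.cast (outChannels_self _ 7).symm (selectChannel a)))
    (ℓ : Fin L) (q : Fin 2) (i : Node m ℓ) (hi : InMesh m ℓ i) :
    |(aggregation L hL).eval σ m x ℓ q i - etaSq m ℓ κ f u q i| ≤
      4 * (16 ^ (L - 1 - ℓ) * δ) := by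
  have h := (eval_aggregate hm σ hL hr ((selectLayer (finest L hL)).eval σ m x)
    (by simpa only [eval_selectLayer] using hx) (L - 1) ℓ (by omega)).2
  have e := eval_stencilLayer σ m L labelChannel (Equiv.refl (Fin 2)) false outWeight 0
    ((aggregate L (L - 1)).eval σ m ((selectLayer (finest L hL)).eval σ m x)) ℓ q i
  rw [aggregation, CNN.eval_append, CNN.eval_append]
  rw [Equiv.refl_apply] at e
  rw [e, activate, if_neg (by simp), Pi.zero_apply, add_zero]
  exact h.abs_sub_etaSq_le hm q i hi

/-- The images in `estimatorMaps` are the residuals and jumps of the estimator. -/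
theorem approxEstimators_of_estimatorMaps (hm : 0 < m) {ℓ : ℕ} (hκ : IsP1 m ℓ κ)
    (hf : IsP1 m ℓ f) (hu : IsP1 m ℓ u) (y : Fin 7 → Image m ℓ)
    (hy : ∀ o i, |y o i - estimatorMaps (cells m ℓ + 1) m ℓ o (nodalImages m ℓ u κ f) i| ≤ δ) :
    ApproxEstimators m ℓ κ f u δ (fun a => y (selectChannel a)) ∧
      ∀ (q : Fin 2) i, InMesh m ℓ i →
        |y (Fin.castLE (by norm_num) q) i - residualSq m ℓ κ f u q i| ≤ δ ∧
        |y (Fin.castLE (by norm_num) (Fin.natAdd 2 q)) i - jumpSq m ℓ κ u q i| ≤ δ := by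
  have h1 : ∀ (q : Fin 2) i, InMesh m ℓ i →
      |y (Fin.castLE (by norm_num) q) i - residualSq m ℓ κ f u q i| ≤ δ := by
    intro q i hi
    rw [← residualMap_eq hm hκ hf hu q i hi]
    fin_cases q
    exacts [hy 0 i, hy 1 i]
  refine ⟨⟨h1, fun t i g1 g2 => ?_⟩, fun q i hi => ⟨h1 q i hi, ?_⟩⟩
  · rw [← edgeMap_eq hm (f := f) hκ hu t i g1 g2]
    fin_cases t
    exacts [hy 4 i, hy 5 i, hy 6 i]
  · rw [← jumpMap_eq hm (f := f) hκ hu q i hi]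
    fin_cases q
    exacts [hy 2 i, hy 3 i]

/-- After the prolongation, the finest level holds the nodal values of `u`, `κ` and `f`. -/
theorem eval_prolong_finest (hm : 0 < m) (hL : 0 < L) (σ : ℝ → ℝ) (u : ∀ ℓ : Fin L, Image m ℓ)
    (κ f : Plane → ℝ) :
    (prolong L (L - 1)).eval σ m (inputImages m L u κ f) (finest L hL) =
      nodalImages m (L - 1) (multilevelFun m L u) κ f := by
  rw [eval_prolong u hm σ _ (fun ℓ => rfl), if_pos le_rfl]
  have : partialFun m L u (finest L hL) = multilevelFun m L u := funext (partialFun_last u)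
  rw [this]
  rfl

theorem abs_nodalImages_le {ℓ : ℕ} {R : ℝ} (hu : ∀ x, |u x| ≤ R) (hκ : ∀ x, |κ x| ≤ R)
    (hf : ∀ x, |f x| ≤ R) (c : Fin 3) (p : Node m ℓ) : |nodalImages m ℓ u κ f c p| ≤ R := by
  fin_cases c
  exacts [hu _, hκ _, hf _]

end Main

end MultilevelFE

end

open MultilevelFE

theorem mainTheorem7 :
    ∃ C : ℝ, 0 < C ∧
      ∀ (σ : ℝ → ℝ), Admissible σ →
      ∀ (m L : ℕ) (_hm : 0 < m) (hL : 0 < L) (ε M : ℝ), 0 < ε → 0 < M →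
      -- the network is `Φ` followed by the aggregation `A`; `Φ` outputs images on the finest
      -- level only, among them the channels `rc q` and `jc q` for `q = 0, 1`
      ∃ (c : Fin L → ℕ) (Φ : CNN (fun _ : Fin L => 3) c) (A : CNN c (fun _ : Fin L => 2))
        (rc jc : Fin 2 → Fin (c (finest L hL))),
        (∀ ℓ : Fin L, ℓ ≠ finest L hL → c ℓ = 0) ∧
        A.IsAggregation ∧
        ((Φ.append A).params : ℝ) ≤ C * L ∧
        ∀ (IV : ∀ ℓ : Fin L, Set (Node m ℓ)) (u : ∀ ℓ : Fin L, Image m ℓ)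
          (κ f : Image m (L - 1)),
          (∀ (ℓ : Fin L) (i : Node m ℓ), i ∉ IV ℓ → u ℓ i = 0) →
          (∀ (ℓ : Fin L) (i : Node m ℓ), |u ℓ i| ≤ M) →
          (∀ i, |κ i| ≤ M) → (∀ i, |f i| ≤ M) →
          -- masked output versus estimator image, in the maximum norm, on every level
          (∀ ℓ : Fin L,
            ‖mask m ℓ (IV ℓ) *
                (Φ.append A).eval σ m
                  (inputImages m L u (feFun m (L - 1) κ) (feFun m (L - 1) f)) ℓ
              - etaSqImage m ℓ (IV ℓ) (feFun m (L - 1) κ) (feFun m (L - 1) f)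
                  (multilevelFun m L u)‖ ≤ ε) ∧
          -- residual and jump images on the finest level
          (∀ (q : Fin 2) (i : Node m (L - 1)), InMesh m (L - 1) i →
            |Φ.eval σ m (inputImages m L u (feFun m (L - 1) κ) (feFun m (L - 1) f))
                (finest L hL) (rc q) i
              - residualSq m (L - 1) (feFun m (L - 1) κ) (feFun m (L - 1) f)
                  (multilevelFun m L u) q i| ≤ ε ∧
            |Φ.eval σ m (inputImages m L u (feFun m (L - 1) κ) (feFun m (L - 1) f))
                (finest L hL) (jc q) i
              - jumpSq m (L - 1) (feFun m (L - 1) κ) (multilevelFun m L u) q i| ≤ ε) := by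
  obtain ⟨P, hP⟩ := exists_params_cnn_featSpan 3 7 5
  refine ⟨((165 + P + 667 : ℕ) : ℝ), Nat.cast_pos.2 (by omega), ?_⟩
  intro σ hσ m L hm hL ε M hε hM
  -- the error on the finest level grows at most by a factor `4 * 16 ^ L` in the aggregation
  obtain ⟨δ, hδ, hδε⟩ : ∃ δ > 0, 4 * (16 ^ L * δ) = ε :=
    ⟨ε / (4 * 16 ^ L), by positivity, by field_simp⟩
  let R : ℝ := max (∑ ℓ : Fin L, Fintype.card (Node m ℓ) * M) (Fintype.card (Node m (L - 1)) * M)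
  obtain ⟨N, hNp, hN⟩ := hP σ hσ m L (finest L hL)
    (estimatorMaps (cells m (L - 1) + 1) m (L - 1)) (estimatorMaps_mem _ m (L - 1)) R δ hδ
  refine ⟨outChannels (finest L hL) 7, (prolong L (L - 1)).append N, aggregation L hL,
    fun q => Fin.cast (outChannels_self _ 7).symm (Fin.castLE (by norm_num) q),
    fun q => Fin.cast (outChannels_self _ 7).symm (Fin.castLE (by norm_num) (Fin.natAdd 2 q)),
    fun ℓ h => if_neg h, isAggregation_aggregation L hL, ?_, ?_⟩
  · rw [CNN.params_append, CNN.params_append]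
    norm_cast
    have h1 : (prolong L (L - 1)).params ≤ 165 * L :=
      (params_prolong_le L (L - 1)).trans (Nat.mul_le_mul_left _ (Nat.sub_le _ _))
    have h2 := params_aggregation_le L hL
    linarith
  intro IV u κ f _ hu hκ hf
  have pκ := isP1_feFun hm κ
  have pf := isP1_feFun hm f
  have pu := isP1_multilevelFun hm u
  have hr : RegularOn m (L - 1) (feFun m (L - 1) κ) (feFun m (L - 1) f) (multilevelFun m L u) :=
    ⟨pκ.edgeRegular hm pu, fun q i _ => pκ.integrableOn_residual hm pf pu i q⟩
  set x := inputImages m L u (feFun m (L - 1) κ) (feFun m (L - 1) f)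
  have hx := eval_prolong_finest hm hL σ u (feFun m (L - 1) κ) (feFun m (L - 1) f)
  have hy := hN ((prolong L (L - 1)).eval σ m x) (by
    rw [hx]
    exact abs_nodalImages_le (fun z => (abs_multilevelFun_le hu z).trans (le_max_left _ _))
      (fun z => (abs_feFun_le hκ z).trans (le_max_right _ _))
      (fun z => (abs_feFun_le hf z).trans (le_max_right _ _)))
  rw [hx, ← CNN.eval_append] at hy
  obtain ⟨h1, h2⟩ := approxEstimators_of_estimatorMaps hm pκ pf pu
    (fun o => ((prolong L (L - 1)).append N).eval σ m x (finest L hL)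
      (Fin.cast (outChannels_self _ 7).symm o)) fun o i => hy _ i
  have hδ' : ∀ k ≤ L, 4 * (16 ^ k * δ) ≤ ε := fun k hk => by
    rw [← hδε]
    gcongr
    norm_num
  have hδ'' : δ ≤ ε := by linarith [hδ' 0 (Nat.zero_le _), pow_zero (16 : ℝ)]
  refine ⟨fun ℓ => ?_, fun q i hi => ⟨(h2 q i hi).1.trans hδ'', (h2 q i hi).2.trans hδ''⟩⟩
  rw [pi_norm_le_iff_of_nonneg hε.le]
  intro q
  rw [pi_norm_le_iff_of_nonneg hε.le]
  intro i
  rw [Real.norm_eq_abs, Pi.sub_apply, Pi.sub_apply, Pi.mul_apply, Pi.mul_apply, mask, etaSqImage]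
  split_ifs with h
  · rw [one_mul, CNN.eval_append]
    exact (abs_eval_aggregation_sub_le hm σ hL hr _ h1 ℓ q i h.1).trans
      (hδ' _ (by omega))
  · simpa using hε.le
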